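/- A flow network is a finite directed graph $(V,E)$ with a source $s\in V$, a terminal $t\in V$ and capacities $c\colon E\to\mathbb N$. An $(s,t)$-flow of demand $d\in\mathbb N$ is a directed path from $s$ to $t$ all of whose edges have capacity at least $d$. A family $F_1,\dots,F_k$ of flows with demands $d_1,\dots,d_k$ is valid if $\sum_{i:\,e\in E(F_i)}d_i\le c(e)$ for every $e\in E$. An update flow network $G$ with $k$ flow pairs is a flow network together with pairs $P_i=(F_i^o,F_i^u)$, $i\in[k]$, of $(s,t)$-flows of demand $d_i$ such that $(F^o_i)_i$ and $(F^u_i)_i$ are valid and every vertex and every edge of the network lies on one of these $2k$ paths; it is acyclic if $(V,E)$ is. Put $|G|=|V|+|E|$. Resolving an update $(v,P_i)\in V\times\{P_1,\dots,P_k\}$ deactivates, for the $i$-th pair, the edge of $F_i^o$ leaving $v$ and activates the edge of $F_i^u$ leaving $v$ (an edge of both paths stays active); initially exactly the edges of $F_i^o$ are active. A set $U$ of resolved updates is consistent if for every $i$ the active edges of the $i$-th pair contain exactly one $(s,t)$-flow $T_{P_i,U}$ of demand $d_i$, and the family $(T_{P_i,U})_i$ with the demands $d_i$ is valid. A feasible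 update sequence is an ordering of all $k|V|$ updates such that, after each step, the set of the updates resolved so far is consistent. Theorem. There is an algorithm (one program for a unit-cost random access machine on natural numbers with addition and truncated subtraction, but without multiplication) that, given an acyclic update flow network $G$ with $k$ flow pairs (as lists of its edges with capacities, its demands and its $2k$ paths), outputs a feasible update sequence if one exists, and otherwise reports that there is none. Its running time is $O(2^{O(k\log k)}\,|G|)$, i.e. at most $C\cdot 2^{Ck\log_2 k}\cdot(|V|+|E|)$ steps for an absolute constant $C$. -/

import Mathlib

/-! ## Flow networks and update flow networks -/

/-- The edges `E(p)` of a directed path `p`, written as the list of its vertices. -/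
def pathEdges {V : Type*} (p : List V) : List (V × V) := p.zip p.tail

/-- A flow network on the finite vertex set `V`: a set of directed edges, a source, a terminal, and
edge capacities (only the values of `c` on `E` matter). -/
structure FlowNetwork (V : Type*) where
  E : Finset (V × V)
  s : V
  t : V
  c : V × V → ℕ

namespace FlowNetwork

variable {V : Type*}

/-- The list of vertices `p` is an `(s,t)`-flow of capacity `d`: a directed path from `s` to `t` in
the network, all of whose edges have capacity at least `d`. -/
structure IsFlow (N : FlowNetwork V) (d : ℕ) (p : List V) : Prop where
  head : p.head? = some N.s
  last : p.getLast? = some N.t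
  nodup : p.Nodup
  edges : ∀ e ∈ pathEdges p, e ∈ N.E
  cap : ∀ e ∈ pathEdges p, d ≤ N.c e

/-- The family `F` of paths with demands `d` is valid: no edge carries more than its capacity. -/
def IsValid [DecidableEq V] (N : FlowNetwork V) {k : ℕ} (d : Fin k → ℕ) (F : Fin k → List V) :
    Prop :=
  ∀ e ∈ N.E, ∑ i with e ∈ pathEdges (F i), d i ≤ N.c e

/-- There is no directed cycle. -/
def Acyclic (N : FlowNetwork V) : Prop :=
  ∀ v, ¬ Relation.TransGen (fun u w => (u, w) ∈ N.E) v v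

/-- The size `|V| + |E|`. -/
def size [Fintype V] (N : FlowNetwork V) : ℕ := Fintype.card V + N.E.card

end FlowNetwork

/-- An update flow network with `k` update flow pairs `(old i, new i)` of demand `d i`. The old flows
are jointly valid, so are the update flows, and all vertices and edges come from these flows. -/
structure UpdateFlowNetwork (V : Type*) [DecidableEq V] (k : ℕ) extends FlowNetwork V where
  d : Fin k → ℕ
  old : Fin k → List V
  new : Fin k → List V
  old_flow : ∀ i, toFlowNetwork.IsFlow (d i) (old i)
  new_flow : ∀ i, toFlowNetwork.IsFlow (d i) (new i)
  old_valid : toFlowNetwork.IsValid d old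
  new_valid : toFlowNetwork.IsValid d new
  vertex_cover : ∀ v, ∃ i, v ∈ old i ∨ v ∈ new i
  edge_cover : ∀ e ∈ E, ∃ i, e ∈ pathEdges (old i) ∨ e ∈ pathEdges (new i)

namespace UpdateFlowNetwork

variable {V : Type*} [DecidableEq V] {k : ℕ}

/-- The network of the edges of the `i`-th pair that are active once the updates in `U` are resolved.
Resolving `(v, i)` deactivates the edge of `old i` leaving `v` and activates the edge of `new i`
leaving `v`; an edge of both paths is thus active all the time. -/
def active (G : UpdateFlowNetwork V k) (i : Fin k) (U : Finset (V × Fin k)) : FlowNetwork V where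
  E := ((pathEdges (G.old i)).toFinset.filter fun e => (e.1, i) ∉ U) ∪
    ((pathEdges (G.new i)).toFinset.filter fun e => (e.1, i) ∈ U)
  s := G.s
  t := G.t
  c := G.c

/-- `T` is the unique `(s,t)`-flow of the `i`-th pair on the edges active after `U`. -/
def IsTransientFlow (G : UpdateFlowNetwork V k) (i : Fin k) (U : Finset (V × Fin k))
    (T : List V) : Prop :=
  (G.active i U).IsFlow (G.d i) T ∧ ∀ T', (G.active i U).IsFlow (G.d i) T' → T' = T

/-- The consistency rule: after `U` every pair has a (unique) transient flow, and together these
flows respect all capacities. -/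
def Consistent (G : UpdateFlowNetwork V k) (U : Finset (V × Fin k)) : Prop :=
  ∃ T : Fin k → List V, (∀ i, G.IsTransientFlow i U (T i)) ∧ G.IsValid G.d T

/-- `σ` is a feasible update sequence: an ordering of all updates `(v, i)` such that the consistency
rule holds after every step. -/
structure Feasible (G : UpdateFlowNetwork V k) (σ : List (V × Fin k)) : Prop where
  nodup : σ.Nodup
  complete : ∀ u, u ∈ σ
  consistent : ∀ j, 1 ≤ j → j ≤ σ.length → G.Consistent (σ.take j).toFinset

/-- An instance written as a list of numbers: `|V|, |E|, k, s, t`; then tail, head and capacity of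
every edge, the edges being listed in the order `es`; then for every pair its demand, followed by
the old path and the new path, each as its number of vertices and the vertices in order. -/
def encode {n : ℕ} (G : UpdateFlowNetwork (Fin n) k) (es : List (Fin n × Fin n)) : List ℕ :=
  [n, es.length, k, (G.s : ℕ), (G.t : ℕ)] ++
    es.flatMap (fun e => [(e.1 : ℕ), (e.2 : ℕ), G.c e]) ++
    (List.finRange k).flatMap fun i =>
      [G.d i] ++ ((G.old i).length :: (G.old i).map fun v => (v : ℕ)) ++
        ((G.new i).length :: (G.new i).map fun v => (v : ℕ))

/-- An answer written as a list of numbers: `0` for "there is no feasible update sequence", and `1`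
followed by the updates (vertex, index of the pair) in order for an update sequence. -/
def encodeAnswer {n : ℕ} : Option (List (Fin n × Fin k)) → List ℕ
  | none => [0]
  | some σ => 1 :: σ.flatMap fun u => [(u.1 : ℕ), (u.2 : ℕ)]

end UpdateFlowNetwork

/-! ## Random access machines

A unit-cost random access machine over the natural numbers, programmed by structured programs. A
program uses finitely many arrays with random access; registers are array cells with a constant
index. The only arithmetic is addition and truncated subtraction; there is no multiplication. -/

namespace RAM

/-- The memory: `s a i` is the content of cell `i` of array `a`. -/
abbrev Store := ℕ → ℕ → ℕ

inductive Expr where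
  | lit (c : ℕ)
  | get (a : ℕ) (i : Expr)
  | add (x y : Expr)
  | sub (x y : Expr)

def Expr.eval (s : Store) : Expr → ℕ
  | .lit c => c
  | .get a i => s a (i.eval s)
  | .add x y => x.eval s + y.eval s
  | .sub x y => x.eval s - y.eval s

/-- The number of elementary operations in the evaluation of an expression. -/
def Expr.cost : Expr → ℕ
  | .lit _ => 1
  | .get _ i => i.cost + 1
  | .add x y => x.cost + y.cost + 1
  | .sub x y => x.cost + y.cost + 1

/-- Programs. `set a i x` stores `x` in cell `i` of array `a`; conditions hold if they are nonzero. -/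
inductive Prog where
  | skip
  | set (a : ℕ) (i x : Expr)
  | seq (p q : Prog)
  | cond (b : Expr) (p q : Prog)
  | loop (b : Expr) (p : Prog)

/-- `Exec p s s' t`: started with memory `s`, the program `p` halts with memory `s'` after exactly
`t` elementary steps. -/
inductive Exec : Prog → Store → Store → ℕ → Prop where
  | skip (s : Store) : Exec .skip s s 1
  | set (s : Store) (a : ℕ) (i x : Expr) :
      Exec (.set a i x) s (Function.update s a (Function.update (s a) (i.eval s) (x.eval s)))
        (i.cost + x.cost + 1)
  | seq {s s₁ s₂ : Store} {t₁ t₂ : ℕ} {p q : Prog} :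
      Exec p s s₁ t₁ → Exec q s₁ s₂ t₂ → Exec (.seq p q) s s₂ (t₁ + t₂)
  | condTrue {s s₁ : Store} {t : ℕ} {b : Expr} {p q : Prog} :
      b.eval s ≠ 0 → Exec p s s₁ t → Exec (.cond b p q) s s₁ (b.cost + 1 + t)
  | condFalse {s s₁ : Store} {t : ℕ} {b : Expr} {p q : Prog} :
      b.eval s = 0 → Exec q s s₁ t → Exec (.cond b p q) s s₁ (b.cost + 1 + t)
  | loopTrue {s s₁ s₂ : Store} {t₁ t₂ : ℕ} {b : Expr} {p : Prog} :
      b.eval s ≠ 0 → Exec p s s₁ t₁ → Exec (.loop b p) s₁ s₂ t₂ →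
        Exec (.loop b p) s s₂ (b.cost + 1 + t₁ + t₂)
  | loopFalse {s : Store} {b : Expr} {p : Prog} :
      b.eval s = 0 → Exec (.loop b p) s s (b.cost + 1)

/-- The initial memory: array `0` starts with the input, everything else is `0`. -/
def initial (x : List ℕ) : Store := fun a i => if a = 0 then x.getD i 0 else 0

/-- On input `x`, the program halts after exactly `t` steps with output `y`: array `1` starts with the
length of `y`, followed by the entries of `y`. -/
def Computes (p : Prog) (x y : List ℕ) (t : ℕ) : Prop :=
  ∃ s, Exec p (initial x) s t ∧ s 1 0 = y.length ∧ ∀ j < y.length, s 1 (j + 1) = y.getD j 0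

end RAM

/-!
Why update sequences can be found in time `2 ^ O(k log k) · |G|`.

Resolving an update `(v, i)` matters only if both paths of pair `i` leave `v` (`Branches`). Along a
topological order `L` of the vertices, such branching vertices cut the two paths of a pair into
blocks, and every position of `L` lies in one block of each pair (`block`). If all updates without
an old edge are performed first and those without a new edge last, the active edges always contain
exactly one flow: it follows, at every position, the new path if the block of the position has been
switched, and the old one otherwise (`Uses`, `IsTopo.exists_transientFlow`). In an arbitrary
feasible sequence the flow has to contain the same edges (`IsTopo.uses_mem_of_flow`). So the
capacities at a vertex depend only on the order in which the `k` blocks that meet its position are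
switched (`OkKey`), and there are at most `k ^ k` rankings of the pairs to consider.

A feasible sequence yields an admissible ranking at every position (`Feasible.okKey`), and the
rankings at consecutive positions agree on the pairs whose block does not change (`Compat`).
Conversely, such local rankings can be amalgamated: going through the positions from left to right,
the blocks that end disappear from the ranking, and those that start are inserted into a global list
right after their predecessor in the local ranking, so the list of all blocks induces every local
ranking (`VisitInv.insert`, `walkProg_spec`). Switching the blocks in the order of this list is
feasible (`feasible_of_okKey`). Hence a sequence exists iff there is a compatible choice of
admissible rankings, which dynamic programming over the positions decides (`Good`, `goodProg_spec`).

The program reads the network, finds a topological order by Kahn's algorithm, fills the table of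
good states and walks through it while it maintains the global list as a linked list. A state is a
number below `k ^ k` whose digits in base `k` are the ranks of the pairs. Turning ties into an order
by the indices of the pairs gives keys below `k ^ 2` (`stateKey`); then only `k ^ 2 + 1` thresholds
have to be tested. Two-dimensional tables are stored in rows of a common length whose multiples are
computed in advance, since the machine cannot multiply. Correctness and running time are proved
together in a program logic (`Runs`), in which the loop rule bounds the time of a loop by the
product of the time of a round and a bound on the number of rounds.
-/

namespace RAM

/-! ### A program logic with time bounds -/

/-- Storing `x` in cell `i` of array `a`. -/
def upd (s : Store) (a i x : ℕ) : Store := Function.update s a (Function.update (s a) i x)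

@[simp] lemma upd_same (s : Store) (a i x j : ℕ) :
    upd s a i x a j = if j = i then x else s a j := by
  simp [upd, Function.update_apply]

@[simp] lemma upd_of_ne (s : Store) {a b : ℕ} (i x : ℕ) (h : b ≠ a) : upd s a i x b = s b := by
  simp [upd, h]

/-- `Runs p s T Q`: started in `s`, the program `p` halts after at most `T` steps in a memory
satisfying `Q`. -/
def Runs (p : Prog) (s : Store) (T : ℕ) (Q : Store → Prop) : Prop :=
  ∃ s' t, Exec p s s' t ∧ t ≤ T ∧ Q s'

lemma Runs.imp {p s T} {Q Q' : Store → Prop} (h : Runs p s T Q) (hQ : ∀ s', Q s' → Q' s') :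
    Runs p s T Q' := by
  obtain ⟨s', t, h1, h2, h3⟩ := h
  exact ⟨s', t, h1, h2, hQ _ h3⟩

lemma Runs.le {p s T T' Q} (h : Runs p s T Q) (hT : T ≤ T') : Runs p s T' Q := by
  obtain ⟨s', t, h1, h2, h3⟩ := h
  exact ⟨s', t, h1, h2.trans hT, h3⟩

lemma Runs.skip {s : Store} {Q : Store → Prop} (h : Q s) : Runs .skip s 1 Q :=
  ⟨s, 1, .skip s, le_rfl, h⟩

lemma Runs.set {s : Store} {a : ℕ} {i x : Expr} {Q : Store → Prop}
    (h : Q (upd s a (i.eval s) (x.eval s))) :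
    Runs (.set a i x) s (i.cost + x.cost + 1) Q :=
  ⟨_, _, .set s a i x, le_rfl, h⟩

lemma Runs.seq {p q : Prog} {s : Store} {T₁ T₂ : ℕ} {Q : Store → Prop}
    (h : Runs p s T₁ fun s₁ => Runs q s₁ T₂ Q) : Runs (.seq p q) s (T₁ + T₂) Q := by
  obtain ⟨s₁, t₁, h1, h2, s₂, t₂, h3, h4, h5⟩ := h
  exact ⟨s₂, _, .seq h1 h3, by omega, h5⟩

/-- The bound adds up both branches. This costs a constant factor and keeps the bounds in the rules
free of maxima. -/
lemma Runs.cond {b : Expr} {p q : Prog} {s : Store} {T₁ T₂ : ℕ} {Q : Store → Prop}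
    (h1 : b.eval s ≠ 0 → Runs p s T₁ Q) (h2 : b.eval s = 0 → Runs q s T₂ Q) :
    Runs (.cond b p q) s (b.cost + 1 + (T₁ + T₂)) Q := by
  by_cases hb : b.eval s = 0
  · obtain ⟨s', t, h3, h4, h5⟩ := h2 hb
    exact ⟨s', _, .condFalse hb h3, by omega, h5⟩
  · obtain ⟨s', t, h3, h4, h5⟩ := h1 hb
    exact ⟨s', _, .condTrue hb h3, by omega, h5⟩

/-- The content of register `a`. -/
abbrev reg (a : ℕ) : Expr := .get a (.lit 0)

/-- Storing the value of `x` in register `a`. -/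
abbrev setReg (a : ℕ) (x : Expr) : Prog := .set a (.lit 0) x

/-- The loop that runs `p` with register `v` counting up from `0` as long as `v < b`. -/
def forTo (v : ℕ) (b : Expr) (p : Prog) : Prog :=
  .seq (setReg v (.lit 0))
    (.loop (.sub b (reg v)) (.seq p (setReg v (.add (reg v) (.lit 1)))))

/-- Invariant rule for counting loops. The number `n` of rounds is only required to be bounded by
some `X ≥ 1`, so that the resulting time bound is a product. -/
lemma Runs.forTo {v : ℕ} {b : Expr} {p : Prog} {s : Store} {T : ℕ} {Q : Store → Prop}
    (n X : ℕ) (hX : 1 ≤ X) (hn : n ≤ X) (I : ℕ → Store → Prop)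
    (h0 : I 0 (upd s v 0 0))
    (hb : ∀ j s, I j s → s v 0 = j → b.eval s = n)
    (hstep : ∀ j s, j < n → I j s → s v 0 = j →
      Runs p s T fun s' => s' v 0 = j ∧ I (j + 1) (upd s' v 0 (j + 1)))
    (hQ : ∀ s, I n s → Q s) :
    Runs (forTo v b p) s ((T + (2 * b.cost + 17)) * X) Q := by
  have key : ∀ r j s, r + j = n → I j s → s v 0 = j →
      Runs (.loop (.sub b (reg v)) (.seq p (setReg v (.add (reg v) (.lit 1))))) s
        (r * (T + b.cost + 10) + (b.cost + 4)) Q := by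
    intro r
    induction r with
    | zero =>
      intro j s hj hI hv
      obtain rfl : j = n := by omega
      refine ⟨s, _, .loopFalse ?_, ?_, hQ _ hI⟩
      · simp [Expr.eval, hb _ _ hI hv, hv]
      · simp [Expr.cost]
    | succ r ih =>
      intro j s hj hI hv
      obtain ⟨s₁, t₁, h1, h2, h3, h4⟩ := hstep j s (by omega) hI hv
      obtain ⟨s₂, t₂, h5, h6, h7⟩ := ih (j + 1) _ (by omega) h4 (by simp)
      have h8 : (Expr.sub b (reg v)).eval s ≠ 0 := by
        simp [Expr.eval, hb _ _ hI hv, hv]; omega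
      refine ⟨s₂, _, .loopTrue (t₂ := t₂) h8 (.seq h1 (.set _ _ _ _)) ?_, ?_, h7⟩
      · simpa [Expr.eval, h3, upd] using h5
      · simp only [Expr.cost, add_mul, one_mul]; omega
  have := key n 0 _ (by omega) h0 (by simp)
  refine (Runs.seq (Runs.set this)).le ?_
  simp only [Expr.cost]
  have h1 : n * (T + b.cost + 10) ≤ X * (T + b.cost + 10) := Nat.mul_le_mul_right _ hn
  nlinarith

/-- `s` and `s'` agree outside the arrays with index in `[lo, hi)`. -/
def Frame (lo hi : ℕ) (s s' : Store) : Prop := ∀ a, a < lo ∨ hi ≤ a → s' a = s a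

lemma Frame.refl {lo hi : ℕ} (s : Store) : Frame lo hi s s := fun _ _ => rfl

lemma Frame.trans {lo hi : ℕ} {s₁ s₂ s₃ : Store} (h : Frame lo hi s₁ s₂) (h' : Frame lo hi s₂ s₃) :
    Frame lo hi s₁ s₃ := fun a ha => (h' a ha).trans (h a ha)

lemma Frame.mono {lo hi lo' hi' : ℕ} {s₁ s₂ : Store} (h : Frame lo hi s₁ s₂)
    (h1 : lo' ≤ lo) (h2 : hi ≤ hi') : Frame lo' hi' s₁ s₂ :=
  fun a ha => h a (by omega)

lemma Frame.upd {lo hi : ℕ} {s s₁ : Store} (h : Frame lo hi s s₁) {a : ℕ} (i x : ℕ) (h1 : lo ≤ a)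
    (h2 : a < hi) : Frame lo hi s (upd s₁ a i x) := by
  intro b hb
  rw [upd_of_ne _ _ _ (by omega), h b hb]

/-- Invariant rule for a counting loop that clears register `f` when one of the `P j` fails. -/
lemma Runs.forAll {v f lo hi : ℕ} {b : Expr} {p : Prog} {s : Store} {T : ℕ}
    (n X : ℕ) (hX : 1 ≤ X) (hn : n ≤ X) (P : ℕ → Prop) (hv : lo ≤ v ∧ v < hi) (hf : f ≠ v)
    (hb : ∀ s', Frame lo hi s s' → b.eval s' = n)
    (hstep : ∀ j s', j < n → Frame lo hi s s' → s' v 0 = j →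
      Runs p s' T fun s'' => s'' v 0 = j ∧ Frame lo hi s' s'' ∧
        (s'' f 0 ≠ 0 ↔ s' f 0 ≠ 0 ∧ P j)) :
    Runs (RAM.forTo v b p) s ((T + (2 * b.cost + 17)) * X) fun s' => Frame lo hi s s' ∧
      (s' f 0 ≠ 0 ↔ s f 0 ≠ 0 ∧ ∀ j < n, P j) := by
  apply Runs.forTo n X hX hn
    (fun j s' => Frame lo hi s s' ∧ (s' f 0 ≠ 0 ↔ s f 0 ≠ 0 ∧ ∀ i < j, P i))
  · exact ⟨(Frame.refl s).upd _ _ hv.1 hv.2, by simp [hf]⟩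
  · rintro j s' ⟨h1, -⟩ -
    exact hb s' h1
  · rintro j s' hj ⟨h1, h2⟩ h3
    refine (hstep j s' hj h1 h3).imp ?_
    rintro s'' ⟨h4, h5, h6⟩
    refine ⟨h4, (h1.trans h5).upd _ _ hv.1 hv.2, ?_⟩
    rw [upd_of_ne _ _ _ hf, h6, h2, and_assoc]
    exact and_congr_right fun _ => Nat.forall_lt_succ_right.symm
  · exact fun s' h => h

end RAM

/-! ### Deciding local conditions on states -/

namespace RAM

/-- Nonzero iff `x` and `y` differ. -/
abbrev neE (x y : Expr) : Expr := .add (.sub x y) (.sub y x)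

/-- Nonzero iff `x < y`. -/
abbrev ltE (x y : Expr) : Expr := .sub y x

/-- `1` if `x < y`, and `0` otherwise. -/
abbrev bitE (x y : Expr) : Expr := .sub (.lit 1) (.sub (.lit 1) (.sub y x))

/-- The number `k` of pairs in the input. -/
abbrev kE : Expr := .get 0 (.lit 2)

/-- The number `n` of vertices in the input. -/
abbrev nE : Expr := .get 0 (.lit 0)

/-- The table entry naming the successor of a vertex on the path that pair `i` currently uses, where
`nx` is the row of the vertex, and pair `i` uses its new path iff `key i < θ`. -/
def hop (nx key : ℕ → ℕ) (θ i : ℕ) : ℕ := nx (i + i + if key i < θ then 1 else 0)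

/-- At a vertex with successor row `nx` and capacity row `cap`, no edge is overloaded when the pairs
with key below `θ` are switched, for every threshold `θ`. -/
def OkAt (k K : ℕ) (nx cap d key : ℕ → ℕ) : Prop :=
  ∀ θ < K, ∀ i₀ < k, hop nx key θ i₀ ≠ 0 →
    ∑ i ∈ Finset.range k, (if hop nx key θ i = hop nx key θ i₀ then d i else 0)
      ≤ cap (hop nx key θ i₀ - 1)

/-- The expression for `hop`, with the pair in register `r`. -/
abbrev hopE (r : ℕ) : Expr :=
  .get 18 (.add (reg 45) (.add (.add (reg r) (reg r))
    (bitE (.get 6 (.add (reg 46) (reg r))) (reg 47))))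

/-- Computes in register `50` the total demand of the pairs whose hop, for the threshold in register
`47`, is the content of register `49`. -/
def sumProg : Prog :=
  .seq (setReg 50 (.lit 0))
    (forTo 51 kE (.cond (neE (hopE 51) (reg 49)) .skip
      (setReg 50 (.add (reg 50) (.get 17 (reg 51))))))

/-- Decides `OkAt` for the vertex whose row starts at `reg 45` and the state whose keys start at
`reg 46`. Register `52` is nonzero iff it holds. -/
def okProg : Prog :=
  .seq (setReg 52 (.lit 1))
    (forTo 47 (reg 4) (forTo 48 kE
      (.seq (setReg 49 (hopE 48))
        (.cond (reg 49)
          (.seq sumProg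
            (.cond (.sub (reg 50) (.get 16 (.add (reg 45) (.sub (reg 49) (.lit 1)))))
              (setReg 52 (.lit 0)) .skip)) .skip))))

lemma bit_eq (a b : ℕ) : 1 - (1 - (b - a)) = if a < b then 1 else 0 := by
  split <;> omega

lemma ne_eq_zero (a b : ℕ) : a - b + (b - a) = 0 ↔ a = b := by omega

lemma hopE_eval {s : Store} {nx key : ℕ → ℕ} {r θ : ℕ} (hnx : ∀ j, s 18 (s 45 0 + j) = nx j)
    (hkey : ∀ j, s 6 (s 46 0 + j) = key j) (hθ : s 47 0 = θ) :
    (hopE r).eval s = hop nx key θ (s r 0) := by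
  simp [Expr.eval, hop, hnx, hkey, hθ, bit_eq]

lemma sumProg_spec (s : Store) (X θ k : ℕ) (nx key d : ℕ → ℕ)
    (hnx : ∀ j, s 18 (s 45 0 + j) = nx j) (hd : s 17 = d)
    (hkey : ∀ j, s 6 (s 46 0 + j) = key j) (hθ : s 47 0 = θ) (hX : 1 ≤ X) (hk : k ≤ X)
    (hk' : s 0 2 = k) :
    Runs sumProg s (200 * X) fun s' => Frame 50 52 s s' ∧
      s' 50 0 = ∑ i ∈ Finset.range k, if hop nx key θ i = s 49 0 then d i else 0 := by
  apply Runs.le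
  · apply Runs.seq
    apply Runs.set
    apply Runs.forTo k X hX hk
      (fun j s' => Frame 50 52 s s' ∧ s' 50 0 = ∑ i ∈ Finset.range j,
        if hop nx key θ i = s 49 0 then d i else 0)
    · refine ⟨((Frame.refl s).upd _ _ ?_ ?_).upd _ _ ?_ ?_, ?_⟩ <;> simp [Expr.eval]
    · rintro j s' ⟨h1, -⟩ -
      simp [Expr.eval, h1 0, hk']
    · rintro j s' hj ⟨h1, h2⟩ h3
      have e : (hopE 51).eval s' = hop nx key θ (s' 51 0) := by
        apply hopE_eval <;> simpa [h1 18, h1 45, h1 46, h1 47, h1 6]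
      apply Runs.cond
      · intro hb
        apply Runs.skip
        simp only [Expr.eval] at hb e
        rw [e, h1 49 (by simp), ne_eq, ne_eq_zero, h3] at hb
        refine ⟨h3, h1.upd _ _ (by simp) (by simp), ?_⟩
        simp [h2, Finset.sum_range_succ, hb]
      · intro hb
        apply Runs.set
        simp only [Expr.eval] at hb e
        rw [e, h1 49 (by simp), ne_eq_zero, h3] at hb
        refine ⟨by simp [Expr.eval, h3],
          (h1.upd _ _ (by simp) (by simp)).upd _ _ (by simp) (by simp), ?_⟩
        simp [Expr.eval, h2, h3, Finset.sum_range_succ, hb, h1 17, hd]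
    · exact fun s' h => h
  · simp [Expr.cost]; omega

lemma okProg_spec (s : Store) (X k K : ℕ) (nx cap key d : ℕ → ℕ)
    (hnx : ∀ j, s 18 (s 45 0 + j) = nx j) (hcap : ∀ j, s 16 (s 45 0 + j) = cap j)
    (hd : s 17 = d) (hkey : ∀ j, s 6 (s 46 0 + j) = key j) (hX : 1 ≤ X)
    (hk : k ≤ X) (hk' : s 0 2 = k) (hK : K ≤ X) (hK' : s 4 0 = K) :
    Runs okProg s (400 * X * X * X) fun s' => Frame 47 53 s s' ∧ (s' 52 0 ≠ 0 ↔
      OkAt k K nx cap d key) := by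
  apply Runs.le
  · apply Runs.seq
    apply Runs.set
    apply Runs.imp
    · apply Runs.forAll (lo := 47) (hi := 53) (f := 52) K X hX hK
        (fun θ => ∀ i₀ < k, hop nx key θ i₀ ≠ 0 →
          ∑ i ∈ Finset.range k, (if hop nx key θ i = hop nx key θ i₀ then d i else 0)
            ≤ cap (hop nx key θ i₀ - 1)) (by simp) (by simp)
      · intro s' h1
        simp [Expr.eval, h1 4, hK']
      · intro θ s' hθ h1 h3
        replace h1 := ((Frame.refl s).upd (lo := 47) (hi := 53) (a := 52) 0 1
          (by simp) (by simp)).trans h1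
        apply Runs.imp
        · apply Runs.forAll (lo := 48) (hi := 53) (f := 52) k X hX hk
            (fun i₀ => hop nx key θ i₀ ≠ 0 →
              ∑ i ∈ Finset.range k, (if hop nx key θ i = hop nx key θ i₀ then d i else 0)
                ≤ cap (hop nx key θ i₀ - 1))
            (by simp) (by simp)
          · intro s₁ h4
            simp [Expr.eval, h4 0, h1 0, hk']
          · intro i₀ s₁ hi₀ h4 h5
            have h6 := h1.trans (h4.mono (by simp : 47 ≤ 48) le_rfl)
            have e : (hopE 48).eval s₁ = hop nx key θ (s₁ 48 0) := by
              apply hopE_eval <;> simpa [h6 18, h6 45, h6 46, h6 6, h4 47]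
            apply Runs.seq
            apply Runs.set
            simp only [Expr.eval] at e ⊢
            rw [e, h5]
            apply Runs.cond
            · intro h7
              simp only [Expr.eval, upd_same, if_true] at h7
              apply Runs.seq
              apply Runs.imp
              · apply sumProg_spec _ X θ k nx key d _ _ _ _ hX hk
                all_goals simp [h6 18, h6 45, h6 46, h6 6, h6 17, h6 0, h4 47, *]
              · rintro s₂ ⟨h8, h9⟩
                have h10 : Frame 48 53 s₁ s₂ :=
                  ((Frame.refl s₁).upd _ _ (by simp) (by simp)).trans
                    (h8.mono (by simp) (by simp))
                have e2 : s₂ 16 (s₂ 45 0 + (s₂ 49 0 - 1)) = cap (hop nx key θ i₀ - 1) := by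
                  rw [h8 49, h10 45, h6 45, h10 16, h6 16] <;> simp [hcap]
                simp only [upd_same, if_true] at h9
                apply Runs.cond
                · intro h11
                  simp only [Expr.eval, h9, e2] at h11
                  apply Runs.set
                  refine ⟨by simp [Expr.eval, h8 48, h5], h10.upd _ _ (by simp) (by simp), ?_⟩
                  simp [Expr.eval, h7]
                  omega
                · intro h11
                  simp only [Expr.eval, h9, e2] at h11
                  apply Runs.skip
                  refine ⟨by simp [h8 48, h5], h10, ?_⟩
                  simp [h8 52]
                  omega
            · intro h7
              simp only [Expr.eval, upd_same, if_true] at h7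
              apply Runs.skip
              refine ⟨by simp [h5], (Frame.refl s₁).upd _ _ (by simp) (by simp), ?_⟩
              simp [h7]
        · rintro s'' ⟨h4, h5⟩
          exact ⟨by rw [h4 47 (by simp), h3], h4.mono (by simp) le_rfl, h5⟩
    · rintro s' ⟨h1, h2⟩
      refine ⟨((Frame.refl s).upd _ _ (by simp) (by simp)).trans h1, ?_⟩
      simpa [Expr.eval, OkAt] using h2
  · simp [Expr.cost]
    have h1 : X ≤ X * X := Nat.le_mul_of_pos_right _ hX
    have h2 : X * X ≤ X * X * X := Nat.le_mul_of_pos_right _ hX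
    linarith

/-- In the row `nx` of a vertex: pair `i` has both an old and a new edge leaving the vertex. -/
def Br (nx : ℕ → ℕ) (i : ℕ) : Prop := nx (i + i) ≠ 0 ∧ nx (i + i + 1) ≠ 0

/-- The pairs that do not branch at the vertex with row `nx` are ordered by `kb` as by `ka`. -/
def Compat (k : ℕ) (nx ka kb : ℕ → ℕ) : Prop :=
  ∀ i < k, ∀ j < k, ¬ Br nx i → ¬ Br nx j → ka i < ka j → kb i < kb j

/-- Nonzero iff the pair in register `r` branches at the vertex whose row starts at `reg 45`; the
value is the minimum of the two successor entries. -/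
abbrev brE (r : ℕ) : Expr :=
  .sub (.get 18 (.add (reg 45) (.add (reg r) (reg r))))
    (.sub (.get 18 (.add (reg 45) (.add (reg r) (reg r))))
      (.get 18 (.add (reg 45) (.add (.add (reg r) (reg r)) (.lit 1)))))

/-- Decides `Compat` for the vertex whose row starts at `reg 45` and the states whose keys start at
`reg 46` and at `reg 53`. Register `56` is nonzero iff it holds. -/
def compatProg : Prog :=
  .seq (setReg 56 (.lit 1))
    (forTo 54 kE (forTo 55 kE
      (.cond (brE 54) .skip (.cond (brE 55) .skip
        (.cond (ltE (.get 6 (.add (reg 46) (reg 54))) (.get 6 (.add (reg 46) (reg 55))))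
          (.cond (ltE (.get 6 (.add (reg 53) (reg 54))) (.get 6 (.add (reg 53) (reg 55))))
            .skip (setReg 56 (.lit 0))) .skip)))))

lemma brE_eval {s : Store} {nx : ℕ → ℕ} {r : ℕ} (hnx : ∀ j, s 18 (s 45 0 + j) = nx j) :
    (brE r).eval s = 0 ↔ ¬ Br nx (s r 0) := by
  simp only [Expr.eval, hnx, Br]
  omega

lemma compatProg_spec (s : Store) (X k : ℕ) (nx ka kb : ℕ → ℕ)
    (hnx : ∀ j, s 18 (s 45 0 + j) = nx j) (ha : ∀ j, s 6 (s 46 0 + j) = ka j)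
    (hb : ∀ j, s 6 (s 53 0 + j) = kb j) (hX : 1 ≤ X) (hk : k ≤ X) (hk' : s 0 2 = k) :
    Runs compatProg s (400 * X * X) fun s' => Frame 54 57 s s' ∧ (s' 56 0 ≠ 0 ↔
      Compat k nx ka kb) := by
  apply Runs.le
  · apply Runs.seq
    apply Runs.set
    apply Runs.imp
    · apply Runs.forAll (lo := 54) (hi := 57) (f := 56) k X hX hk
        (fun i => ∀ j < k, ¬ Br nx i → ¬ Br nx j → ka i < ka j → kb i < kb j)
        (by simp) (by simp)
      · intro s' h1
        simp [Expr.eval, h1 0, hk']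
      · intro i s' hi h1 h3
        replace h1 := ((Frame.refl s).upd (lo := 54) (hi := 57) (a := 56) 0 1
          (by simp) (by simp)).trans h1
        apply Runs.imp
        · apply Runs.forAll (lo := 55) (hi := 57) (f := 56) k X hX hk
            (fun j => ¬ Br nx i → ¬ Br nx j → ka i < ka j → kb i < kb j) (by simp) (by simp)
          · intro s₁ h4
            simp [Expr.eval, h4 0, h1 0, hk']
          · intro j s₁ hj h4 h5
            have h6 := h1.trans (h4.mono (by simp : 54 ≤ 55) le_rfl)
            have e : ∀ r, (brE r).eval s₁ = 0 ↔ ¬ Br nx (s₁ r 0) := fun r => by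
              apply brE_eval; simpa [h6 18, h6 45]
            have hi' : s₁ 54 0 = i := by simp [h4 54, h3]
            have h46 : s₁ 46 = s 46 := h6 46 (by simp)
            have h53 : s₁ 53 = s 53 := h6 53 (by simp)
            have h6' : s₁ 6 = s 6 := h6 6 (by simp)
            have skip : ∀ {P : Prop}, P →
                s₁ 55 0 = j ∧ Frame 55 57 s₁ s₁ ∧ (s₁ 56 0 ≠ 0 ↔ s₁ 56 0 ≠ 0 ∧ P) :=
              fun hP => ⟨h5, Frame.refl _, by simp [hP]⟩
            apply Runs.cond <;> intro c1
            · rw [ne_eq, e, hi', not_not] at c1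
              exact Runs.skip (skip fun h => absurd c1 h)
            rw [e, hi'] at c1
            apply Runs.cond <;> intro c2
            · rw [ne_eq, e, h5, not_not] at c2
              exact Runs.skip (skip fun _ h => absurd c2 h)
            rw [e, h5] at c2
            apply Runs.cond <;> intro c3
            · simp only [Expr.eval, h6', h46, hi', h5, ha] at c3
              apply Runs.cond <;> intro c4
              · simp only [Expr.eval, h6', h53, hi', h5, hb] at c4
                exact Runs.skip (skip fun _ _ _ => by omega)
              · simp only [Expr.eval, h6', h53, hi', h5, hb] at c4
                apply Runs.set
                refine ⟨by simp [h5], (Frame.refl _).upd _ _ (by simp) (by simp), ?_⟩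
                simp [Expr.eval, c1, c2]
                omega
            · simp only [Expr.eval, h6', h46, hi', h5, ha] at c3
              exact Runs.skip (skip fun _ _ h => by omega)
        · rintro s'' ⟨h4, h5⟩
          exact ⟨by rw [h4 54 (by simp), h3], h4.mono (by simp) le_rfl, h5⟩
    · rintro s' ⟨h1, h2⟩
      refine ⟨((Frame.refl s).upd _ _ (by simp) (by simp)).trans h1, ?_⟩
      simpa [Expr.eval, Compat] using h2
  · simp [Expr.cost]
    have h1 : X ≤ X * X := Nat.le_mul_of_pos_right _ hX
    linarith

end RAM

/-! ### The table of good states -/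

namespace RAM

lemma row_inj {Q x y x' y' : ℕ} (hy : y < Q) (hy' : y' < Q) :
    x * Q + y = x' * Q + y' ↔ x = x' ∧ y = y' := by
  constructor
  · intro h
    have h1 : (x * Q + y) / Q = (x' * Q + y') / Q := by rw [h]
    have hQ : 0 < Q := by omega
    rw [mul_comm x, mul_comm x', Nat.mul_add_div hQ, Nat.mul_add_div hQ, Nat.div_eq_of_lt hy,
      Nat.div_eq_of_lt hy'] at h1
    have h2 : x = x' := by simpa using h1
    subst h2
    exact ⟨rfl, by omega⟩
  · rintro ⟨rfl, rfl⟩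
    rfl

/-- The tables in memory that the search for local orders reads: row starts, the keys of the
`N` states, the demands, and the successor and capacity rows of the vertex at each position of the
topological order. -/
structure Env (s : Store) (n k K N Q : ℕ) (nx cap : ℕ → ℕ → ℕ) (d : ℕ → ℕ) (key : ℕ → ℕ → ℕ) :
    Prop where
  n_eq : s 0 0 = n
  k_eq : s 0 2 = k
  N_eq : s 3 0 = N
  K_eq : s 4 0 = K
  row : ∀ x ≤ n + N, s 5 x = x * Q
  N_lt : N < Q
  key_eq : ∀ a < N, ∀ j, s 6 (a * Q + j) = key a j
  d_eq : s 17 = d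
  nx_eq : ∀ p j, s 18 (s 5 (s 31 p) + j) = nx p j
  cap_eq : ∀ p j, s 16 (s 5 (s 31 p) + j) = cap p j

lemma Env.frame {s s' : Store} {n k K N Q : ℕ} {nx cap : ℕ → ℕ → ℕ} {d : ℕ → ℕ}
    {key : ℕ → ℕ → ℕ} (h : Env s n k K N Q nx cap d key) {lo hi : ℕ} (hf : Frame lo hi s s')
    (hlo : 32 ≤ lo) : Env s' n k K N Q nx cap d key := by
  obtain ⟨h1, h2, h3, h4, h5, h6, h7, h8, h9, h10⟩ := h
  have e : ∀ a, a < 32 → s' a = s a := fun a ha => hf a (by omega)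
  constructor <;> simpa [e]

/-- `Good r a`: state `a` at position `n - r` extends to a compatible choice of states at the last
`r` positions, all of which respect the capacities. -/
def Good (n k K N : ℕ) (nx cap : ℕ → ℕ → ℕ) (d : ℕ → ℕ) (key : ℕ → ℕ → ℕ) : ℕ → ℕ → Prop
  | 0, _ => True
  | r + 1, a => OkAt k K (nx (n - 1 - r)) (cap (n - 1 - r)) d (key a) ∧
      ∃ b < N, Good n k K N nx cap d key r b ∧ Compat k (nx (n - r)) (key a) (key b)

/-- Searches a good state at position `n - reg 41` that is compatible with the state whose keys
start at `reg 46`. Success is reported by a zero in register `44`, the state by register `57`. -/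
def extendProg : Prog :=
  .seq (.set 45 (.lit 0) (.get 5 (.get 31 (.sub nE (reg 41)))))
    (.seq (setReg 44 (.lit 1))
      (forTo 43 (reg 3)
        (.seq (setReg 53 (.get 5 (reg 43)))
          (.cond (.get 40 (.add (.get 5 (.sub nE (reg 41))) (reg 43)))
            (.seq compatProg
              (.cond (reg 56) (.seq (setReg 44 (.lit 0)) (setReg 57 (reg 43))) .skip)) .skip))))

/-- Decides whether state `reg 42` is good at position `n - 1 - reg 41`, given the next row of the
table of good states in array `40`. -/
def goodCellProg : Prog :=
  .seq (setReg 45 (.get 5 (.get 31 (.sub (.sub nE (.lit 1)) (reg 41)))))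
    (.seq (setReg 46 (.get 5 (reg 42)))
      (.seq okProg
        (.cond (reg 52)
          (.seq extendProg
            (.set 40 (.add (.get 5 (.sub (.sub nE (.lit 1)) (reg 41))) (reg 42))
              (.sub (.lit 1) (reg 44))))
          (.set 40 (.add (.get 5 (.sub (.sub nE (.lit 1)) (reg 41))) (reg 42)) (.lit 0)))))

/-- Fills the table of good states, from the last position to the first. -/
def goodProg : Prog :=
  .seq (forTo 42 (reg 3) (.set 40 (.add (.get 5 nE) (reg 42)) (.lit 1)))
    (forTo 41 nE (forTo 42 (reg 3) goodCellProg))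

section

variable {s : Store} {n k K N Q M : ℕ} {nx cap : ℕ → ℕ → ℕ} {d : ℕ → ℕ} {key : ℕ → ℕ → ℕ}

lemma extendProg_spec (he : Env s n k K N Q nx cap d key) (hM : 1 ≤ M) (hk : k ≤ M) (hN : N ≤ M)
    (a r : ℕ) (hr : s 41 0 = r) (ha : ∀ j, s 6 (s 46 0 + j) = key a j)
    (hg : ∀ b < N, s 40 ((n - r) * Q + b) ≠ 0 ↔ Good n k K N nx cap d key r b) :
    Runs extendProg s (600 * M * M * M) fun s' => Frame 43 58 s s' ∧
      (s' 44 0 = 0 → s' 57 0 < N ∧ Good n k K N nx cap d key r (s' 57 0) ∧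
        Compat k (nx (n - r)) (key a) (key (s' 57 0))) ∧
      (s' 44 0 = 0 ↔ ∃ b < N, Good n k K N nx cap d key r b ∧
        Compat k (nx (n - r)) (key a) (key b)) := by
  set F : ℕ → Prop := fun b => Good n k K N nx cap d key r b ∧
    Compat k (nx (n - r)) (key a) (key b) with hF
  apply Runs.le
  · apply Runs.seq
    apply Runs.set
    apply Runs.seq
    apply Runs.set
    set s₀ := upd (upd s _ _ _) _ _ _ with hs₀
    have hf₀ : Frame 43 58 s s₀ :=
      ((Frame.refl s).upd _ _ (by simp) (by simp)).upd _ _ (by simp) (by simp)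
    have h45 : s₀ 45 0 = s 5 (s 31 (n - r)) := by simp [hs₀, Expr.eval, he.n_eq, hr]
    have h44 : s₀ 44 0 = 1 := by simp [hs₀, Expr.eval]
    have h46 : s₀ 46 = s 46 := by simp [hs₀]
    clear_value s₀
    apply Runs.forTo N M hM hN (fun b s' => Frame 43 58 s s' ∧ s' 45 0 = s 5 (s 31 (n - r)) ∧
      s' 46 = s 46 ∧ (s' 44 0 = 0 → s' 57 0 < N ∧ F (s' 57 0)) ∧ (s' 44 0 = 0 ↔ ∃ b' < b, F b'))
    · refine ⟨hf₀.upd _ _ (by simp) (by simp), ?_⟩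
      simp [h45, h44, h46]
    · rintro b s' ⟨h1, -⟩ -
      simp [Expr.eval, h1 3, he.N_eq]
    · rintro b s' hb ⟨h1, h2, h3, h3', h4⟩ h5
      have he' := he.frame h1 (by simp)
      have step : ∀ s'', Frame 43 58 s s'' → s'' 45 = s' 45 → s'' 46 = s' 46 → s'' 43 0 = b →
          (s'' 44 0 = 0 → s'' 57 0 < N ∧ F (s'' 57 0)) →
          (s'' 44 0 = 0 ↔ s' 44 0 = 0 ∨ F b) →
          s'' 43 0 = b ∧ Frame 43 58 s (upd s'' 43 0 (b + 1)) ∧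
            upd s'' 43 0 (b + 1) 45 0 = s 5 (s 31 (n - r)) ∧ upd s'' 43 0 (b + 1) 46 = s 46 ∧
            (upd s'' 43 0 (b + 1) 44 0 = 0 → upd s'' 43 0 (b + 1) 57 0 < N ∧
              F (upd s'' 43 0 (b + 1) 57 0)) ∧
            (upd s'' 43 0 (b + 1) 44 0 = 0 ↔ ∃ b' < b + 1, F b') := by
        intro s'' k1 k2 k3 k4 k6 k5
        refine ⟨k4, k1.upd _ _ (by simp) (by simp), by simp [k2, h2], by simp [k3, h3], ?_, ?_⟩
        · rwa [upd_of_ne _ _ _ (by simp), upd_of_ne _ _ _ (by simp)]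
        rw [upd_of_ne _ _ _ (by simp), k5, h4]
        constructor
        · rintro (⟨b', h6, h7⟩ | h6)
          · exact ⟨b', by omega, h7⟩
          · exact ⟨b, by omega, h6⟩
        · rintro ⟨b', h6, h7⟩
          rcases Nat.lt_succ_iff_lt_or_eq.mp h6 with h8 | rfl
          · exact Or.inl ⟨b', h8, h7⟩
          · exact Or.inr h7
      apply Runs.seq
      apply Runs.set
      have e : s' 5 (s' 43 0) = b * Q := by rw [h5]; exact he'.row _ (by omega)
      have e40 : s' 40 = s 40 := h1 40 (by simp)
      have eg : (Expr.get 40 (.add (.get 5 (.sub nE (reg 41))) (reg 43))).eval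
          (upd s' 53 0 (b * Q)) ≠ 0 ↔ Good n k K N nx cap d key r b := by
        rw [← hg b hb]
        simp [Expr.eval, he'.n_eq, h1 41, hr, h5, e40, he'.row (n - r) (by omega)]
      simp only [Expr.eval, e] at eg ⊢
      have h1' : Frame 43 58 s (upd s' 53 0 (b * Q)) := h1.upd _ _ (by simp) (by simp)
      apply Runs.cond <;> intro c1
      · simp only [Expr.eval] at c1
        rw [eg] at c1
        apply Runs.seq
        apply Runs.imp
        · apply compatProg_spec _ M k (nx (n - r)) (key a) (key b) _ _ _ hM hk
          · simp [he'.k_eq]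
          · simp [h1 18, h2, he.nx_eq]
          · simp [h1 6, h3, ha]
          · simp [he'.key_eq b hb]
        · rintro s₂ ⟨k1, k2⟩
          have k3 := h1'.trans (k1.mono (by simp) (by simp))
          have e43 : s₂ 43 0 = b := by simp [k1 43, h5]
          have e45 : s₂ 45 = s' 45 := by simp [k1 45]
          have e46 : s₂ 46 = s' 46 := by simp [k1 46]
          have e44 : s₂ 44 = s' 44 := by simp [k1 44]
          have e57 : s₂ 57 = s' 57 := by simp [k1 57]
          apply Runs.cond <;> intro c2
          · apply Runs.seq
            apply Runs.set
            apply Runs.set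
            simp only [Expr.eval, k2] at c2
            refine step _ ((k3.upd _ _ (by simp) (by simp)).upd _ _ (by simp) (by simp))
              (by simp [e45]) (by simp [e46]) (by simp [e43]) ?_ ?_
            · simp [Expr.eval, e43, hb, hF, c1, c2]
            · simp [Expr.eval, hF, c1, c2]
          · apply Runs.skip
            simp only [Expr.eval] at c2
            refine step _ k3 e45 e46 e43 (by simpa [e44, e57]) ?_
            have : ¬ F b := fun h => (k2.mpr h.2) c2
            simp [e44, this]
      · apply Runs.skip
        simp only [Expr.eval] at c1
        refine step _ h1' (by simp) (by simp) (by simp [h5]) (by simpa) ?_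
        have : ¬ F b := fun h => (eg.mpr h.1) c1
        simp [this]
    · rintro s' ⟨h1, h2, h3, h4, h5⟩
      exact ⟨h1, h4, h5⟩
  · simp [Expr.cost]
    have h1 : M ≤ M * M := Nat.le_mul_of_pos_right _ hM
    have h2 : M * M ≤ M * M * M := Nat.le_mul_of_pos_right _ hM
    linarith

lemma goodCellProg_spec (he : Env s n k K N Q nx cap d key) (hM : 1 ≤ M) (hk : k ≤ M) (hN : N ≤ M)
    (hK : K ≤ M) (a r : ℕ) (hr : s 41 0 = r) (ha : s 42 0 = a) (haN : a < N)
    (hg : ∀ b < N, s 40 ((n - r) * Q + b) ≠ 0 ↔ Good n k K N nx cap d key r b) :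
    Runs goodCellProg s (1200 * M * M * M) fun s' => Frame 40 58 s s' ∧ s' 41 = s 41 ∧
      s' 42 = s 42 ∧ ∃ x, s' 40 = Function.update (s 40) ((n - 1 - r) * Q + a) x ∧
        (x ≠ 0 ↔ Good n k K N nx cap d key (r + 1) a) := by
  apply Runs.le
  · apply Runs.seq
    apply Runs.set
    apply Runs.seq
    apply Runs.set
    set s₀ := upd (upd s _ _ _) _ _ _ with hs₀
    have hf₀ : Frame 43 58 s s₀ :=
      ((Frame.refl s).upd _ _ (by simp) (by simp)).upd _ _ (by simp) (by simp)
    have h45 : s₀ 45 0 = s 5 (s 31 (n - 1 - r)) := by simp [hs₀, Expr.eval, he.n_eq, hr]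
    have h46 : s₀ 46 0 = a * Q := by simp [hs₀, Expr.eval, ha, he.row a (by omega)]
    clear_value s₀
    apply Runs.seq
    apply Runs.imp
    · apply okProg_spec s₀ M k K (nx (n - 1 - r)) (cap (n - 1 - r)) (key a) d _ _ _ _ hM hk _ hK
      · rw [hf₀ 4 (by simp), he.K_eq]
      · intro j; rw [h45, hf₀ 18 (by simp), he.nx_eq]
      · intro j; rw [h45, hf₀ 16 (by simp), he.cap_eq]
      · rw [hf₀ 17 (by simp), he.d_eq]
      · intro j; rw [h46, hf₀ 6 (by simp), he.key_eq a haN]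
      · rw [hf₀ 0 (by simp), he.k_eq]
    · rintro s₁ ⟨h1, h2⟩
      have hf₁ := hf₀.trans (h1.mono (by simp) (by simp) : Frame 43 58 s₀ s₁)
      have he₁ := he.frame hf₁ (by simp)
      have fin : ∀ s₂ x, Frame 43 58 s s₂ → (x ≠ 0 ↔ Good n k K N nx cap d key (r + 1) a) →
          Frame 40 58 s (upd s₂ 40 (s₂ 5 (s₂ 0 0 - 1 - s₂ 41 0) + s₂ 42 0) x) ∧
          upd s₂ 40 (s₂ 5 (s₂ 0 0 - 1 - s₂ 41 0) + s₂ 42 0) x 41 = s 41 ∧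
          upd s₂ 40 (s₂ 5 (s₂ 0 0 - 1 - s₂ 41 0) + s₂ 42 0) x 42 = s 42 ∧
          ∃ x', upd s₂ 40 (s₂ 5 (s₂ 0 0 - 1 - s₂ 41 0) + s₂ 42 0) x 40 =
            Function.update (s 40) ((n - 1 - r) * Q + a) x' ∧
          (x' ≠ 0 ↔ Good n k K N nx cap d key (r + 1) a) := by
        intro s₂ x hf hx
        have he₂ := he.frame hf (by simp)
        have e : s₂ 5 (s₂ 0 0 - 1 - s₂ 41 0) + s₂ 42 0 = (n - 1 - r) * Q + a := by
          rw [he₂.n_eq, he₂.row _ (by omega), hf 41 (by simp), hf 42 (by simp), hr, ha]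
        rw [e]
        refine ⟨(hf.mono (by simp) le_rfl).upd _ _ (by simp) (by simp), by simp [hf 41],
          by simp [hf 42], x, by simp [upd, hf 40], hx⟩
      apply Runs.cond <;> intro c1
      · simp only [Expr.eval] at c1
        rw [h2] at c1
        apply Runs.seq
        apply Runs.imp
        · apply extendProg_spec he₁ hM hk hN a r
          · rw [hf₁ 41 (by simp), hr]
          · intro j; rw [h1 46 (by simp), h46, he₁.key_eq a haN]
          · rwa [hf₁ 40 (by simp)]
        · rintro s₂ ⟨k1, -, k2⟩
          apply Runs.set
          simp only [Expr.eval]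
          refine fin s₂ _ (hf₁.trans k1) ?_
          simp only [Good, c1, true_and]
          rw [← k2]
          omega
      · simp only [Expr.eval] at c1
        apply Runs.set
        simp only [Expr.eval]
        refine fin s₁ _ hf₁ ?_
        have : ¬ OkAt k K (nx (n - 1 - r)) (cap (n - 1 - r)) d (key a) := fun h => (h2.mpr h) c1
        simp [Good, this]
  · simp [Expr.cost]
    have h1 : M ≤ M * M := Nat.le_mul_of_pos_right _ hM
    have h2 : M * M ≤ M * M * M := Nat.le_mul_of_pos_right _ hM
    linarith

lemma goodProg_spec (he : Env s n k K N Q nx cap d key) (hM : 1 ≤ M) (hk : k ≤ M) (hN : N ≤ M)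
    (hK : K ≤ M) (hn : 1 ≤ n) :
    Runs goodProg s (2000 * M * M * M * M * n) fun s' => Frame 40 58 s s' ∧
      ∀ r ≤ n, ∀ a < N, s' 40 ((n - r) * Q + a) ≠ 0 ↔ Good n k K N nx cap d key r a := by
  apply Runs.le
  · apply Runs.seq
    apply Runs.forTo N M hM hN (fun a s' => Frame 40 58 s s' ∧ ∀ a' < a, s' 40 (n * Q + a') ≠ 0)
    · exact ⟨(Frame.refl s).upd _ _ (by simp) (by simp), by simp⟩
    · rintro a s' ⟨h1, -⟩ -
      simp [Expr.eval, h1 3, he.N_eq]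
    · rintro a s' ha ⟨h1, h2⟩ h3
      have he' := he.frame h1 (by simp)
      apply Runs.set
      refine ⟨by simp [h3], (h1.upd _ _ (by simp) (by simp)).upd _ _ (by simp) (by simp), ?_⟩
      intro a' ha'
      simp only [Expr.eval, he'.n_eq, he'.row n (by omega), h3]
      rw [upd_of_ne _ _ _ (by simp), upd_same]
      split_ifs with h4
      · simp
      · exact h2 a' (by rcases Nat.lt_succ_iff_lt_or_eq.mp ha' with h | rfl <;> omega)
    · rintro s₁ ⟨h1, h2⟩
      apply Runs.forTo n n hn le_rfl (fun r s' => Frame 40 58 s s' ∧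
        ∀ r' ≤ r, ∀ a < N, s' 40 ((n - r') * Q + a) ≠ 0 ↔ Good n k K N nx cap d key r' a)
      · refine ⟨h1.upd _ _ (by simp) (by simp), ?_⟩
        intro r' hr' a ha
        obtain rfl : r' = 0 := by omega
        simpa [Good] using h2 a ha
      · rintro r s' ⟨h1, -⟩ -
        simp [Expr.eval, h1 0, he.n_eq]
      · rintro r s' hr ⟨h1, h2⟩ h3
        apply Runs.forTo N M hM hN (fun a s' => Frame 40 58 s s' ∧ s' 41 0 = r ∧
          (∀ r' ≤ r, ∀ a < N, s' 40 ((n - r') * Q + a) ≠ 0 ↔ Good n k K N nx cap d key r' a) ∧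
          ∀ a' < a, s' 40 ((n - (r + 1)) * Q + a') ≠ 0 ↔ Good n k K N nx cap d key (r + 1) a')
        · refine ⟨h1.upd _ _ (by simp) (by simp), by simpa, by simpa using h2, by simp⟩
        · rintro a s' ⟨h1, -⟩ -
          simp [Expr.eval, h1 3, he.N_eq]
        · rintro a s₂ ha ⟨k1, k2, k3, k4⟩ k5
          apply Runs.imp
          · exact goodCellProg_spec (he.frame k1 (by simp)) hM hk hN hK a r k2 k5 ha
              (k3 r le_rfl)
          · rintro s₃ ⟨l1, l2, l3, x, l4, l5⟩
            refine ⟨by rw [l3, k5], (k1.trans l1).upd _ _ (by simp) (by simp), by simp [l2, k2],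
              ?_, ?_⟩
            · intro r' hr' a' ha'
              rw [upd_of_ne _ _ _ (by simp), l4, Function.update_of_ne]
              · exact k3 r' hr' a' ha'
              · rw [ne_eq, row_inj (ha'.trans he.N_lt) (ha.trans he.N_lt)]
                omega
            · intro a' ha'
              rw [upd_of_ne _ _ _ (by simp), l4]
              rcases Nat.lt_succ_iff_lt_or_eq.mp ha' with h | rfl
              · rw [Function.update_of_ne]
                · exact k4 a' h
                · rw [ne_eq, row_inj ((h.trans ha).trans he.N_lt) (ha.trans he.N_lt)]
                  omega
              · rw [show n - (r + 1) = n - 1 - r by omega, Function.update_self]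
                exact l5
        · rintro s₂ ⟨k1, k2, k3, k4⟩
          refine ⟨k2, k1.upd _ _ (by simp) (by simp), ?_⟩
          intro r' hr' a ha
          rw [upd_of_ne _ _ _ (by simp)]
          rcases Nat.le_succ_iff.mp hr' with h | rfl
          · exact k3 r' h a ha
          · exact k4 a ha
      · exact fun s' h => h
  · simp [Expr.cost]
    have h1 : M ≤ M * M := Nat.le_mul_of_pos_right _ hM
    have h2 : M * M ≤ M * M * M := Nat.le_mul_of_pos_right _ hM
    have h3 : M * M * M ≤ M * M * M * M := Nat.le_mul_of_pos_right _ hM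
    have h4 : M * M * M * M ≤ M * M * M * M * n := Nat.le_mul_of_pos_right _ hn
    have h5 : M * n ≤ M * M * M * M * n := Nat.mul_le_mul_right _ (by linarith)
    have h6 : n ≤ M * M * M * M * n := Nat.le_mul_of_pos_left _ (by positivity)
    linarith

end

end RAM

/-! ### States and their keys -/

namespace RAM

/-- Computes the number `k ^ k` of states in register `3`, by repeated addition. -/
def powProg : Prog :=
  .seq (setReg 3 (.lit 1))
    (forTo 7 kE (.seq (setReg 9 (.lit 0)) (.seq (forTo 8 kE (setReg 9 (.add (reg 9) (reg 3))))
      (setReg 3 (reg 9)))))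

/-- Computes the bound `k * k + 1` of the thresholds in register `4`, and the common length of the
rows of all tables in register `2`. -/
def sizesProg : Prog :=
  .seq (setReg 4 (.lit 1))
    (.seq (forTo 7 kE (setReg 4 (.add (reg 4) kE)))
      (setReg 2 (.add (.add (reg 3) nE) (.add (.add kE kE) (.lit 1)))))

/-- Stores the starts of the rows in array `5`, which replaces the multiplications in all later
accesses to two-dimensional tables. -/
def rowProg : Prog :=
  .seq (setReg 9 (.lit 0))
    (forTo 7 (.add (.add nE (reg 3)) (.lit 1))
      (.seq (.set 5 (reg 7) (reg 9)) (setReg 9 (.add (reg 9) (reg 2)))))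

/-- Stores the keys of the state `a = reg 7`. As the digits of `a` are `a % k`, followed by those of
`a / k`, they come from the keys of the state `a / k = reg 10`. -/
def keyRowProg : Prog :=
  .seq (.set 6 (.get 5 (reg 7)) (reg 12))
    (forTo 8 (.sub kE (.lit 1))
      (.set 6 (.add (.get 5 (reg 7)) (.add (reg 8) (.lit 1)))
        (.add (.get 6 (.add (.get 5 (reg 10)) (reg 8))) (.lit 1))))

/-- Stores the keys of all states `a` in array `6`. Registers `10`, `11` and `12` hold
`a / k`, `a % k` and `a % k * k`. -/
def keyProg : Prog :=
  .seq (setReg 10 (.lit 0)) (.seq (setReg 11 (.lit 0)) (.seq (setReg 12 (.lit 0))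
    (forTo 7 (reg 3)
      (.seq keyRowProg
        (.seq (setReg 11 (.add (reg 11) (.lit 1)))
          (.seq (setReg 12 (.add (reg 12) kE))
            (.cond (.sub kE (reg 11)) .skip
              (.seq (setReg 11 (.lit 0)) (.seq (setReg 12 (.lit 0))
                (setReg 10 (.add (reg 10) (.lit 1))))))))))))

/-- The key of pair `i` in state `a`: the rank of the pair is the `i`-th digit of `a` in base `k`,
and ties between equal ranks are broken by the index `i`. -/
def stateKey (k a i : ℕ) : ℕ := a / k ^ i % k * k + i

lemma powProg_spec (s : Store) (k M : ℕ) (hM : 1 ≤ M) (hk : k ≤ M) (hk' : s 0 2 = k) :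
    Runs powProg s (100 * M * M) fun s' => Frame 3 10 s s' ∧ s' 3 0 = k ^ k := by
  apply Runs.le
  · apply Runs.seq
    apply Runs.set
    apply Runs.forTo k M hM hk (fun i s' => Frame 3 10 s s' ∧ s' 3 0 = k ^ i)
    · exact ⟨((Frame.refl s).upd _ _ (by simp) (by simp)).upd _ _ (by simp) (by simp),
        by simp [Expr.eval]⟩
    · rintro i s' ⟨h1, -⟩ -
      simp [Expr.eval, h1 0, hk']
    · rintro i s' hi ⟨h1, h2⟩ h3
      apply Runs.seq
      apply Runs.set
      apply Runs.seq
      apply Runs.forTo k M hM hk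
        (fun j s' => Frame 3 10 s s' ∧ s' 3 0 = k ^ i ∧ s' 9 0 = j * k ^ i ∧ s' 7 0 = i)
      · exact ⟨(h1.upd _ _ (by simp) (by simp)).upd _ _ (by simp) (by simp),
          by simp [Expr.eval, h2, h3]⟩
      · rintro j s' ⟨h1, -⟩ -
        simp [Expr.eval, h1 0, hk']
      · rintro j s' hj ⟨k1, k2, k3, k4⟩ k5
        apply Runs.set
        refine ⟨by simp [k5], (k1.upd _ _ (by simp) (by simp)).upd _ _ (by simp) (by simp), ?_⟩
        simp [Expr.eval, k2, k3, k4]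
        ring
      · rintro s' ⟨k1, k2, k3, k4⟩
        apply Runs.set
        refine ⟨by simp [k4], (k1.upd _ _ (by simp) (by simp)).upd _ _ (by simp) (by simp), ?_⟩
        simp [Expr.eval, k3]
        ring
    · exact fun s' h => h
  · simp [Expr.cost]
    have h1 : M ≤ M * M := Nat.le_mul_of_pos_right _ hM
    linarith

lemma sizesProg_spec (s : Store) (n k N M : ℕ) (hM : 1 ≤ M) (hk : k ≤ M) (hk' : s 0 2 = k)
    (hn : s 0 0 = n) (hN : s 3 0 = N) :
    Runs sizesProg s (100 * M) fun s' => Frame 2 10 s s' ∧ s' 3 = s 3 ∧ s' 4 0 = k * k + 1 ∧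
      s' 2 0 = N + n + 2 * k + 1 := by
  apply Runs.le
  · apply Runs.seq
    apply Runs.set
    apply Runs.seq
    apply Runs.forTo k M hM hk
      (fun i s' => Frame 2 10 s s' ∧ s' 3 = s 3 ∧ s' 4 0 = i * k + 1)
    · exact ⟨((Frame.refl s).upd _ _ (by simp) (by simp)).upd _ _ (by simp) (by simp),
        by simp [Expr.eval]⟩
    · rintro i s' ⟨h1, -⟩ -
      simp [Expr.eval, h1 0, hk']
    · rintro i s' hi ⟨h1, h2, h3⟩ h4
      apply Runs.set
      refine ⟨by simp [h4], (h1.upd _ _ (by simp) (by simp)).upd _ _ (by simp) (by simp), ?_⟩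
      simp [Expr.eval, h1 0, h2, h3, hk']
      ring
    · rintro s' ⟨h1, h2, h3⟩
      apply Runs.set
      refine ⟨h1.upd _ _ (by simp) (by simp), ?_⟩
      simp [Expr.eval, h1 0, h2, h3, hk', hn, hN]
      ring
  · simp [Expr.cost]
    linarith

lemma rowProg_spec (s : Store) (n N Q X : ℕ) (hn : s 0 0 = n) (hN : s 3 0 = N) (hQ : s 2 0 = Q)
    (hX : n + N + 1 ≤ X) :
    Runs rowProg s (100 * X) fun s' => Frame 5 10 s s' ∧ ∀ x ≤ n + N, s' 5 x = x * Q := by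
  apply Runs.le
  · apply Runs.seq
    apply Runs.set
    apply Runs.forTo (n + N + 1) X (by omega) hX
      (fun x s' => Frame 5 10 s s' ∧ s' 9 0 = x * Q ∧ ∀ x' < x, s' 5 x' = x' * Q)
    · exact ⟨((Frame.refl s).upd _ _ (by simp) (by simp)).upd _ _ (by simp) (by simp),
        by simp [Expr.eval]⟩
    · rintro i s' ⟨h1, -⟩ -
      simp [Expr.eval, h1 0, h1 3, hn, hN]
    · rintro x s' hx ⟨h1, h2, h3⟩ h4
      apply Runs.seq
      apply Runs.set
      apply Runs.set
      refine ⟨by simp [h4], ((h1.upd _ _ (by simp) (by simp)).upd _ _ (by simp) (by simp)).upd _ _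
        (by simp) (by simp), ?_, ?_⟩
      · simp [Expr.eval, h1 2, h2, hQ]
        ring
      · intro x' hx'
        simp only [Expr.eval, h4, h2]
        rw [upd_of_ne _ _ _ (by simp), upd_of_ne _ _ _ (by simp), upd_same]
        split_ifs with h
        · rw [h]
        · exact h3 x' (by omega)
    · rintro s' ⟨h1, -, h3⟩
      exact ⟨h1, fun x hx => h3 x (by omega)⟩
  · simp [Expr.cost]
    omega

lemma stateKey_zero (k a : ℕ) : stateKey k a 0 = a % k * k := by simp [stateKey]

lemma stateKey_succ (k a i : ℕ) : stateKey k a (i + 1) = stateKey k (a / k) i + 1 := by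
  simp [stateKey, pow_succ', Nat.div_div_eq_div_mul, add_assoc]

lemma keyRowProg_spec (s : Store) (k N Q M a n : ℕ) (hM : 1 ≤ M) (hk1 : 1 ≤ k) (hk : k ≤ M)
    (hk' : s 0 2 = k) (hrow : ∀ x ≤ n + N, s 5 x = x * Q) (hkQ : k < Q) (haN : a < N)
    (h7 : s 7 0 = a) (h10 : s 10 0 = a / k) (h12 : s 12 0 = a % k * k)
    (hkey : ∀ a' < a, ∀ i < k, s 6 (a' * Q + i) = stateKey k a' i) :
    Runs keyRowProg s (100 * M) fun s' => Frame 6 9 s s' ∧ s' 7 = s 7 ∧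
      ∀ a' ≤ a, ∀ i < k, s' 6 (a' * Q + i) = stateKey k a' i := by
  apply Runs.le
  · apply Runs.seq
    apply Runs.set
    apply Runs.forTo (k - 1) M hM (by omega)
      (fun j s' => Frame 6 9 s s' ∧ s' 7 = s 7 ∧
        (∀ a' < a, ∀ i < k, s' 6 (a' * Q + i) = stateKey k a' i) ∧
        ∀ i ≤ j, s' 6 (a * Q + i) = stateKey k a i)
    · refine ⟨((Frame.refl s).upd _ _ (by simp) (by simp)).upd _ _ (by simp) (by simp), by simp,
        ?_, ?_⟩
      · intro a' ha' i hi
        simp only [Expr.eval, h7]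
        rw [upd_of_ne _ _ _ (by simp), upd_same, if_neg, hkey a' ha' i hi]
        rw [hrow a (by omega), show a * Q = a * Q + 0 from rfl,
          row_inj (hi.trans hkQ) (by omega)]
        omega
      · intro i hi
        obtain rfl : i = 0 := by omega
        simp [Expr.eval, h7, hrow a (by omega), h12, stateKey_zero]
    · rintro i s' ⟨h1, -⟩ -
      simp [Expr.eval, h1 0, hk']
    · rintro j s' hj ⟨h1, h2, h3, h4⟩ h5
      apply Runs.set
      simp only [Expr.eval, h2, h7, h5, h1 10 (by simp), h10, h1 5 (by simp)]
      rw [hrow a (by omega), hrow (a / k) ((Nat.div_le_self _ _).trans (by omega))]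
      refine ⟨by simp [h5], (h1.upd _ _ (by simp) (by simp)).upd _ _ (by simp) (by simp),
        by simp [h2], ?_, ?_⟩
      · intro a' ha' i hi
        rw [upd_of_ne _ _ _ (by simp), upd_same, if_neg, h3 a' ha' i hi]
        rw [row_inj (hi.trans hkQ) (by omega)]
        omega
      · intro i hi
        rw [upd_of_ne _ _ _ (by simp), upd_same]
        rcases Nat.le_succ_iff.mp hi with h | rfl
        · rw [if_neg, h4 i h]
          rw [row_inj (by omega) (by omega)]
          omega
        · rw [if_pos rfl, stateKey_succ]
          congr 1
          rcases (Nat.div_le_self a k).lt_or_eq with h | h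
          · exact h3 _ h j (by omega)
          · rw [h]; exact h4 j le_rfl
    · rintro s' ⟨h1, h2, h3, h4⟩
      refine ⟨h1, h2, fun a' ha' i hi => ?_⟩
      rcases ha'.lt_or_eq with h | rfl
      · exact h3 a' h i hi
      · exact h4 i (by omega)
  · simp [Expr.cost]
    omega

lemma keyProg_spec (s : Store) (k N Q M n : ℕ) (hM : 1 ≤ M) (hk1 : 1 ≤ k) (hk : k ≤ M)
    (hk' : s 0 2 = k) (hN : s 3 0 = N) (hNM : N ≤ M) (hrow : ∀ x ≤ n + N, s 5 x = x * Q)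
    (hkQ : k < Q) :
    Runs keyProg s (300 * M * M) fun s' => Frame 6 13 s s' ∧
      ∀ a < N, ∀ i < k, s' 6 (a * Q + i) = stateKey k a i := by
  apply Runs.le
  · apply Runs.seq
    apply Runs.set
    apply Runs.seq
    apply Runs.set
    apply Runs.seq
    apply Runs.set
    apply Runs.forTo N M hM hNM
      (fun a s' => Frame 6 13 s s' ∧ s' 10 0 = a / k ∧ s' 11 0 = a % k ∧ s' 12 0 = a % k * k ∧
        ∀ a' < a, ∀ i < k, s' 6 (a' * Q + i) = stateKey k a' i)
    · refine ⟨((((Frame.refl s).upd _ _ ?_ ?_).upd _ _ ?_ ?_).upd _ _ ?_ ?_).upd _ _ ?_ ?_, ?_⟩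
        <;> simp [Expr.eval]
    · rintro i s' ⟨h1, -⟩ -
      simp [Expr.eval, h1 3, hN]
    · rintro a s' ha ⟨h1, h2, h3, h4, h5⟩ h6
      apply Runs.seq
      apply Runs.imp
      · apply keyRowProg_spec s' k N Q M a n hM hk1 hk (by simp [h1 0, hk']) _ hkQ ha h6 h2 h4 h5
        simpa [h1 5]
      · rintro s₁ ⟨k1, k2, k3⟩
        have k4 := h1.trans (k1.mono le_rfl (by simp) : Frame 6 13 s' s₁)
        have e0 : s₁ 0 2 = k := by simp [k4 0, hk']
        have e7 : s₁ 7 0 = a := by rw [k2, h6]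
        have e10 : s₁ 10 0 = a / k := by rw [k1 10 (by simp), h2]
        have e11 : s₁ 11 0 = a % k := by rw [k1 11 (by simp), h3]
        have e12 : s₁ 12 0 = a % k * k := by rw [k1 12 (by simp), h4]
        have hlt := Nat.mod_lt a hk1
        apply Runs.seq
        apply Runs.set
        apply Runs.seq
        apply Runs.set
        have hd := Nat.div_add_mod a k
        apply Runs.cond <;> intro c
        · simp [Expr.eval, e0, e11] at c
          obtain ⟨q1, q2⟩ := (Nat.div_mod_unique (a := a + 1) (c := a % k + 1) (d := a / k) hk1).mpr
            ⟨by omega, by omega⟩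
          apply Runs.skip
          refine ⟨by simp [e7], ?_, ?_⟩
          · exact ((k4.upd _ _ (by simp) (by simp)).upd _ _ (by simp) (by simp)).upd _ _
              (by simp) (by simp)
          · simp [Expr.eval, e0, e10, e11, e12, q1, q2, add_mul]
            exact k3
        · simp [Expr.eval, e0, e11] at c
          obtain ⟨q1, q2⟩ := (Nat.div_mod_unique (a := a + 1) (c := 0) (d := a / k + 1) hk1).mpr
            ⟨by rw [mul_add]; omega, by omega⟩
          apply Runs.seq
          apply Runs.set
          apply Runs.seq
          apply Runs.set
          apply Runs.set
          refine ⟨by simp [e7], ?_, ?_⟩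
          · exact (((((k4.upd _ _ (by simp) (by simp)).upd _ _ (by simp) (by simp)).upd _ _
              (by simp) (by simp)).upd _ _ (by simp) (by simp)).upd _ _ (by simp) (by simp)).upd _ _
              (by simp) (by simp)
          · simp [Expr.eval, e10, q1, q2]
            exact k3
    · rintro s' ⟨h1, h2, h3, h4, h5⟩
      exact ⟨h1, h5⟩
  · simp [Expr.cost]
    have h1 : M ≤ M * M := Nat.le_mul_of_pos_right _ hM
    linarith

end RAM

/-! ### Reading the network -/

lemma pathEdges_length {V : Type*} (p : List V) : (pathEdges p).length = p.length - 1 := by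
  simp [pathEdges]

lemma pathEdges_getElem {V : Type*} (p : List V) (l : ℕ) (h : l < (pathEdges p).length) :
    (pathEdges p)[l] = (p[l]'(by simp [pathEdges] at h; omega),
      p[l + 1]'(by simp [pathEdges] at h; omega)) := by
  simp [pathEdges]

lemma mem_pathEdges_iff {V : Type*} {p : List V} {u w : V} :
    (u, w) ∈ pathEdges p ↔ ∃ l, ∃ h : l + 1 < p.length, p[l] = u ∧ p[l + 1] = w := by
  rw [List.mem_iff_getElem]
  constructor
  · rintro ⟨l, h, h'⟩
    rw [pathEdges_getElem] at h'
    rw [pathEdges_length] at h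
    exact ⟨l, by omega, by simpa using h'⟩
  · rintro ⟨l, h, h1, h2⟩
    refine ⟨l, by rw [pathEdges_length]; omega, ?_⟩
    rw [pathEdges_getElem, h1, h2]

lemma pathEdges_right_unique {V : Type*} {p : List V} (hp : p.Nodup) {u w w' : V}
    (h : (u, w) ∈ pathEdges p) (h' : (u, w') ∈ pathEdges p) : w = w' := by
  obtain ⟨l, hl, h1, h2⟩ := mem_pathEdges_iff.mp h
  obtain ⟨l', hl', h1', h2'⟩ := mem_pathEdges_iff.mp h'
  obtain rfl : l = l' := (hp.getElem_inj_iff (hi := by omega) (hj := by omega)).mp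
    (h1.trans h1'.symm)
  exact h2.symm.trans h2'

namespace RAM

/-- The cells of the array `f` from index `c` on contain the list `l`. -/
def Rd (f : ℕ → ℕ) : ℕ → List ℕ → Prop
  | _, [] => True
  | c, a :: l => f c = a ∧ Rd f (c + 1) l

lemma rd_append {f : ℕ → ℕ} {c : ℕ} {l l' : List ℕ} :
    Rd f c (l ++ l') ↔ Rd f c l ∧ Rd f (c + l.length) l' := by
  induction l generalizing c with
  | nil => simp [Rd]
  | cons a l ih => simp [Rd, ih, and_assoc, add_assoc, add_comm 1]

lemma rd_initial (x : List ℕ) : Rd (initial x 0) 0 x := by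
  have : ∀ (l pre : List ℕ), Rd (initial (pre ++ l) 0) pre.length l := by
    intro l
    induction l with
    | nil => simp [Rd]
    | cons a l ih =>
      intro pre
      refine ⟨by simp [initial], ?_⟩
      simpa using ih (pre ++ [a])
  exact this x []

/-- Reads the edges and stores the capacities in array `16`. Register `15` is the position in the
input. -/
def capProg : Prog :=
  .seq (setReg 15 (.lit 5))
    (forTo 14 (.get 0 (.lit 1))
      (.seq (.set 16 (.add (.get 5 (.get 0 (reg 15))) (.get 0 (.add (reg 15) (.lit 1))))
          (.get 0 (.add (reg 15) (.lit 2))))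
        (setReg 15 (.add (reg 15) (.lit 3)))))

lemma capProg_spec (s : Store) {n Q N X : ℕ} (es : List (Fin n × Fin n)) (c : Fin n × Fin n → ℕ)
    (rest : List ℕ) (hrow : ∀ x ≤ n + N, s 5 x = x * Q) (hnQ : n ≤ Q) (hm : s 0 1 = es.length)
    (hX : 1 ≤ X) (hmX : es.length ≤ X)
    (hrd : Rd (s 0) 5 (es.flatMap (fun e => [(e.1 : ℕ), (e.2 : ℕ), c e]) ++ rest)) :
    Runs capProg s (100 * X) fun s' => Frame 14 17 s s' ∧ Rd (s 0) (s' 15 0) rest ∧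
      ∀ e ∈ es, s' 16 (e.1 * Q + e.2) = c e := by
  apply Runs.le
  · apply Runs.seq
    apply Runs.set
    apply Runs.forTo es.length X hX hmX
      (fun j s' => Frame 14 17 s s' ∧
        Rd (s 0) (s' 15 0) ((es.drop j).flatMap (fun e => [(e.1 : ℕ), (e.2 : ℕ), c e]) ++ rest) ∧
        ∀ e ∈ es.take j, s' 16 (e.1 * Q + e.2) = c e)
    · exact ⟨((Frame.refl s).upd _ _ (by simp) (by simp)).upd _ _ (by simp) (by simp),
        by simpa [Expr.eval] using hrd⟩
    · rintro i s' ⟨h1, -⟩ -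
      simp [Expr.eval, h1 0, hm]
    · rintro j s' hj ⟨h1, h2, h3⟩ h4
      rw [List.drop_eq_getElem_cons hj] at h2
      simp only [List.flatMap_cons, List.cons_append, List.nil_append, Rd] at h2
      obtain ⟨r1, r2, r3, r4⟩ := h2
      apply Runs.seq
      apply Runs.set
      apply Runs.set
      refine ⟨by simp [h4], ?_, ?_, ?_⟩
      · exact ((h1.upd _ _ (by simp) (by simp)).upd _ _ (by simp) (by simp)).upd _ _
          (by simp) (by simp)
      · simpa [Expr.eval, h1 0] using r4
      · intro e he
        simp only [Expr.eval, h1 0 (by simp), r1, r2, r3, h1 5 (by simp)]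
        rw [upd_of_ne _ _ _ (by simp), upd_of_ne _ _ _ (by simp), upd_same,
          hrow _ (by have := es[j].1.isLt; omega)]
        have hi := row_inj (x := e.1) (y := e.2) (x' := es[j].1) (y' := es[j].2) (Q := Q)
          (by omega) (by omega)
        simp only [hi]
        split_ifs with h
        · congr 1
          ext <;> simp [h]
        · rw [List.take_succ_eq_append_getElem hj, List.mem_append] at he
          rcases he with he | he
          · exact h3 e he
          · simp only [List.mem_singleton] at he
            simp [he] at h
    · rintro s' ⟨h1, h2, h3⟩
      simp at h2 h3
      exact ⟨h1, h2, fun e he => h3 _ _ he⟩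
  · simp [Expr.cost]
    omega

/-- Reads a path and stores its successors in column `reg 24` of array `18`. -/
def pathProg : Prog :=
  .seq (setReg 23 (.get 0 (reg 15)))
    (.seq (setReg 15 (.add (reg 15) (.lit 1)))
      (forTo 22 (reg 23)
        (.seq (.cond (.sub (reg 23) (.add (reg 22) (.lit 1)))
            (.set 18 (.add (.get 5 (.get 0 (reg 15))) (reg 24))
              (.add (.get 0 (.add (reg 15) (.lit 1))) (.lit 1))) .skip)
          (setReg 15 (.add (reg 15) (.lit 1))))))

/-- Column `j` of the successor table `f` describes the path `p`: the entry of a vertex is its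
successor plus one, or zero if there is none. -/
def PathCol {n : ℕ} (f : ℕ → ℕ) (Q j : ℕ) (p : List (Fin n)) : Prop :=
  (∀ v w : Fin n, (v, w) ∈ pathEdges p → f (v * Q + j) = w + 1) ∧
    ∀ v : Fin n, f (v * Q + j) ≠ 0 → ∃ w : Fin n, f (v * Q + j) = w + 1 ∧ (v, w) ∈ pathEdges p

lemma pathProg_spec (s : Store) {n Q N X j : ℕ} (p : List (Fin n)) (hp : p.Nodup)
    (rest : List ℕ) (hrow : ∀ x ≤ n + N, s 5 x = x * Q) (hjQ : j < Q) (hj : s 24 0 = j)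
    (hX : 1 ≤ X) (hnX : n ≤ X) (h0 : ∀ v < n, s 18 (v * Q + j) = 0)
    (hrd : Rd (s 0) (s 15 0) (p.length :: p.map (fun v : Fin n => (v : ℕ)) ++ rest)) :
    Runs pathProg s (100 * X) fun s' => Frame 15 24 s s' ∧ s' 16 = s 16 ∧ s' 17 = s 17 ∧
      s' 20 = s 20 ∧ Rd (s 0) (s' 15 0) rest ∧ PathCol (s' 18) Q j p ∧
      ∀ v j', j' < Q → j' ≠ j → s' 18 (v * Q + j') = s 18 (v * Q + j') := by
  have hlen : p.length ≤ n := by simpa using hp.length_le_card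
  simp only [List.cons_append, Rd] at hrd
  apply Runs.le
  · apply Runs.seq
    apply Runs.set
    apply Runs.seq
    apply Runs.set
    apply Runs.forTo p.length X hX (hlen.trans hnX)
      (fun l s' => Frame 15 24 s s' ∧ s' 16 = s 16 ∧ s' 17 = s 17 ∧ s' 20 = s 20 ∧
        s' 23 0 = p.length ∧
        Rd (s 0) (s' 15 0) ((p.drop l).map (fun v : Fin n => (v : ℕ)) ++ rest) ∧
        (∀ v w : Fin n, (v, w) ∈ (pathEdges p).take l → s' 18 (v * Q + j) = w + 1) ∧
        (∀ v : Fin n, s' 18 (v * Q + j) ≠ 0 →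
          ∃ w : Fin n, s' 18 (v * Q + j) = w + 1 ∧ (v, w) ∈ pathEdges p) ∧
        ∀ v j', j' < Q → j' ≠ j → s' 18 (v * Q + j') = s 18 (v * Q + j'))
    · refine ⟨(((Frame.refl s).upd _ _ ?_ ?_).upd _ _ ?_ ?_).upd _ _ ?_ ?_, ?_⟩ <;>
        simp [Expr.eval, hrd, h0]
    · rintro i s' ⟨h1, h2, h3, h4, h5, -⟩ -
      simp [Expr.eval, h5]
    · rintro l s' hl ⟨h1, h2, h2', h2'', h3, h4, h5, h6, h7⟩ h8
      rw [List.drop_eq_getElem_cons hl] at h4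
      simp only [List.map_cons, List.cons_append, Rd] at h4
      obtain ⟨r1, r2⟩ := h4
      have hv := p[l].isLt
      apply Runs.seq
      apply Runs.cond <;> intro c
      · simp only [Expr.eval, h3, h8] at c
        have hl' : l + 1 < p.length := by omega
        have r3 : s 0 (s' 15 0 + 1) = p[l + 1] := by
          rw [List.drop_eq_getElem_cons hl'] at r2
          exact r2.1
        have hmem : (p[l], p[l + 1]) ∈ pathEdges p := mem_pathEdges_iff.mpr ⟨l, hl', rfl, rfl⟩
        apply Runs.set
        apply Runs.set
        simp only [Expr.eval, h1 0 (by simp), r1, r3, h1 5 (by simp), h1 24 (by simp), hj,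
          hrow p[l] (by omega)]
        have e : ∀ i, upd (upd (upd s' 18 (p[l] * Q + j) (p[l + 1] + 1)) 15 0
            (upd s' 18 (p[l] * Q + j) (p[l + 1] + 1) 15 0 + 1)) 22 0 (l + 1) 18 i =
            if i = p[l] * Q + j then (p[l + 1] : ℕ) + 1 else s' 18 i := by
          intro i
          rw [upd_of_ne _ _ _ (by simp), upd_of_ne _ _ _ (by simp), upd_same]
        refine ⟨by simp [h8], ?_, by simp [h2], by simp [h2'], by simp [h2''], by simp [h3],
          by simpa using r2, ?_, ?_, ?_⟩
        · exact ((h1.upd _ _ (by simp) (by simp)).upd _ _ (by simp) (by simp)).upd _ _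
            (by simp) (by simp)
        · intro v w hvw
          simp only [e, row_inj hjQ hjQ]
          split_ifs with h
          · obtain rfl : v = p[l] := Fin.ext h.1
            rw [pathEdges_right_unique hp (List.mem_of_mem_take hvw) hmem]
          · rw [List.take_succ_eq_append_getElem (by rw [pathEdges_length]; omega),
              List.mem_append, pathEdges_getElem] at hvw
            rcases hvw with hvw | hvw
            · exact h5 v w hvw
            · simp only [List.mem_singleton, Prod.mk.injEq] at hvw
              simp [hvw.1] at h
        · intro v
          simp only [e, row_inj hjQ hjQ]
          split_ifs with h
          · obtain rfl : v = p[l] := Fin.ext h.1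
            exact fun _ => ⟨_, rfl, hmem⟩
          · exact h6 v
        · intro v j' hj' hne
          rw [e, if_neg (fun h => hne ((row_inj hj' hjQ).mp h).2)]
          exact h7 v j' hj' hne
      · simp only [Expr.eval, h3, h8] at c
        apply Runs.skip
        apply Runs.set
        refine ⟨by simp [h8], ?_, by simp [h2], by simp [h2'], by simp [h2''], by simp [h3],
          by simpa [Expr.eval] using r2, ?_, by simpa using h6, by simpa using h7⟩
        · exact (h1.upd _ _ (by simp) (by simp)).upd _ _ (by simp) (by simp)
        · intro v w hvw
          rw [upd_of_ne _ _ _ (by simp), upd_of_ne _ _ _ (by simp)]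
          refine h5 v w ?_
          rw [List.take_of_length_le (by rw [pathEdges_length]; omega)] at hvw ⊢
          exact hvw
    · rintro s' ⟨h1, h2, h2', h2'', h3, h4, h5, h6, h7⟩
      rw [List.take_of_length_le (by rw [pathEdges_length]; omega)] at h5
      simp at h4
      exact ⟨h1, h2, h2', h2'', h4, ⟨h5, h6⟩, h7⟩
  · simp [Expr.cost]
    omega

/-- Reads the pairs: the demand of pair `i` goes to array `17`, the successors on its old and on its
new path go to the columns `2 * i` and `2 * i + 1` of array `18`. -/
def pairsProg : Prog :=
  .seq (setReg 24 (.lit 0))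
    (forTo 20 kE
      (.seq (.set 17 (reg 20) (.get 0 (reg 15)))
        (.seq (setReg 15 (.add (reg 15) (.lit 1)))
          (.seq pathProg (.seq (setReg 24 (.add (reg 24) (.lit 1)))
            (.seq pathProg (setReg 24 (.add (reg 24) (.lit 1)))))))))

lemma pairsProg_spec (s : Store) {n k Q N X Y : ℕ} (d : Fin k → ℕ) (old new : Fin k → List (Fin n))
    (hold : ∀ i, (old i).Nodup) (hnew : ∀ i, (new i).Nodup) (hk : s 0 2 = k)
    (hrow : ∀ x ≤ n + N, s 5 x = x * Q) (hkQ : 2 * k < Q)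
    (hX : 1 ≤ X) (hnX : n ≤ X) (hY : 1 ≤ Y) (hkY : k ≤ Y) (h0 : ∀ j, s 18 j = 0)
    (hrd : Rd (s 0) (s 15 0) ((List.finRange k).flatMap fun i =>
      [d i] ++ ((old i).length :: (old i).map fun v : Fin n => (v : ℕ)) ++
        ((new i).length :: (new i).map fun v : Fin n => (v : ℕ)))) :
    Runs pairsProg s (300 * X * Y) fun s' => Frame 15 25 s s' ∧ s' 16 = s 16 ∧
      ∀ i : Fin k, s' 17 i = d i ∧ PathCol (s' 18) Q (i + i) (old i) ∧
        PathCol (s' 18) Q (i + i + 1) (new i) := by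
  apply Runs.le
  · apply Runs.seq
    apply Runs.set
    apply Runs.forTo k Y hY hkY
      (fun j s' => Frame 15 25 s s' ∧ s' 16 = s 16 ∧ s' 24 0 = j + j ∧
        Rd (s 0) (s' 15 0) (((List.finRange k).drop j).flatMap fun i =>
          [d i] ++ ((old i).length :: (old i).map fun v : Fin n => (v : ℕ)) ++
          ((new i).length :: (new i).map fun v : Fin n => (v : ℕ))) ∧
        (∀ v j', j + j ≤ j' → j' < Q → s' 18 (v * Q + j') = 0) ∧
        ∀ i : Fin k, i < j → s' 17 i = d i ∧ PathCol (s' 18) Q (i + i) (old i) ∧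
          PathCol (s' 18) Q (i + i + 1) (new i))
    · refine ⟨((Frame.refl s).upd _ _ ?_ ?_).upd _ _ ?_ ?_, ?_⟩ <;> simp [Expr.eval, h0]
      simpa using hrd
    · rintro i s' ⟨h1, -⟩ -
      simp [Expr.eval, h1 0, hk]
    · rintro j s' hj ⟨h1, h2, h3, h4, h5, h6⟩ h7
      rw [List.drop_eq_getElem_cons (by simpa using hj)] at h4
      simp only [List.flatMap_cons, List.cons_append, List.nil_append, Rd, List.append_assoc,
        List.getElem_finRange] at h4
      obtain ⟨r1, r2⟩ := h4
      set i : Fin k := Fin.cast (by simp) (⟨j, by simpa using hj⟩ : Fin (List.finRange k).length)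
        with hi
      have hij : (i : ℕ) = j := by simp [hi]
      clear_value i
      apply Runs.seq
      apply Runs.set
      apply Runs.seq
      apply Runs.set
      simp only [Expr.eval, h7, h1 0 (by simp), r1]
      set s₁ := upd (upd s' 17 j (d i)) 15 0 _ with hs₁
      have k1 : Frame 15 25 s s₁ :=
        (h1.upd _ _ (by simp) (by simp)).upd _ _ (by simp) (by simp)
      have k20 : s₁ 20 = s' 20 := by simp [hs₁]
      have k24 : s₁ 24 0 = j + j := by simp [hs₁, h3]
      have k18 : s₁ 18 = s' 18 := by simp [hs₁]
      have k17 : ∀ x, s₁ 17 x = if x = j then d i else s' 17 x := fun x => by simp [hs₁]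
      have k15 : s₁ 15 0 = s' 15 0 + 1 := by simp [hs₁]
      have k16 : s₁ 16 = s 16 := by simp [hs₁, h2]
      clear_value s₁
      apply Runs.seq
      apply Runs.imp
      · apply pathProg_spec s₁ (Q := Q) (N := N) (old i) (hold i) _ _ (by omega) k24 hX hnX
          (fun v hv => by rw [k18]; exact h5 v _ le_rfl (by omega))
        · rw [k1 0 (by simp), k15]
          exact r2
        · simpa [k1 5] using hrow
      · rintro s₂ ⟨l1, l16, l17, l20, l15, l18, l18'⟩
        have m1 := k1.trans (l1.mono le_rfl (by simp) : Frame 15 25 s₁ s₂)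
        apply Runs.seq
        apply Runs.set
        have n1 : Frame 15 25 s (upd s₂ 24 0 (s₂ 24 0 + 1)) := m1.upd _ _ (by simp) (by simp)
        simp only [Expr.eval] at n1 ⊢
        apply Runs.seq
        apply Runs.imp
        · apply pathProg_spec _ (Q := Q) (N := N) (j := j + j + 1) (new i) (hnew i) _ _ (by omega) _
            hX hnX
          · intro v hv
            rw [upd_of_ne _ _ _ (by simp), l18' _ _ (by omega) (by omega), k18]
            exact h5 v _ (by omega) (by omega)
          · rw [n1 0 (by simp), upd_of_ne _ _ _ (by simp)]
            rw [k1 0 (by simp)] at l15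
            exact l15
          · simpa [m1 5] using hrow
          · simp [l1 24, k24]
        · rintro s₃ ⟨p1, p16, p17, p20, p15, p18, p18'⟩
          have q1 := n1.trans (p1.mono le_rfl (by simp) : Frame 15 25 _ s₃)
          simp only [upd_of_ne _ _ _ (by simp : 16 ≠ 24), upd_of_ne _ _ _ (by simp : 17 ≠ 24),
            upd_of_ne _ _ _ (by simp : 20 ≠ 24), upd_of_ne _ _ _ (by simp : 18 ≠ 24),
            upd_of_ne _ _ _ (by simp : 0 ≠ 24)] at p16 p17 p20 p15 p18'
          rw [m1 0 (by simp)] at p15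
          apply Runs.set
          have e24 : s₃ 24 0 = j + j + 1 := by rw [p1 24 (by simp)]; simp [l1 24, k24]
          simp only [Expr.eval, e24]
          have e18 : ∀ v j', j' < Q → j' ≠ j + j → j' ≠ j + j + 1 →
              s₃ 18 (v * Q + j') = s' 18 (v * Q + j') := fun v j' q2 q3 q4 => by
            rw [p18' v j' q2 q4, l18' v j' q2 q3, k18]
          refine ⟨by simp [p20, l20, k20, h7],
            (q1.upd _ _ (by simp) (by simp)).upd _ _ (by simp) (by simp),
            by simp [p16, l16, k16], by simp; omega, by simpa using p15, ?_, ?_⟩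
          · intro v j' q2 q3
            rw [upd_of_ne _ _ _ (by simp), upd_of_ne _ _ _ (by simp),
              e18 v j' q3 (by omega) (by omega)]
            exact h5 v j' (by omega) q3
          · intro i' hi'
            rw [upd_of_ne _ _ _ (by simp), upd_of_ne _ _ _ (by simp),
              upd_of_ne _ _ _ (by simp), upd_of_ne _ _ _ (by simp), p17, l17, k17]
            by_cases hh : i' = i
            · subst hh
              rw [if_pos hij, hij]
              refine ⟨rfl, ?_, p18⟩
              have : ∀ v, s₃ 18 (v * Q + (j + j)) = s₂ 18 (v * Q + (j + j)) := fun v =>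
                p18' v _ (by omega) (by omega)
              simpa only [PathCol, this] using l18
            · have hne : (i' : ℕ) ≠ j := fun h => hh (Fin.ext (h.trans hij.symm))
              rw [if_neg hne]
              have q5 := h6 i' (by omega)
              have : ∀ v, s₃ 18 (v * Q + (i' + i')) = s' 18 (v * Q + (i' + i')) := fun v =>
                e18 v _ (by omega) (by omega) (by omega)
              have this' : ∀ v, s₃ 18 (v * Q + (i' + i' + 1)) = s' 18 (v * Q + (i' + i' + 1)) :=
                fun v => e18 v _ (by omega) (by omega) (by omega)
              simpa only [PathCol, this, this'] using q5
    · rintro s' ⟨h1, h2, -, -, -, h6⟩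
      exact ⟨h1, h2, fun i => h6 i i.isLt⟩
  · simp [Expr.cost]
    have h1 : X ≤ X * Y := Nat.le_mul_of_pos_right _ hY
    have h2 : Y ≤ X * Y := Nat.le_mul_of_pos_left _ hX
    have h3 : 1 ≤ X * Y := hX.trans h1
    nlinarith

end RAM

/-! ### Topological sorting -/

namespace RAM

open Classical in
/-- The number of successor entries `(u, j)` satisfying `P` that point to `w`. -/
noncomputable def entryCount (n m : ℕ) (nx : ℕ → ℕ → ℕ) (P : ℕ → ℕ → Prop) (w : ℕ) : ℕ :=
  ((Finset.range n ×ˢ Finset.range m).filter fun e => nx e.1 e.2 = w + 1 ∧ P e.1 e.2).card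

section

variable {n m : ℕ} {nx : ℕ → ℕ → ℕ}

lemma entryCount_congr {P P' : ℕ → ℕ → Prop} (h : ∀ u < n, ∀ j < m, P u j ↔ P' u j) (w : ℕ) :
    entryCount n m nx P w = entryCount n m nx P' w := by
  classical
  unfold entryCount
  congr 1
  apply Finset.filter_congr
  intro e he
  simp only [Finset.mem_product, Finset.mem_range] at he
  rw [h _ he.1 _ he.2]

lemma entryCount_insert {P P' : ℕ → ℕ → Prop} {v j : ℕ} (hv : v < n) (hj : j < m)
    (h : ∀ u j', P' u j' ↔ P u j' ∨ (u = v ∧ j' = j)) (hP : ¬ P v j) (w : ℕ) :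
    entryCount n m nx P' w = entryCount n m nx P w + if nx v j = w + 1 then 1 else 0 := by
  classical
  unfold entryCount
  split_ifs with hx
  · rw [← Finset.card_insert_of_notMem (a := (v, j)) (by simp [hP])]
    congr 1
    ext ⟨u, j'⟩
    simp only [Finset.mem_filter, Finset.mem_product, Finset.mem_range, h, Finset.mem_insert,
      Prod.mk.injEq]
    constructor
    · rintro ⟨h1, h2, h3 | h3⟩
      · exact Or.inr ⟨h1, h2, h3⟩
      · exact Or.inl h3
    · rintro (⟨rfl, rfl⟩ | ⟨h1, h2, h3⟩)
      · exact ⟨⟨hv, hj⟩, hx, Or.inr ⟨rfl, rfl⟩⟩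
      · exact ⟨h1, h2, Or.inl h3⟩
  · rw [add_zero]
    congr 1
    apply Finset.filter_congr
    rintro ⟨u, j'⟩ -
    simp only [h]
    constructor
    · rintro ⟨h1, h2 | ⟨rfl, rfl⟩⟩
      · exact ⟨h1, h2⟩
      · exact absurd h1 hx
    · rintro ⟨h1, h2⟩
      exact ⟨h1, Or.inl h2⟩

lemma entryCount_eq_zero {P : ℕ → ℕ → Prop} {w : ℕ} :
    entryCount n m nx P w = 0 ↔ ∀ u < n, ∀ j < m, nx u j = w + 1 → ¬ P u j := by
  classical
  unfold entryCount
  rw [Finset.card_eq_zero, Finset.filter_eq_empty_iff]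
  simp only [Finset.mem_product, Finset.mem_range, Prod.forall]
  constructor
  · intro h u hu j hj h1 h2
    exact h u j ⟨hu, hj⟩ ⟨h1, h2⟩
  · rintro h u j ⟨hu, hj⟩ ⟨h1, h2⟩
    exact h u hu j hj h1 h2

end

/-- Counts in array `30` the successor entries that point to each vertex. -/
def countProg : Prog :=
  forTo 33 nE (forTo 34 (.add kE kE)
    (.seq (setReg 36 (.get 18 (.add (.get 5 (reg 33)) (reg 34))))
      (.cond (reg 36)
        (.set 30 (.sub (reg 36) (.lit 1)) (.add (.get 30 (.sub (reg 36) (.lit 1))) (.lit 1)))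
        .skip)))

/-- Discards the entry in column `reg 34` of the row that starts at `reg 35`. If no other entry for
the same vertex is left, the vertex joins the queue in array `31`, which ends at `reg 32`. -/
def relaxProg : Prog :=
  .seq (setReg 36 (.get 18 (.add (reg 35) (reg 34))))
    (.cond (reg 36)
      (.seq (.set 30 (.sub (reg 36) (.lit 1)) (.sub (.get 30 (.sub (reg 36) (.lit 1))) (.lit 1)))
        (.cond (.get 30 (.sub (reg 36) (.lit 1))) .skip
          (.seq (.set 31 (reg 32) (.sub (reg 36) (.lit 1)))
            (setReg 32 (.add (reg 32) (.lit 1))))))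
      .skip)

/-- Kahn's algorithm, started with the source, which is the only vertex without incoming edges. -/
def sortProg : Prog :=
  .seq countProg
    (.seq (.set 31 (.lit 0) (.get 0 (.lit 3)))
      (.seq (setReg 32 (.lit 1))
        (forTo 33 nE (.seq (setReg 35 (.get 5 (.get 31 (reg 33))))
          (forTo 34 (.add kE kE) relaxProg)))))

lemma countProg_spec (s : Store) {n k Q N X Y : ℕ} (nx : ℕ → ℕ → ℕ)
    (hk : s 0 2 = k) (hn : s 0 0 = n) (hrow : ∀ x ≤ n + N, s 5 x = x * Q)
    (hX : 1 ≤ X) (hnX : n ≤ X) (hY : 1 ≤ Y) (hkY : k + k ≤ Y) (h0 : ∀ j, s 30 j = 0)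
    (hnx : ∀ u j, s 18 (u * Q + j) = nx u j) :
    Runs countProg s (100 * X * Y) fun s' => Frame 30 37 s s' ∧ s' 31 = s 31 ∧
      ∀ w, s' 30 w = entryCount n (k + k) nx (fun _ _ => True) w := by
  apply Runs.le
  · apply Runs.forTo n X hX hnX
      (fun v s' => Frame 30 37 s s' ∧ s' 31 = s 31 ∧
        ∀ w, s' 30 w = entryCount n (k + k) nx (fun u _ => u < v) w)
    · refine ⟨(Frame.refl s).upd _ _ ?_ ?_, by simp, ?_⟩ <;> simp
      intro w
      rw [h0]
      symm
      rw [entryCount_eq_zero]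
      simp
    · rintro i s' ⟨h1, -⟩ -
      simp [Expr.eval, h1 0, hn]
    · rintro v s' hv ⟨h1, h31, h2⟩ h3
      apply Runs.forTo (k + k) Y hY hkY
        (fun j s' => Frame 30 37 s s' ∧ s' 31 = s 31 ∧ s' 33 0 = v ∧
          ∀ w, s' 30 w = entryCount n (k + k) nx (fun u j' => u < v ∨ (u = v ∧ j' < j)) w)
      · refine ⟨h1.upd _ _ (by simp) (by simp), by simpa, by simpa, ?_⟩
        simpa using h2
      · rintro i s' ⟨h1, -⟩ -
        simp [Expr.eval, h1 0, hk]
      · rintro j s₁ hj ⟨k1, k31, k2, k3⟩ k4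
        have ins : ∀ w, entryCount n (k + k) nx (fun u j' => u < v ∨ (u = v ∧ j' < j + 1)) w =
            entryCount n (k + k) nx (fun u j' => u < v ∨ (u = v ∧ j' < j)) w +
              if nx v j = w + 1 then 1 else 0 :=
          entryCount_insert hv hj (fun u j' => by omega) (by omega)
        apply Runs.seq
        apply Runs.set
        have ex : s₁ 18 (s₁ 5 (s₁ 33 0) + s₁ 34 0) = nx v j := by
          rw [k1 18 (by simp), k1 5 (by simp), k2, k4, hrow v (by omega), hnx]
        simp only [Expr.eval, ex]
        apply Runs.cond <;> intro c
        · simp [Expr.eval] at c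
          apply Runs.set
          refine ⟨by simp [k4], ((k1.upd _ _ (by simp) (by simp)).upd _ _ (by simp)
            (by simp)).upd _ _ (by simp) (by simp), by simp [k31], by simp [k2], ?_⟩
          intro w
          rw [ins]
          simp [Expr.eval, k3]
          by_cases hw : w = nx v j - 1
          · rw [if_pos hw, if_pos (by omega), hw]
          · rw [if_neg hw, if_neg (by omega), add_zero]
        · simp [Expr.eval] at c
          apply Runs.skip
          refine ⟨by simp [k4], (k1.upd _ _ (by simp) (by simp)).upd _ _ (by simp)
            (by simp), by simp [k31], by simp [k2], ?_⟩
          intro w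
          rw [ins, c]
          simp [k3]
      · rintro s' ⟨k1, k31, k2, k3⟩
        refine ⟨k2, k1.upd _ _ (by simp) (by simp), by simpa, ?_⟩
        intro w
        rw [upd_of_ne _ _ _ (by simp), k3]
        apply entryCount_congr
        intro u _ j hj
        omega
    · rintro s' ⟨h1, h31, h2⟩
      refine ⟨h1, h31, fun w => ?_⟩
      rw [h2]
      apply entryCount_congr
      intro u hu j hj
      simp [hu]
  · simp [Expr.cost]
    have h1 : X ≤ X * Y := Nat.le_mul_of_pos_right _ hY
    nlinarith

/-- The queue `L` of vertices without pending incoming entries, as it is kept in memory. The entries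
satisfying `P` are the pending ones. -/
structure QueueInv (n m : ℕ) (nx : ℕ → ℕ → ℕ) (P : ℕ → ℕ → Prop) (s : Store) (L : List ℕ) :
    Prop where
  nodup : L.Nodup
  lt : ∀ x ∈ L, x < n
  cells : ∀ i, ∀ h : i < L.length, s 31 i = L[i]
  tail : s 32 0 = L.length
  count : ∀ w < n, s 30 w = entryCount n m nx P w
  mem : ∀ w < n, w ∈ L ↔ entryCount n m nx P w = 0
  order : ∀ u < n, ∀ j < m, ∀ w, nx u j = w + 1 → w ∈ L → u ∈ L ∧ L.idxOf u < L.idxOf w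

lemma QueueInv.congr {n m : ℕ} {nx : ℕ → ℕ → ℕ} {P P' : ℕ → ℕ → Prop} {s s' : Store} {L : List ℕ}
    (h : QueueInv n m nx P s L) (hP : ∀ u < n, ∀ j < m, P u j ↔ P' u j) (h30 : s' 30 = s 30)
    (h31 : s' 31 = s 31) (h32 : s' 32 = s 32) : QueueInv n m nx P' s' L := by
  obtain ⟨h1, h2, h3, h4, h5, h6, h7⟩ := h
  have e := entryCount_congr (nx := nx) hP
  exact ⟨h1, h2, by simpa [h31], by simpa [h32], by simpa [h30, ← e], by simpa [← e], h7⟩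

lemma relaxProg_spec (s : Store) {n m v j : ℕ} {nx : ℕ → ℕ → ℕ} {P P' : ℕ → ℕ → Prop}
    {L : List ℕ} (hq : QueueInv n m nx P s L) (hv : v < n) (hj : j < m)
    (hP : ∀ u j', P u j' ↔ P' u j' ∨ (u = v ∧ j' = j)) (hP' : ¬ P' v j)
    (hdone : ∀ u j', u < n → ¬ P' u j' → u ∈ L) (hle : ∀ u < n, ∀ j < m, nx u j ≤ n)
    (hx : s 18 (s 35 0 + s 34 0) = nx v j) :
    Runs relaxProg s 100 fun s' => Frame 30 37 s s' ∧ s' 33 = s 33 ∧ s' 34 = s 34 ∧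
      s' 35 = s 35 ∧ ∃ L', L <+: L' ∧ QueueInv n m nx P' s' L' := by
  have ins : ∀ w, entryCount n m nx P w = entryCount n m nx P' w +
      if nx v j = w + 1 then 1 else 0 := entryCount_insert hv hj hP hP'
  apply Runs.le
  · apply Runs.seq
    apply Runs.set
    simp only [Expr.eval, hx]
    apply Runs.cond
    · intro c
      simp [Expr.eval] at c
      obtain ⟨w, hw⟩ := Nat.exists_eq_succ_of_ne_zero c
      have hwn : w < n := by have := hle v hv j hj; omega
      have hwc : entryCount n m nx P w = entryCount n m nx P' w + 1 := by rw [ins, if_pos hw]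
      have hwL : w ∉ L := by rw [hq.mem w hwn]; omega
      have hother : ∀ w', w' ≠ w → entryCount n m nx P' w' = entryCount n m nx P w' := by
        intro w' h
        rw [ins, if_neg (by omega), add_zero]
      apply Runs.seq
      apply Runs.set
      set s₁ := upd (upd s 36 0 (nx v j)) 30 _ _ with hs₁
      have e30 : ∀ w' < n, s₁ 30 w' = entryCount n m nx P' w' := by
        intro w' hw'
        simp only [hs₁, Expr.eval, upd_same, hw]
        simp
        split_ifs with h
        · rw [hq.count w hwn, hwc, h]; rfl
        · rw [hq.count w' hw', hother w' h]
      have f₁ : Frame 30 37 s s₁ :=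
        ((Frame.refl s).upd _ _ (by simp) (by simp)).upd _ _ (by simp) (by simp)
      have e31 : s₁ 31 = s 31 := by simp [hs₁]
      have e32 : s₁ 32 = s 32 := by simp [hs₁]
      have e33 : s₁ 33 = s 33 := by simp [hs₁]
      have e34 : s₁ 34 = s 34 := by simp [hs₁]
      have e35 : s₁ 35 = s 35 := by simp [hs₁]
      have e36 : s₁ 36 0 = w + 1 := by simp [hs₁, hw]
      clear_value s₁
      apply Runs.cond
      · intro c
        simp only [Expr.eval, e36, Nat.add_sub_cancel, e30 w hwn] at c
        apply Runs.skip
        refine ⟨f₁, e33, e34, e35, L, List.prefix_refl _, hq.nodup, hq.lt, by simpa [e31] using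
          hq.cells, by simpa [e32] using hq.tail, e30, ?_, hq.order⟩
        intro w' hw'
        by_cases h : w' = w
        · subst h; simp [hwL, c]
        · rw [hother w' h]; exact hq.mem w' hw'
      · intro c
        simp only [Expr.eval, e36, Nat.add_sub_cancel, e30 w hwn] at c
        apply Runs.seq
        apply Runs.set
        apply Runs.set
        simp only [Expr.eval, e36, Nat.add_sub_cancel, e32]
        refine ⟨(f₁.upd _ _ (by simp) (by simp)).upd _ _ (by simp) (by simp), by simp [e33],
          by simp [e34], by simp [e35], L ++ [w], List.prefix_append _ _, ?_, ?_, ?_, ?_, ?_, ?_,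
          ?_⟩
        · rw [List.nodup_append]
          exact ⟨hq.nodup, by simp, fun a ha b hb hab => hwL
            ((hab.trans (List.mem_singleton.mp hb)) ▸ ha)⟩
        · intro x hx
          rw [List.mem_append, List.mem_singleton] at hx
          rcases hx with hx | rfl
          · exact hq.lt x hx
          · exact hwn
        · intro i hi
          rw [upd_of_ne _ _ _ (by simp), upd_same, hq.tail]
          split_ifs with h
          · subst h; simp
          · have : i < L.length := by simp at hi; omega
            rw [List.getElem_append_left this, e31, hq.cells i this]
        · simp [e32, hq.tail]
        · simpa using e30
        · intro w' hw'
          by_cases h : w' = w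
          · subst h; simp [c]
          · rw [hother w' h, ← hq.mem w' hw']; simp [h]
        · intro u hu j' hj' w' h1 h2
          rw [List.mem_append, List.mem_singleton] at h2
          rcases h2 with h2 | rfl
          · obtain ⟨h3, h4⟩ := hq.order u hu j' hj' w' h1 h2
            refine ⟨List.mem_append_left _ h3, ?_⟩
            rwa [List.idxOf_append_of_mem h3, List.idxOf_append_of_mem h2]
          · have h3 : u ∈ L := hdone u j' hu ((entryCount_eq_zero.mp c) u hu j' hj' h1)
            refine ⟨List.mem_append_left _ h3, ?_⟩
            rw [List.idxOf_append_of_mem h3, List.idxOf_append_of_notMem hwL]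
            have := List.idxOf_lt_length_of_mem h3
            omega
    · intro c
      simp [Expr.eval] at c
      apply Runs.skip
      refine ⟨(Frame.refl s).upd _ _ (by simp) (by simp), by simp, by simp, by simp, L,
        List.prefix_refl _, ?_⟩
      have : ∀ w, entryCount n m nx P' w = entryCount n m nx P w := by
        intro w; rw [ins, if_neg (by omega), add_zero]
      exact ⟨hq.nodup, hq.lt, by simpa using hq.cells, by simpa using hq.tail,
        by simpa [this] using hq.count, by simpa [this] using hq.mem, hq.order⟩
  · simp [Expr.cost]

/-- Kahn's algorithm writes a topological order of the vertices to array `31`. -/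
lemma sortProg_spec (s : Store) {n k Q N X Y src : ℕ} (nx : ℕ → ℕ → ℕ)
    (hk : s 0 2 = k) (hn : s 0 0 = n) (hrow : ∀ x ≤ n + N, s 5 x = x * Q)
    (hX : 1 ≤ X) (hnX : n ≤ X) (hY : 1 ≤ Y) (hkY : k + k ≤ Y) (h0 : ∀ j, s 30 j = 0)
    (hnx : ∀ u j, s 18 (u * Q + j) = nx u j) (hsrc : s 0 3 = src) (hsn : src < n)
    (hle : ∀ u < n, ∀ j < k + k, nx u j ≤ n)
    (hin : ∀ w < n, entryCount n (k + k) nx (fun _ _ => True) w = 0 ↔ w = src)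
    (rank : ℕ → ℕ) (hrank : ∀ u < n, ∀ j < k + k, ∀ w, nx u j = w + 1 → rank u < rank w) :
    Runs sortProg s (600 * X * Y) fun s' => Frame 30 37 s s' ∧ ∃ L : List ℕ, L.Nodup ∧
      L.length = n ∧ (∀ x ∈ L, x < n) ∧ (∀ p, ∀ h : p < L.length, s' 31 p = L[p]) ∧
      ∀ u < n, ∀ j < k + k, ∀ w, nx u j = w + 1 → L.idxOf u < L.idxOf w := by
  apply Runs.le
  · apply Runs.seq
    apply (countProg_spec s nx hk hn hrow hX hnX hY hkY h0 hnx).imp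
    rintro s₀ ⟨f0, h31, h30⟩
    apply Runs.seq
    apply Runs.set
    apply Runs.seq
    apply Runs.set
    apply Runs.forTo n X hX hnX
      (fun p s' => Frame 30 37 s s' ∧ ∃ L, p ≤ L.length ∧
        QueueInv n (k + k) nx (fun u _ => u ∉ L.take p) s' L)
    · refine ⟨((f0.upd _ _ (by simp) (by simp)).upd _ _ (by simp) (by simp)).upd _ _ (by simp)
        (by simp), [src], by simp, ?_⟩
      have e : ∀ w, entryCount n (k + k) nx (fun u _ => u ∉ List.take 0 [src]) w =
          entryCount n (k + k) nx (fun _ _ => True) w :=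
        entryCount_congr (by simp)
      refine ⟨by simp, by simpa, ?_, by simp [Expr.eval], ?_, ?_, ?_⟩
      · intro i hi
        obtain rfl : i = 0 := by simpa using hi
        simp [Expr.eval, f0 0, hsrc]
      · intro w hw
        rw [e]; simp [h30]
      · intro w hw
        rw [e, hin w hw]; simp
      · intro u hu j hj w h1 h2
        obtain rfl : w = src := by simpa using h2
        exact absurd trivial (entryCount_eq_zero.mp ((hin w hsn).mpr rfl) u hu j hj h1)
    · rintro i s' ⟨h1, -⟩ -
      simp [Expr.eval, h1 0, hn]
    · rintro p s' hp ⟨h1, L, hpL, hq⟩ h3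
      -- A vertex of least rank outside the queue would have all its predecessors processed.
      have hpL' : p < L.length := by
        by_contra hcon
        have hall : L.take p = L := List.take_of_length_le (by omega)
        have : ∀ r w, w < n → rank w < r → w ∈ L := by
          intro r
          induction r with
          | zero => intro w _ h; omega
          | succ r ih =>
            intro w hw h
            rw [hq.mem w hw, entryCount_eq_zero]
            intro u hu j hj huw
            rw [hall, not_not]
            exact ih u hu (by have := hrank u hu j hj w huw; omega)
        have hsub : Finset.range n ⊆ L.toFinset := fun w hw => by
          simpa using this _ w (by simpa using hw) (Nat.lt_succ_self _)
        have := Finset.card_le_card hsub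
        rw [Finset.card_range, List.toFinset_card_of_nodup hq.nodup] at this
        omega
      have hvn : L[p] < n := hq.lt _ (List.getElem_mem _)
      have key := List.take_succ_eq_append_getElem hpL'
      apply Runs.seq
      apply Runs.set
      simp only [Expr.eval, h3, hq.cells p hpL', h1 5 (by simp), hrow L[p] (by omega)]
      apply Runs.forTo (k + k) Y hY hkY
        (fun j s' => Frame 30 37 s s' ∧ s' 33 0 = p ∧ s' 35 0 = L[p] * Q ∧
          ∃ L', L <+: L' ∧ QueueInv n (k + k) nx
            (fun u j' => ¬ (u ∈ L.take p ∨ (u = L[p] ∧ j' < j))) s' L')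
      · refine ⟨(h1.upd _ _ (by simp) (by simp)).upd _ _ (by simp) (by simp), by simp [h3],
          by simp, L, List.prefix_refl _, ?_⟩
        exact hq.congr (by simp) (by simp) (by simp) (by simp)
      · rintro i s' ⟨h1, -⟩ -
        simp [Expr.eval, h1 0, hk]
      · rintro j s₁ hj ⟨k1, k2, k3, L', hL', kq⟩ k4
        have hnot : L[p] ∉ L.take p := by
          have := hq.nodup.sublist (List.take_sublist (p + 1) L)
          rw [key, List.nodup_append] at this
          exact fun h => this.2.2 _ h _ (by simp) rfl
        apply (relaxProg_spec s₁ (v := L[p]) (j := j)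
          (P' := fun u j' => ¬ (u ∈ L.take p ∨ (u = L[p] ∧ j' < j + 1))) kq hvn hj ?_ ?_ ?_ hle
          ?_).imp
        · rintro s₂ ⟨l1, l33, l34, l35, L'', hL'', lq⟩
          refine ⟨by rw [l34, k4], (k1.trans l1).upd _ _ (by simp) (by simp), by simp [l33, k2],
            by simp [l35, k3], L'', hL'.trans hL'', ?_⟩
          exact lq.congr (by simp) (by simp) (by simp) (by simp)
        · intro u j'
          by_cases hu : u = L[p]
          · subst hu; simp [hnot]; omega
          · simp [hu]
        · simp
        · intro u j' _ h
          rw [not_not] at h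
          rcases h with h | ⟨h, -⟩
          · exact hL'.subset (List.mem_of_mem_take h)
          · rw [h]; exact hL'.subset (List.getElem_mem _)
        · rw [k1 18 (by simp), k3, k4, hnx]
      · rintro s₁ ⟨k1, k2, k3, L', hL', kq⟩
        refine ⟨k2, k1.upd _ _ (by simp) (by simp), L', ?_, ?_⟩
        · have := hL'.length_le; omega
        · refine kq.congr ?_ (by simp) (by simp) (by simp)
          intro u _ j hj
          have : L'.take (p + 1) = L.take (p + 1) := by
            obtain ⟨l, rfl⟩ := hL'
            rw [List.take_append_of_le_length (by omega)]
          rw [this, key, List.mem_append, List.mem_singleton]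
          simp only [hj, and_true]
    · rintro s' ⟨h1, L, hL, hq⟩
      have hlen : L.length = n := by
        refine le_antisymm ?_ hL
        have hsub : L.toFinset ⊆ Finset.range n := fun x hx => by
          simpa using hq.lt x (by simpa using hx)
        have := Finset.card_le_card hsub
        rwa [Finset.card_range, List.toFinset_card_of_nodup hq.nodup] at this
      refine ⟨h1, L, hq.nodup, hlen, hq.lt, hq.cells, ?_⟩
      intro u hu j hj w h
      refine (hq.order u hu j hj w h ?_).2
      have hw : w < n := by have := hle u hu j hj; omega
      have hsub : L.toFinset = Finset.range n := by
        apply Finset.eq_of_subset_of_card_le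
        · exact fun x hx => by simpa using hq.lt x (by simpa using hx)
        · rw [Finset.card_range, List.toFinset_card_of_nodup hq.nodup, hlen]
      rw [← List.mem_toFinset, hsub]
      simpa using hw
  · simp [Expr.cost]
    have h1 : X ≤ X * Y := Nat.le_mul_of_pos_right _ hY
    have h3 : 1 ≤ X * Y := hX.trans h1
    nlinarith

end RAM

/-! ### Paths -/

section Paths

variable {V : Type*}

lemma pathEdges_mem_left {p : List V} {u w : V} (h : (u, w) ∈ pathEdges p) : u ∈ p := by
  obtain ⟨l, hl, h1, -⟩ := mem_pathEdges_iff.mp h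
  exact h1 ▸ List.getElem_mem _

lemma pathEdges_mem_right {p : List V} {u w : V} (h : (u, w) ∈ pathEdges p) : w ∈ p := by
  obtain ⟨l, hl, -, h2⟩ := mem_pathEdges_iff.mp h
  exact h2 ▸ List.getElem_mem _

lemma pathEdges_cons_cons (a b : V) (p : List V) :
    pathEdges (a :: b :: p) = (a, b) :: pathEdges (b :: p) := rfl

/-- A numbering that increases along every edge of a path increases along the path. -/
lemma pos_lt_pos_of_path {p : List V} {pos : V → ℕ}
    (h : ∀ u w, (u, w) ∈ pathEdges p → pos u < pos w) {l m : ℕ} (hlm : l < m) (hm : m < p.length) :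
    pos p[l] < pos p[m] := by
  induction m, hlm using Nat.le_induction with
  | base => exact h _ _ (mem_pathEdges_iff.mpr ⟨l, hm, rfl, rfl⟩)
  | succ m hlm ih =>
    exact (ih (by omega)).trans (h _ _ (mem_pathEdges_iff.mpr ⟨m, hm, rfl, rfl⟩))

lemma not_between_of_path {p : List V} {pos : V → ℕ}
    (h : ∀ u w, (u, w) ∈ pathEdges p → pos u < pos w) {u w c : V} (hu : (u, w) ∈ pathEdges p)
    (hc : c ∈ p) (h1 : pos u < pos c) : pos w ≤ pos c := by
  obtain ⟨l, hl, rfl, rfl⟩ := mem_pathEdges_iff.mp hu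
  obtain ⟨m, hm, rfl⟩ := List.mem_iff_getElem.mp hc
  rcases lt_trichotomy m (l + 1) with h2 | rfl | h2
  · rcases (Nat.lt_succ_iff.mp h2).lt_or_eq with h3 | rfl
    · have := pos_lt_pos_of_path h h3 (by omega); omega
    · omega
  · exact le_rfl
  · exact (pos_lt_pos_of_path h h2 hm).le

/-- Two paths with the same start along a deterministic relation that both end in a vertex without
successors are equal. -/
lemma path_unique {R : V → V → Prop} (hR : ∀ u w w', R u w → R u w' → w = w') {t : V}
    (ht : ∀ w, ¬ R t w) : ∀ (p q : List V), p.head? = q.head? → p.getLast? = some t →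
    q.getLast? = some t → (∀ e ∈ pathEdges p, R e.1 e.2) → (∀ e ∈ pathEdges q, R e.1 e.2) →
    p = q
  | [], _, _, hp, _, _, _ => by simp at hp
  | _ :: _, [], _, _, hq, _, _ => by simp at hq
  | [a], [b], h, _, _, _, _ => by simpa using h
  | [a], b :: c :: q, h, hp, _, _, eq => by
    obtain rfl : a = b := by simpa using h
    obtain rfl : a = t := by simpa using hp
    exact absurd (eq (a, c) (by simp [pathEdges_cons_cons])) (ht c)
  | a :: c :: p, [b], h, _, hq, ep, _ => by
    obtain rfl : a = b := by simpa using h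
    obtain rfl : a = t := by simpa using hq
    exact absurd (ep (a, c) (by simp [pathEdges_cons_cons])) (ht c)
  | a :: c :: p, b :: c' :: q, h, hp, hq, ep, eq => by
    obtain rfl : a = b := by simpa using h
    obtain rfl : c = c' := hR a c c' (ep (a, c) (by simp [pathEdges_cons_cons]))
      (eq (a, c') (by simp [pathEdges_cons_cons]))
    rw [path_unique hR ht (c :: p) (c :: q) rfl (by simpa using hp) (by simpa using hq)
      (fun e he => ep e (by simp [pathEdges_cons_cons, he]))
      (fun e he => eq e (by simp [pathEdges_cons_cons, he]))]

end Paths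

namespace FlowNetwork.IsFlow

variable {V : Type*} {N : FlowNetwork V} {d : ℕ} {p : List V}

lemma exists_succ (h : N.IsFlow d p) {v : V} (hv : v ∈ p) (hvt : v ≠ N.t) :
    ∃ w, (v, w) ∈ pathEdges p := by
  obtain ⟨l, hl, rfl⟩ := List.mem_iff_getElem.mp hv
  by_cases hl' : l + 1 < p.length
  · exact ⟨_, mem_pathEdges_iff.mpr ⟨l, hl', rfl, rfl⟩⟩
  · have := h.last
    rw [List.getLast?_eq_getElem?] at this
    obtain rfl : l = p.length - 1 := by omega
    rw [List.getElem?_eq_getElem hl] at this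
    exact absurd (by simpa using this) hvt

lemma exists_pred (h : N.IsFlow d p) {v : V} (hv : v ∈ p) (hvs : v ≠ N.s) :
    ∃ u, (u, v) ∈ pathEdges p := by
  obtain ⟨l, hl, rfl⟩ := List.mem_iff_getElem.mp hv
  cases l with
  | zero =>
    have := h.head
    rw [List.head?_eq_getElem?, List.getElem?_eq_getElem hl] at this
    exact absurd (by simpa using this) hvs
  | succ l => exact ⟨_, mem_pathEdges_iff.mpr ⟨l, hl, rfl, rfl⟩⟩

lemma source_mem (h : N.IsFlow d p) : N.s ∈ p := List.mem_of_head? h.head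

lemma not_terminal_edge (h : N.IsFlow d p) (w : V) : (N.t, w) ∉ pathEdges p := by
  intro hw
  obtain ⟨l, hl, h1, -⟩ := mem_pathEdges_iff.mp hw
  have := h.last
  rw [List.getLast?_eq_getElem?, List.getElem?_eq_getElem (by omega)] at this
  have h2 : p[l] = p[p.length - 1] := h1.trans (Option.some.inj this).symm
  have := (h.nodup.getElem_inj_iff).mp h2
  omega

lemma not_edge_source (h : N.IsFlow d p) (u : V) : (u, N.s) ∉ pathEdges p := by
  intro hu
  obtain ⟨l, hl, -, h1⟩ := mem_pathEdges_iff.mp hu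
  have := h.head
  rw [List.head?_eq_getElem?, List.getElem?_eq_getElem (by omega)] at this
  have h2 : p[l + 1] = p[0] := h1.trans (Option.some.inj this).symm
  have := (h.nodup.getElem_inj_iff).mp h2
  omega

end FlowNetwork.IsFlow

namespace UpdateFlowNetwork

variable {V : Type*} [DecidableEq V] {k : ℕ}

/-- The new path of pair `i` if `b` holds, and the old one otherwise. -/
def path (G : UpdateFlowNetwork V k) (i : Fin k) (b : Prop) [Decidable b] : List V :=
  if b then G.new i else G.old i

lemma path_flow (G : UpdateFlowNetwork V k) (i : Fin k) (b : Prop) [Decidable b] :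
    G.toFlowNetwork.IsFlow (G.d i) (G.path i b) := by
  unfold path
  split_ifs
  exacts [G.new_flow i, G.old_flow i]

/-- Both paths of pair `i` leave `v`. -/
def Branches (G : UpdateFlowNetwork V k) (i : Fin k) (v : V) : Prop :=
  (∃ w, (v, w) ∈ pathEdges (G.old i)) ∧ ∃ w, (v, w) ∈ pathEdges (G.new i)

open Classical in
/-- The start of the block of pair `i` at position `p` of the vertex order `L`: the last vertex, at
this position or before, where both paths of the pair leave. The first block starts at the
source. -/
noncomputable def block (G : UpdateFlowNetwork V k) (L : List V) (i : Fin k) : ℕ → V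
  | 0 => G.s
  | p + 1 => if G.Branches i (L.getD (p + 1) G.s) then L.getD (p + 1) G.s else G.block L i p

/-- The list `L` is a topological order of the vertices. -/
structure IsTopo (G : UpdateFlowNetwork V k) (L : List V) : Prop where
  nodup : L.Nodup
  complete : ∀ v, v ∈ L
  forward : ∀ i b, [Decidable b] → ∀ u w, (u, w) ∈ pathEdges (G.path i b) →
    L.idxOf u < L.idxOf w

/-- The edge `(u, w)` is used by pair `i` when the blocks starting at the updates in `U` are
switched to the new path. -/
def Uses (G : UpdateFlowNetwork V k) (L : List V) (U : Finset (V × Fin k)) (i : Fin k)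
    (u w : V) : Prop :=
  (u, w) ∈ pathEdges (G.path i ((G.block L i (L.idxOf u), i) ∈ U))

section

variable {G : UpdateFlowNetwork V k} {L : List V}

lemma mem_active {i : Fin k} {U : Finset (V × Fin k)} {u w : V} :
    (u, w) ∈ (G.active i U).E ↔ (u, w) ∈ pathEdges (G.path i ((u, i) ∈ U)) := by
  simp only [active, path, Finset.mem_union, Finset.mem_filter, List.mem_toFinset]
  split_ifs with h <;> simp [h]

lemma Branches.path {i : Fin k} {v : V} (h : G.Branches i v) (b : Prop) [Decidable b] :
    ∃ w, (v, w) ∈ pathEdges (G.path i b) := by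
  unfold UpdateFlowNetwork.path
  split_ifs
  exacts [h.2, h.1]

lemma branches_source (hst : G.s ≠ G.t) (i : Fin k) : G.Branches i G.s :=
  ⟨(G.old_flow i).exists_succ (G.old_flow i).source_mem hst,
    (G.new_flow i).exists_succ (G.new_flow i).source_mem hst⟩

lemma branches_block (hst : G.s ≠ G.t) (i : Fin k) (p : ℕ) : G.Branches i (G.block L i p) := by
  induction p with
  | zero => exact branches_source hst i
  | succ p ih =>
    rw [block]
    split_ifs with h
    exacts [h, ih]

/-- A vertex with an edge leaving it on some path forces the source and the terminal to differ. -/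
lemma source_ne_terminal {i : Fin k} {b : Prop} [Decidable b] {u w : V}
    (h : (u, w) ∈ pathEdges (G.path i b)) : G.s ≠ G.t := by
  intro hst
  have hf := G.path_flow i b
  have : ∀ l (hl : l < (G.path i b).length), l = 0 := by
    intro l hl
    have h1 := hf.head
    have h2 := hf.last
    rw [List.head?_eq_getElem?, List.getElem?_eq_getElem (by omega)] at h1
    rw [List.getLast?_eq_getElem?, List.getElem?_eq_getElem (by omega)] at h2
    have := (hf.nodup.getElem_inj_iff (hi := by omega) (hj := by omega)).mp
      (Option.some.inj (h1.trans ((congrArg some hst).trans h2.symm)))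
    omega
  obtain ⟨l, hl, -, -⟩ := mem_pathEdges_iff.mp h
  have := this _ hl
  omega

namespace IsTopo

variable (hL : G.IsTopo L)
include hL

lemma getD_idxOf (v : V) : L.getD (L.idxOf v) G.s = v := by
  have h := List.idxOf_lt_length_of_mem (hL.complete v)
  rw [List.getD_eq_getElem _ _ h, List.getElem_idxOf h]

lemma idxOf_source : L.idxOf G.s = 0 := by
  have h0 : 0 < L.length := List.length_pos_of_mem (hL.complete G.s)
  have hi : L.idxOf L[0] = 0 := hL.nodup.idxOf_getElem 0 h0
  by_cases h : L[0] = G.s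
  · rw [← h, hi]
  · exfalso
    obtain ⟨i, hv⟩ := G.vertex_cover L[0]
    have : ∃ b : Bool, L[0] ∈ G.path i b := by
      rcases hv with hv | hv
      exacts [⟨false, by simpa [path]⟩, ⟨true, by simpa [path]⟩]
    obtain ⟨b, hb⟩ := this
    obtain ⟨u, hu⟩ := (G.path_flow i b).exists_pred hb h
    have := hL.forward i b u L[0] hu
    omega

lemma block_idxOf {i : Fin k} {v : V} (h : G.Branches i v) : G.block L i (L.idxOf v) = v := by
  rcases hp : L.idxOf v with _ | p
  · rw [block]
    have h1 := hL.getD_idxOf v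
    have h2 := hL.getD_idxOf G.s
    rw [hp] at h1
    rw [hL.idxOf_source] at h2
    exact h2.symm.trans h1
  · have h1 := hL.getD_idxOf v
    rw [hp] at h1
    rw [block, h1, if_pos h]

/-- Between the two ends of an edge of a path of pair `i` there is no start of a block. -/
lemma block_pred {i : Fin k} {b : Prop} [Decidable b] {u w : V}
    (h : (u, w) ∈ pathEdges (G.path i b)) :
    G.block L i (L.idxOf w - 1) = G.block L i (L.idxOf u) := by
  have hlt := hL.forward i b u w h
  have key : ∀ m, L.idxOf u + m ≤ L.idxOf w - 1 →
      G.block L i (L.idxOf u + m) = G.block L i (L.idxOf u) := by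
    intro m
    induction m with
    | zero => simp
    | succ m ih =>
      intro hm
      rw [← add_assoc, block, if_neg, ih (by omega)]
      intro hbr
      have hlen := List.idxOf_lt_length_of_mem (hL.complete w)
      have hm' : L.idxOf u + m + 1 < L.length := by omega
      rw [List.getD_eq_getElem _ _ hm'] at hbr
      obtain ⟨x, hx⟩ := hbr.path b
      have hc := not_between_of_path (pos := L.idxOf) (hL.forward i b) h (pathEdges_mem_left hx)
        (by rw [hL.nodup.idxOf_getElem]; omega)
      rw [hL.nodup.idxOf_getElem] at hc
      omega
  have := key (L.idxOf w - 1 - L.idxOf u) (by omega)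
  rwa [show L.idxOf u + (L.idxOf w - 1 - L.idxOf u) = L.idxOf w - 1 by omega] at this

lemma block_succ {i : Fin k} {b : Prop} [Decidable b] {u w : V}
    (h : (u, w) ∈ pathEdges (G.path i b)) (hw : ¬ G.Branches i w) :
    G.block L i (L.idxOf w) = G.block L i (L.idxOf u) := by
  rw [← hL.block_pred h]
  have hlt := hL.forward i b u w h
  obtain ⟨p, hp⟩ := Nat.exists_eq_succ_of_ne_zero (show L.idxOf w ≠ 0 by omega)
  have := hL.getD_idxOf w
  rw [hp] at this ⊢
  rw [block, Nat.succ_eq_add_one, this, if_neg hw]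
  rfl

variable {U : Finset (V × Fin k)} {i : Fin k}

omit hL in
lemma _root_.UpdateFlowNetwork.Uses.lt {u w : V} (hL : G.IsTopo L) (h : G.Uses L U i u w) :
    L.idxOf u < L.idxOf w := hL.forward i _ u w h

/-- The path of pair `i` in the network of used edges continues until it reaches the terminal. -/
lemma uses_succ {u w : V} (h : G.Uses L U i u w) (hwt : w ≠ G.t) : ∃ x, G.Uses L U i w x := by
  have hx := (G.path_flow i _).exists_succ (pathEdges_mem_right h) hwt
  by_cases hw : G.Branches i w
  · exact hw.path _
  · unfold Uses
    simp only [hL.block_succ h hw]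
    exact hx

omit hL in
lemma uses_source (hst : G.s ≠ G.t) : ∃ x, G.Uses L U i G.s x :=
  (branches_source hst i).path _

lemma uses_pred_of_mem {w : V} (hw : ∀ b : Prop, [Decidable b] → w ∈ G.path i b) (hws : w ≠ G.s) :
    ∃ u, G.Uses L U i u w := by
  set b : Prop := (G.block L i (L.idxOf w - 1), i) ∈ U with hb
  obtain ⟨u, hu⟩ := (G.path_flow i b).exists_pred (hw b) hws
  refine ⟨u, ?_⟩
  unfold Uses
  simp only [← hL.block_pred hu]
  exact hu

lemma uses_pred {w x : V} (h : G.Uses L U i w x) (hws : w ≠ G.s) : ∃ u, G.Uses L U i u w := by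
  by_cases hw : G.Branches i w
  · apply hL.uses_pred_of_mem _ hws
    intro b _
    obtain ⟨x, hx⟩ := hw.path b
    exact pathEdges_mem_left hx
  · obtain ⟨u, hu⟩ := (G.path_flow i _).exists_pred (pathEdges_mem_left h) hws
    refine ⟨u, ?_⟩
    unfold Uses
    simp only [← hL.block_succ hu hw]
    exact hu

/-- A used edge and an active edge leaving the same vertex coincide. -/
lemma uses_eq_active {u w x : V} (h : G.Uses L U i u w) (hx : (u, x) ∈ (G.active i U).E) :
    w = x := by
  rw [mem_active] at hx
  have h' := h
  unfold Uses at h'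
  by_cases hu : G.Branches i u
  · simp only [hL.block_idxOf hu] at h'
    exact pathEdges_right_unique (G.path_flow i _).nodup h' hx
  · by_cases h1 : (u, i) ∈ U <;> by_cases h2 : (G.block L i (L.idxOf u), i) ∈ U <;>
      simp only [path, h1, h2, if_true, if_false] at h' hx
    · exact pathEdges_right_unique (G.new_flow i).nodup h' hx
    · exact absurd ⟨⟨_, h'⟩, ⟨_, hx⟩⟩ hu
    · exact absurd ⟨⟨_, hx⟩, ⟨_, h'⟩⟩ hu
    · exact pathEdges_right_unique (G.old_flow i).nodup h' hx

/-- Every flow in the network of active edges contains all used edges. -/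
lemma uses_mem_of_flow {T : List V} {d : ℕ} (hT : (G.active i U).IsFlow d T) :
    ∀ (u w : V), G.Uses L U i u w → (u, w) ∈ pathEdges T := by
  have main : ∀ n u w, L.idxOf u = n → G.Uses L U i u w → (u, w) ∈ pathEdges T := by
    intro n
    induction n using Nat.strong_induction_on with
    | _ n ih =>
      intro u w hn h
      have hu : u ∈ T := by
        by_cases hus : u = G.s
        · rw [hus]; exact hT.source_mem
        · obtain ⟨v, hv⟩ := hL.uses_pred h hus
          exact pathEdges_mem_right (ih _ (hn ▸ hv.lt hL) v u rfl hv)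
      have hut : u ≠ G.t := fun h' => (G.path_flow i _).not_terminal_edge w (h' ▸ h)
      obtain ⟨x, hx⟩ := hT.exists_succ hu hut
      rwa [hL.uses_eq_active h (hT.edges _ hx)]
  exact fun u w => main _ u w rfl

/-- If the used edges are active, they form a flow. -/
lemma exists_flow (hact : ∀ u w, G.Uses L U i u w → (u, w) ∈ (G.active i U).E) :
    ∃ T, (G.active i U).IsFlow (G.d i) T ∧ ∀ e ∈ pathEdges T, G.Uses L U i e.1 e.2 := by
  have main : ∀ n u, L.length - L.idxOf u = n → (u = G.t ∨ ∃ w, G.Uses L U i u w) →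
      ∃ T : List V, T.head? = some u ∧ T.getLast? = some G.t ∧
        (∀ e ∈ pathEdges T, G.Uses L U i e.1 e.2) ∧
        T.Pairwise (fun a b => L.idxOf a < L.idxOf b) := by
    intro n
    induction n using Nat.strong_induction_on with
    | _ n ih =>
      intro u hn h
      by_cases hu : u = G.t
      · exact ⟨[u], rfl, by simp [hu], by simp [pathEdges], by simp⟩
      obtain ⟨w, hw⟩ := h.resolve_left hu
      have hlt := hw.lt hL
      have hlen := List.idxOf_lt_length_of_mem (hL.complete w)
      have hw' : w = G.t ∨ ∃ x, G.Uses L U i w x := by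
        by_cases hwt : w = G.t
        · exact Or.inl hwt
        · exact Or.inr (hL.uses_succ hw hwt)
      obtain ⟨T, h1, h2, h3, h4⟩ := ih _ (by omega) w rfl hw'
      obtain ⟨T', rfl⟩ : ∃ T', T = w :: T' := by
        cases T with
        | nil => simp at h1
        | cons a T => exact ⟨T, by simpa using h1⟩
      refine ⟨u :: w :: T', rfl, by simpa using h2, ?_, ?_⟩
      · intro e he
        rw [pathEdges_cons_cons, List.mem_cons] at he
        rcases he with rfl | he
        exacts [hw, h3 e he]
      · rw [List.pairwise_cons]
        refine ⟨fun b hb => ?_, h4⟩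
        rcases List.mem_cons.mp hb with rfl | hb
        · exact hlt
        · exact hlt.trans ((List.pairwise_cons.mp h4).1 b hb)
  have hs : G.s = G.t ∨ ∃ w, G.Uses L U i G.s w := by
    by_cases hst : G.s = G.t
    exacts [Or.inl hst, Or.inr (uses_source hst)]
  obtain ⟨T, h1, h2, h3, h4⟩ := main _ G.s rfl hs
  refine ⟨T, ⟨h1, h2, h4.imp fun h h' => ?_, fun e he => hact _ _ (h3 e he), fun e he => ?_⟩, h3⟩
  · rw [h'] at h; exact lt_irrefl _ h
  · exact (G.path_flow i _).cap e (h3 e he)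

/-- If the used edges are active, the transient flow exists, and it consists of used edges. -/
lemma exists_transientFlow (hact : ∀ u w, G.Uses L U i u w → (u, w) ∈ (G.active i U).E) :
    ∃ T, G.IsTransientFlow i U T ∧ ∀ e ∈ pathEdges T, G.Uses L U i e.1 e.2 := by
  obtain ⟨T, hT, hT'⟩ := hL.exists_flow hact
  refine ⟨T, ⟨hT, fun T' h => ?_⟩, hT'⟩
  refine path_unique (R := fun u w => (u, w) ∈ (G.active i U).E) ?_ (t := G.t) ?_ T' T
    (h.head.trans hT.head.symm) h.last hT.last h.edges hT.edges
  · intro u w w' h1 h2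
    simp only [mem_active] at h1 h2
    exact pathEdges_right_unique (G.path_flow i _).nodup h1 h2
  · intro w h1
    simp only [mem_active] at h1
    exact (G.path_flow i _).not_terminal_edge w h1

end IsTopo

open Classical in
/-- No edge is overloaded by the pairs that use it. -/
def UsesValid (G : UpdateFlowNetwork V k) (L : List V) (U : Finset (V × Fin k)) : Prop :=
  ∀ e ∈ G.E, ∑ i with G.Uses L U i e.1 e.2, G.d i ≤ G.c e

lemma usesValid_of_consistent (hL : G.IsTopo L) {U : Finset (V × Fin k)} (h : G.Consistent U) :
    G.UsesValid L U := by
  obtain ⟨T, hT, hv⟩ := h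
  intro e he
  refine le_trans (Finset.sum_le_sum_of_subset ?_) (hv e he)
  intro i hi
  simp only [Finset.mem_filter, Finset.mem_univ, true_and] at hi ⊢
  exact hL.uses_mem_of_flow (hT i).1 _ _ hi

lemma consistent_of_usesValid (hL : G.IsTopo L) {U : Finset (V × Fin k)} (h : G.UsesValid L U)
    (hact : ∀ i u w, G.Uses L U i u w → (u, w) ∈ (G.active i U).E) : G.Consistent U := by
  choose T hT hT' using fun i => hL.exists_transientFlow (hact i)
  refine ⟨T, hT, fun e he => le_trans (Finset.sum_le_sum_of_subset ?_) (h e he)⟩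
  intro i hi
  simp only [Finset.mem_filter, Finset.mem_univ, true_and] at hi ⊢
  exact hT' i e hi

end

end UpdateFlowNetwork

/-! ### Update sequences and local orders -/

/-- A set that is closed downwards with respect to `g` is cut out by a threshold. -/
lemma exists_threshold {k : ℕ} (g : Fin k → ℕ) (D : Fin k → Prop)
    (h : ∀ i j, g i ≤ g j → D j → D i) {B : ℕ} (hB : ∀ i, g i < B) :
    ∃ θ ≤ B, ∀ i, D i ↔ g i < θ := by
  classical
  refine ⟨(Finset.univ.filter D).sup fun i => g i + 1, ?_, fun i => ⟨fun hi => ?_, fun hi => ?_⟩⟩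
  · exact Finset.sup_le fun i _ => hB i
  · exact Nat.lt_of_succ_le (Finset.le_sup (f := fun i => g i + 1) (by simpa using hi))
  · rw [Finset.lt_sup_iff] at hi
    obtain ⟨j, hj, hij⟩ := hi
    exact h i j (by omega) (by simpa using hj)

lemma mem_take_of_sublist {α : Type*} {l : List α} (hl : l.Nodup) {x y : α} (h : [x, y].Sublist l)
    {j : ℕ} (hy : y ∈ l.take j) : x ∈ l.take j := by
  by_contra hx
  have h1 : [x, y].Sublist (l.take j ++ l.drop j) := by rwa [List.take_append_drop]
  rw [← List.take_append_drop j l, List.nodup_append] at hl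
  obtain ⟨l₁, l₂, h2, h3, h4⟩ := List.sublist_append_iff.mp h1
  cases l₁ with
  | nil =>
    simp only [List.nil_append] at h2
    subst h2
    exact hl.2.2 y hy y (h4.subset (by simp)) rfl
  | cons a l₁ =>
    obtain ⟨rfl, -⟩ := List.cons_eq_cons.mp (h2.trans (List.cons_append ..))
    exact hx (h3.subset (by simp))

namespace UpdateFlowNetwork

variable {V : Type*} [DecidableEq V] {k : ℕ} {G : UpdateFlowNetwork V k} {L : List V}

lemma path_congr (i : Fin k) {b b' : Prop} [Decidable b] [Decidable b'] (h : b ↔ b') :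
    G.path i b = G.path i b' := by
  unfold path
  split_ifs <;> tauto

/-- No edge leaving `v` is overloaded when the pairs with key below a threshold less than `K` use
their new path and the others their old path. -/
def OkKey (G : UpdateFlowNetwork V k) (K : ℕ) (v : V) (key : Fin k → ℕ) : Prop :=
  ∀ θ < K, ∀ w, (v, w) ∈ G.E →
    ∑ i with (v, w) ∈ pathEdges (G.path i (key i < θ)), G.d i ≤ G.c (v, w)

/-- In a feasible sequence, the blocks meeting a position are switched in an order that respects the
capacities of the edges leaving that position. -/
lemma Feasible.okKey (hL : G.IsTopo L) {σ : List (V × Fin k)} (hσ : G.Feasible σ) (K : ℕ) (v : V) :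
    G.OkKey K v fun i => σ.idxOf (G.block L i (L.idxOf v), i) := by
  intro θ _ w hw
  rcases Nat.eq_zero_or_pos θ with rfl | hθ
  · simpa [path] using G.old_valid (v, w) hw
  · have hlen : 1 ≤ σ.length := by
      obtain ⟨i, -⟩ := G.vertex_cover v
      exact List.length_pos_of_mem (hσ.complete (v, i))
    have h := usesValid_of_consistent hL (hσ.consistent (min θ σ.length) (by omega) (by omega))
      (v, w) hw
    refine le_trans (le_of_eq ?_) h
    apply Finset.sum_congr _ fun _ _ => rfl
    ext i
    have hmem := hσ.complete (G.block L i (L.idxOf v), i)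
    have : (G.block L i (L.idxOf v), i) ∈ (σ.take (min θ σ.length)).toFinset ↔
        σ.idxOf (G.block L i (L.idxOf v), i) < θ := by
      rw [List.mem_toFinset, List.mem_take_iff_idxOf_lt hmem]
      have := List.idxOf_lt_length_of_mem hmem
      omega
    simp only [Finset.mem_filter, Finset.mem_univ, true_and]
    unfold Uses
    rw [path_congr _ this]

/-- A sequence that first performs the updates without effect on the current flows, then switches
the blocks in an order compatible with admissible local keys, and finally performs the remaining
updates is feasible. -/
lemma feasible_of_okKey (hL : G.IsTopo L) {A B C : List (V × Fin k)} {K : ℕ} (key : V → Fin k → ℕ)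
    (hA : A.Nodup) (hB : B.Nodup) (hC : C.Nodup)
    (hA' : ∀ v i, (v, i) ∈ A ↔ ∀ w, (v, w) ∉ pathEdges (G.old i))
    (hB' : ∀ v i, (v, i) ∈ B ↔ G.Branches i v)
    (hC' : ∀ v i, (v, i) ∈ C ↔ (∃ w, (v, w) ∈ pathEdges (G.old i)) ∧
      ∀ w, (v, w) ∉ pathEdges (G.new i))
    (hK : ∀ v i, key v i + 1 < K) (hok : ∀ v, G.OkKey K v (key v))
    (hinj : ∀ v, Function.Injective (key v))
    (hord : G.s ≠ G.t → ∀ v i j, key v i < key v j →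
      [(G.block L i (L.idxOf v), i), (G.block L j (L.idxOf v), j)].Sublist B) :
    G.Feasible (A ++ B ++ C) := by
  have hAB : ∀ x ∈ A, x ∉ B := fun ⟨v, i⟩ h1 h2 => by
    rw [hA'] at h1
    obtain ⟨⟨w, hw⟩, -⟩ := (hB' v i).mp h2
    exact h1 w hw
  have hAC : ∀ x ∈ A, x ∉ C := fun ⟨v, i⟩ h1 h2 => by
    rw [hA'] at h1
    obtain ⟨⟨w, hw⟩, -⟩ := (hC' v i).mp h2
    exact h1 w hw
  have hBC : ∀ x ∈ B, x ∉ C := fun ⟨v, i⟩ h1 h2 => by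
    obtain ⟨-, ⟨w, hw⟩⟩ := (hB' v i).mp h1
    exact ((hC' v i).mp h2).2 w hw
  refine ⟨?_, ?_, ?_⟩
  · rw [List.nodup_append, List.nodup_append]
    refine ⟨⟨hA, hB, ?_⟩, hC, ?_⟩
    · rintro x hx y hy rfl
      exact hAB x hx hy
    · rintro x hx y hy rfl
      rcases List.mem_append.mp hx with hx | hx
      exacts [hAC x hx hy, hBC x hx hy]
  · rintro ⟨v, i⟩
    rw [List.mem_append, List.mem_append, hA', hB', hC']
    by_cases h1 : ∃ w, (v, w) ∈ pathEdges (G.old i)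
    · by_cases h2 : ∃ w, (v, w) ∈ pathEdges (G.new i)
      · exact Or.inl (Or.inr ⟨h1, h2⟩)
      · exact Or.inr ⟨h1, not_exists.mp h2⟩
    · exact Or.inl (Or.inl (not_exists.mp h1))
  · intro n _ _
    set U := ((A ++ B ++ C).take n).toFinset with hU
    have hmemB : ∀ x ∈ B, x ∈ U ↔ x ∈ B.take (n - A.length) := by
      intro x hx
      rw [hU, List.mem_toFinset, List.take_append, List.take_append, List.mem_append,
        List.mem_append]
      constructor
      · rintro ((h | h) | h)
        · exact absurd hx (hAB x (List.mem_of_mem_take h))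
        · exact h
        · exact absurd (List.mem_of_mem_take h) (hBC x hx)
      · exact fun h => Or.inl (Or.inr h)
    have hA_of_B : ∀ x ∈ B, x ∈ U → ∀ y ∈ A, y ∈ U := by
      intro x hx hxU y hy
      rw [hmemB x hx] at hxU
      have : 0 < (B.take (n - A.length)).length := List.length_pos_of_mem hxU
      rw [List.length_take] at this
      rw [hU, List.mem_toFinset, List.take_append, List.take_append, List.take_of_length_le
        (by omega : A.length ≤ n)]
      simp [hy]
    have hB_of_C : ∀ x ∈ C, x ∈ U → ∀ y ∈ B, y ∈ U := by
      intro x hx hxU y hy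
      rw [hU, List.mem_toFinset, List.take_append, List.mem_append] at hxU
      rcases hxU with h | h
      · rcases List.mem_append.mp (List.mem_of_mem_take h) with h | h
        exacts [absurd hx (hAC x h), absurd hx (hBC x h)]
      · have : 0 < (C.take (n - (A ++ B).length)).length := List.length_pos_of_mem h
        rw [List.length_take] at this
        rw [hU, List.mem_toFinset, List.take_append, List.take_of_length_le
          (by omega : (A ++ B).length ≤ n)]
        simp [hy]
    apply consistent_of_usesValid hL
    · rintro ⟨v, w⟩ he
      have hst : G.s ≠ G.t := by
        obtain ⟨i, h | h⟩ := G.edge_cover _ he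
        · exact source_ne_terminal (i := i) (b := False) (by simpa [path] using h)
        · exact source_ne_terminal (i := i) (b := True) (by simpa [path] using h)
      -- The blocks meeting `v` that are already switched are those with key below a threshold.
      obtain ⟨θ, hθ, hθ'⟩ := exists_threshold (B := K - 1) (key v)
        (fun i => (G.block L i (L.idxOf v), i) ∈ U) (by
          intro i j hij hj
          rcases hij.lt_or_eq with hij | hij
          · have hi := (hB' _ i).mpr (branches_block hst i (L.idxOf v) (L := L))
            have hj' := (hB' _ j).mpr (branches_block hst j (L.idxOf v) (L := L))
            rw [hmemB _ hj'] at hj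
            rw [hmemB _ hi]
            exact mem_take_of_sublist hB (hord hst v i j hij) hj
          · rwa [hinj v hij]) (by intro i; have := hK v i; omega)
      have hθK : θ < K := by
        obtain ⟨i, -⟩ := G.vertex_cover v
        have := hK v i
        omega
      refine le_trans (le_of_eq ?_) (hok v θ hθK w he)
      apply Finset.sum_congr _ fun _ _ => rfl
      ext i
      simp only [Finset.mem_filter, Finset.mem_univ, true_and]
      unfold Uses
      rw [path_congr _ (hθ' i)]
    · intro i u w h
      rw [mem_active]
      have h' := h
      unfold Uses at h'
      have hst := source_ne_terminal h'
      have hblk := (hB' _ i).mpr (branches_block hst i (L.idxOf u) (L := L))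
      by_cases hu : G.Branches i u
      · simpa only [hL.block_idxOf hu] using h'
      -- If only one path leaves `u`, the update at `u` comes before or after all switches.
      · by_cases hb : (G.block L i (L.idxOf u), i) ∈ U
        · simp only [path, hb, if_true] at h'
          have : (u, i) ∈ U := hA_of_B _ hblk hb _ ((hA' u i).mpr fun x hx => hu ⟨⟨x, hx⟩, _, h'⟩)
          simpa only [path, this, if_true]
        · simp only [path, hb, if_false] at h'
          have : (u, i) ∉ U := fun hc => hb (hB_of_C _ ((hC' u i).mpr
            ⟨⟨_, h'⟩, fun x hx => hu ⟨⟨_, h'⟩, x, hx⟩⟩) hc _ hblk)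
          simpa only [path, this, if_false]

end UpdateFlowNetwork

/-! ### Linked lists -/

/-- An element inserted right after `c` comes after `c` and after everything before `c`. -/
lemma List.pair_sublist_insert {α : Type*} {L₁ L₂ : List α} {c b x : α}
    (hn : (L₁ ++ c :: L₂).Nodup) (h : [x, c].Sublist (L₁ ++ c :: L₂) ∨ x = c) :
    [x, b].Sublist (L₁ ++ c :: b :: L₂) := by
  have hx : x ∈ L₁ ++ [c] := by
    rcases h with h | rfl
    · have hc : (L₁ ++ c :: L₂).take (L₁.length + 1) = L₁ ++ [c] := by simp [List.take_append]
      have := mem_take_of_sublist hn h (j := L₁.length + 1) (by rw [hc]; simp)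
      rwa [hc] at this
    · simp
  have h1 : [x].Sublist (L₁ ++ [c]) := List.singleton_sublist.mpr hx
  have h2 : [b].Sublist (b :: L₂) := by simp
  simpa using h1.append h2

/-- An element inserted right after `c` comes before everything after `c`. -/
lemma List.insert_pair_sublist {α : Type*} {L₁ L₂ : List α} {c b y : α}
    (hn : (L₁ ++ c :: L₂).Nodup) (h : [c, y].Sublist (L₁ ++ c :: L₂)) :
    [b, y].Sublist (L₁ ++ c :: b :: L₂) := by
  have hy : y ∈ L₂ := by
    by_contra hy
    have hmem : y ∈ L₁ ++ c :: L₂ := h.subset (by simp)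
    have hyc : y ≠ c := by
      rintro rfl
      have := h.nodup hn
      simp at this
    have hy1 : y ∈ L₁ := by simpa [hyc, hy] using hmem
    have := mem_take_of_sublist hn h (j := L₁.length) (by simpa using hy1)
    rw [List.take_left' rfl] at this
    rw [List.nodup_append] at hn
    exact hn.2.2 c this c (by simp) rfl
  have h1 : [b, y].Sublist (b :: L₂) := by simpa using hy
  exact h1.trans ((List.sublist_cons_self c _).trans (List.sublist_append_right L₁ _))

namespace RAM

/-- Following the pointers `nx` from node `a` visits the nodes of `l` and ends with pointer `0`. -/
def Walk (nx : ℕ → ℕ) : ℕ → List ℕ → Prop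
  | a, [] => nx a = 0
  | a, b :: l => nx a = b ∧ Walk nx b l

lemma Walk.congr {nx nx' : ℕ → ℕ} {a : ℕ} {l : List ℕ} (h : Walk nx a l)
    (he : ∀ x ∈ a :: l, nx' x = nx x) : Walk nx' a l := by
  induction l generalizing a with
  | nil => rw [Walk, he a (by simp)]; exact h
  | cons b l ih =>
    exact ⟨by rw [he a (by simp)]; exact h.1, ih h.2 fun x hx => he x (by simp [hx])⟩

lemma Walk.insert_head {nx : ℕ → ℕ} {a b : ℕ} {l : List ℕ} (h : Walk nx a l) (hb : b ∉ a :: l)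
    (ha : a ∉ l) : Walk (Function.update (Function.update nx b (nx a)) a b) a (b :: l) := by
  have hab : b ≠ a := fun h => hb (by simp [h])
  refine ⟨by simp, ?_⟩
  have e : ∀ x ∈ l, Function.update (Function.update nx b (nx a)) a b x = nx x := by
    intro x hx
    rw [Function.update_of_ne (by rintro rfl; exact ha hx),
      Function.update_of_ne (by rintro rfl; exact hb (by simp [hx]))]
  cases l with
  | nil =>
    rw [Walk, Function.update_of_ne hab, Function.update_self]
    exact h
  | cons c l =>
    refine ⟨?_, h.2.congr e⟩
    rw [Function.update_of_ne hab, Function.update_self]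
    exact h.1

lemma Walk.insert_after {nx : ℕ → ℕ} {b c : ℕ} {l₂ : List ℕ} :
    ∀ {a : ℕ} {l₁ : List ℕ}, Walk nx a (l₁ ++ c :: l₂) → b ∉ a :: (l₁ ++ c :: l₂) →
      (a :: (l₁ ++ c :: l₂)).Nodup →
      Walk (Function.update (Function.update nx b (nx c)) c b) a (l₁ ++ c :: b :: l₂) := by
  intro a l₁
  induction l₁ generalizing a with
  | nil =>
    intro h hb hn
    simp only [List.nil_append] at *
    refine ⟨?_, h.2.insert_head (fun h => hb (by simp [List.mem_cons.mp h]))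
      (List.nodup_cons.mp (List.nodup_cons.mp hn).2).1⟩
    rw [Function.update_of_ne, Function.update_of_ne]
    · exact h.1
    · rintro rfl; simp at hb
    · rintro rfl; simp at hn
  | cons x l₁ ih =>
    intro h hb hn
    simp only [List.cons_append] at *
    refine ⟨?_, ih h.2 (fun h => hb (List.mem_cons_of_mem _ h)) (List.nodup_cons.mp hn).2⟩
    rw [Function.update_of_ne, Function.update_of_ne]
    · exact h.1
    · rintro rfl; simp at hb
    · rintro rfl; simp at hn

/-- The address of the list node of the update `u`. -/
def node (Q : ℕ) (u : ℕ × ℕ) : ℕ := u.1 * Q + u.2 + 1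

lemma node_inj {Q : ℕ} {u v : ℕ × ℕ} (hu : u.2 < Q) (hv : v.2 < Q) (h : node Q u = node Q v) :
    u = v := by
  simp only [node, Nat.add_right_cancel_iff, row_inj hu hv] at h
  exact Prod.ext h.1 h.2

/-- The linked list in memory represents `L`. -/
structure ListRep (Q : ℕ) (s : Store) (L : List (ℕ × ℕ)) : Prop where
  walk : Walk (s 66) 0 (L.map (node Q))
  fst : ∀ u ∈ L, s 67 (node Q u) = u.1
  snd : ∀ u ∈ L, s 68 (node Q u) = u.2

/-- Inserts the block of pair `reg 63` at the current vertex after the node `reg 64` and makes it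
the current block of the pair in array `65`. The arrays `66`, `67` and `68` hold the successor, the
vertex and the pair of each node; address `0` is the head of the list. -/
def linkProg : Prog :=
  .seq (setReg 69 (.add (.add (reg 45) (reg 63)) (.lit 1)))
    (.seq (.set 66 (reg 69) (.get 66 (reg 64)))
      (.seq (.set 66 (reg 64) (reg 69))
        (.seq (.set 67 (reg 69) (.get 31 (reg 61)))
          (.seq (.set 68 (reg 69) (reg 63)) (.set 65 (reg 63) (reg 69))))))

lemma linkProg_spec (s : Store) {Q v i : ℕ} {L : List (ℕ × ℕ)} (hrep : ListRep Q s L)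
    (hL : L.Nodup) (hQ : ∀ u ∈ L, u.2 < Q) (hiQ : i < Q) (hv : s 45 0 = v * Q) (hi : s 63 0 = i)
    (hord : s 31 (s 61 0) = v) (hnew : (v, i) ∉ L)
    (hprev : s 64 0 = 0 ∨ ∃ c ∈ L, s 64 0 = node Q c) :
    Runs linkProg s 100 fun s' => Frame 65 70 s s' ∧
      s' 65 = Function.update (s 65) i (node Q (v, i)) ∧
      ((s 64 0 = 0 ∧ ListRep Q s' ((v, i) :: L)) ∨
        ∃ c L₁ L₂, L = L₁ ++ c :: L₂ ∧ s 64 0 = node Q c ∧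
          ListRep Q s' (L₁ ++ c :: (v, i) :: L₂)) := by
  have hzero : 0 ∉ L.map (node Q) := by simp [node]
  have hfresh : ∀ u ∈ L, node Q u ≠ node Q (v, i) := fun u hu h =>
    hnew (node_inj (hQ u hu) hiQ h ▸ hu)
  have hnn : (0 :: L.map (node Q)).Nodup := by
    rw [List.nodup_cons]
    exact ⟨hzero, hL.map_on fun u hu w hw h => node_inj (hQ u hu) (hQ w hw) h⟩
  have hnotin : node Q (v, i) ∉ 0 :: L.map (node Q) := by
    simp only [List.mem_cons, List.mem_map, not_or, not_exists, not_and]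
    exact ⟨by simp [node], hfresh⟩
  apply Runs.le
  · apply Runs.seq
    apply Runs.set
    have e : s 45 0 + s 63 0 + 1 = node Q (v, i) := by rw [hv, hi, node]
    simp only [Expr.eval, e]
    apply Runs.seq
    apply Runs.set
    apply Runs.seq
    apply Runs.set
    apply Runs.seq
    apply Runs.set
    apply Runs.seq
    apply Runs.set
    apply Runs.set
    simp only [Expr.eval, upd_same, upd_of_ne _ _ _ (by simp : 66 ≠ 69),
      upd_of_ne _ _ _ (by simp : 64 ≠ 69), upd_of_ne _ _ _ (by simp : 64 ≠ 66),
      upd_of_ne _ _ _ (by simp : 69 ≠ 66), upd_of_ne _ _ _ (by simp : 31 ≠ 66),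
      upd_of_ne _ _ _ (by simp : 31 ≠ 69), upd_of_ne _ _ _ (by simp : 61 ≠ 66),
      upd_of_ne _ _ _ (by simp : 61 ≠ 69), upd_of_ne _ _ _ (by simp : 69 ≠ 67),
      upd_of_ne _ _ _ (by simp : 69 ≠ 68), upd_of_ne _ _ _ (by simp : 63 ≠ 66),
      upd_of_ne _ _ _ (by simp : 63 ≠ 67), upd_of_ne _ _ _ (by simp : 63 ≠ 68),
      upd_of_ne _ _ _ (by simp : 63 ≠ 69), hord, hi, if_true]
    set s' := upd (upd (upd (upd (upd (upd s _ _ _) _ _ _) _ _ _) _ _ _) _ _ _) _ _ _ with hs'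
    have e66 : s' 66 = Function.update (Function.update (s 66) (node Q (v, i)) (s 66 (s 64 0)))
        (s 64 0) (node Q (v, i)) := by
      simp [hs', upd]
    have e67 : ∀ x, s' 67 x = if x = node Q (v, i) then v else s 67 x := fun x => by simp [hs']
    have e68 : ∀ x, s' 68 x = if x = node Q (v, i) then i else s 68 x := fun x => by simp [hs']
    have e65 : s' 65 = Function.update (s 65) i (node Q (v, i)) := by simp [hs', upd]
    have hf : Frame 65 70 s s' :=
      ((((((Frame.refl s).upd _ _ (by simp) (by simp)).upd _ _ (by simp) (by simp)).upd _ _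
        (by simp) (by simp)).upd _ _ (by simp) (by simp)).upd _ _ (by simp) (by simp)).upd _ _
        (by simp) (by simp)
    clear_value s'
    refine ⟨hf, e65, ?_⟩
    have h67 : ∀ u, u = (v, i) ∨ u ∈ L → s' 67 (node Q u) = u.1 := by
      rintro u (rfl | hu)
      · rw [e67, if_pos rfl]
      · rw [e67, if_neg (hfresh u hu), hrep.fst u hu]
    have h68 : ∀ u, u = (v, i) ∨ u ∈ L → s' 68 (node Q u) = u.2 := by
      rintro u (rfl | hu)
      · rw [e68, if_pos rfl]
      · rw [e68, if_neg (hfresh u hu), hrep.snd u hu]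
    rcases hprev with hp | ⟨c, hc, hp⟩
    · left
      refine ⟨hp, ?_, fun u hu => h67 u (by simpa using hu), fun u hu => h68 u (by simpa using hu)⟩
      rw [e66, hp]
      exact hrep.walk.insert_head hnotin hzero
    · right
      obtain ⟨L₁, L₂, rfl⟩ := List.append_of_mem hc
      refine ⟨c, L₁, L₂, rfl, hp, ?_, fun u hu => h67 u ?_, fun u hu => h68 u ?_⟩
      · rw [e66, hp]
        have := hrep.walk
        simp only [List.map_append, List.map_cons] at this hnotin hnn ⊢
        exact this.insert_after hnotin hnn
      all_goals
        simp only [List.mem_append, List.mem_cons] at hu ⊢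
        tauto
  · simp [Expr.cost]

end RAM

/-! ### Inserting the blocks that start at a position -/

namespace RAM

open Classical in
/-- The start of the block of pair `j` before position `p`, for successor rows `nx` of the vertices
`ord 0, ord 1, …`. -/
noncomputable def blockBefore (nx : ℕ → ℕ → ℕ) (ord : ℕ → ℕ) : ℕ → ℕ → ℕ
  | 0, _ => 0
  | p + 1, j => if Br (nx p) j then ord p else blockBefore nx ord p j

/-- Visits pair `reg 63` if its key is `reg 62`: if the pair branches, its new block is inserted
after the block in register `64`. Afterwards this register contains the current block of the pair.
-/
def visitProg : Prog :=
  .cond (neE (.get 6 (.add (.get 5 (reg 59)) (reg 63))) (reg 62)) .skip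
    (.seq (.cond (brE 63) linkProg .skip) (setReg 64 (.get 65 (reg 63))))

/-- Visits all pairs at position `reg 61`, in the order of their keys in state `reg 59`. As the keys
are less than `reg 4`, all possible keys are tried one after the other. -/
def positionProg : Prog :=
  .seq (setReg 45 (.get 5 (.get 31 (reg 61))))
    (.seq (setReg 64 (.lit 0)) (forTo 62 (reg 4) (forTo 63 kE visitProg)))

/-- The state of the insertion of the blocks that start at position `p`, when the pairs in `D` have
been visited in the order of their keys: `L` extends the list `L₀` from before, and the current
blocks of the pairs that are in `D` or do not branch occur in `L` in the order of the keys. -/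
structure VisitInv (k Q : ℕ) (nx : ℕ → ℕ) (v : ℕ) (B key : ℕ → ℕ) (L₀ : List (ℕ × ℕ))
    (D : ℕ → Prop) (s : Store) (L : List (ℕ × ℕ)) : Prop where
  rep : ListRep Q s L
  nodup : L.Nodup
  sub : L₀.Sublist L
  mem : ∀ u, u ∈ L ↔ u ∈ L₀ ∨ (u.1 = v ∧ u.2 < k ∧ Br nx u.2 ∧ D u.2)
  cur : ∀ j < k, D j ∨ ¬ Br nx j → s 65 j = node Q (B j, j) ∧ (B j, j) ∈ L
  prev : (s 64 0 = 0 ∧ ∀ j < k, ¬ D j) ∨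
    ∃ j < k, D j ∧ (∀ i < k, D i → key i ≤ key j) ∧ s 64 0 = node Q (B j, j)
  ord : ∀ i < k, ∀ j < k, D i ∨ ¬ Br nx i → D j ∨ ¬ Br nx j → key i < key j →
    [(B i, i), (B j, j)].Sublist L

section

variable {k Q : ℕ} {nx : ℕ → ℕ} {v : ℕ} {B key : ℕ → ℕ} {L₀ : List (ℕ × ℕ)}

lemma VisitInv.congr {D D' : ℕ → Prop} {s s' : Store} {L : List (ℕ × ℕ)}
    (h : VisitInv k Q nx v B key L₀ D s L) (hD : ∀ j < k, D j ↔ D' j)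
    (hs : ∀ a, 64 ≤ a → a < 69 → s' a = s a) : VisitInv k Q nx v B key L₀ D' s' L := by
  obtain ⟨h1, h2, h3, h4, h5, h6, h7⟩ := h
  refine ⟨⟨?_, ?_, ?_⟩, h2, h3, ?_, ?_, ?_, ?_⟩
  · rw [hs 66 (by simp) (by simp)]; exact h1.walk
  · rw [hs 67 (by simp) (by simp)]; exact h1.fst
  · rw [hs 68 (by simp) (by simp)]; exact h1.snd
  · intro u
    rw [h4]
    refine or_congr_right (and_congr_right fun _ => and_congr_right fun hu => ?_)
    rw [hD _ hu]
  · intro j hj h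
    rw [hs 65 (by simp) (by simp)]
    exact h5 j hj (by rwa [hD j hj])
  · rw [hs 64 (by simp) (by simp)]
    rcases h6 with ⟨h6, h6'⟩ | ⟨j, hj, hj1, hj2, hj3⟩
    · exact Or.inl ⟨h6, fun j hj => by rw [← hD j hj]; exact h6' j hj⟩
    · exact Or.inr ⟨j, hj, by rwa [← hD j hj], fun i hi h => hj2 i hi (by rwa [hD i hi]), hj3⟩
  · intro i hi j hj h h'
    exact h7 i hi j hj (by rwa [hD i hi]) (by rwa [hD j hj])

/-- Visiting the branching pair `i`, whose key is the next one, preserves the invariant. -/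
lemma VisitInv.insert {D D' : ℕ → Prop} {s s₂ : Store} {L : List (ℕ × ℕ)} {i : ℕ}
    (hI : VisitInv k Q nx v B key L₀ D s L) (hik : i < k) (hkQ : k < Q)
    (hinj : ∀ j < k, ∀ j' < k, key j = key j' → j = j')
    (hDD : ∀ j < k, D' j ↔ D j ∨ j = i) (hDlt : ∀ j < k, D j → key j < key i)
    (hDgt : ∀ j < k, ¬ D j → j ≠ i → key i < key j) (hLk : ∀ u ∈ L, u.2 < k) (c1 : Br nx i)
    (hBi : B i = v) (hnew : (v, i) ∉ L) (g64 : s₂ 64 0 = node Q (v, i))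
    (g65 : s₂ 65 = Function.update (s 65) i (node Q (v, i)))
    (hrep : (s 64 0 = 0 ∧ ListRep Q s₂ ((v, i) :: L)) ∨
      ∃ c L₁ L₂, L = L₁ ++ c :: L₂ ∧ s 64 0 = node Q c ∧
        ListRep Q s₂ (L₁ ++ c :: (v, i) :: L₂)) :
    ∃ L', VisitInv k Q nx v B key L₀ D' s₂ L' := by
  -- The new block comes right after the block visited last, which has the largest smaller key.
  -- Hence it comes after all blocks of smaller key, and before the current blocks of larger key.
  obtain ⟨L', hrep', hsub, hperm, hlt, hgt⟩ : ∃ L', ListRep Q s₂ L' ∧ L.Sublist L' ∧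
      L'.Perm ((v, i) :: L) ∧ (∀ j < k, D j → [(B j, j), (v, i)].Sublist L') ∧
      (∀ j < k, ¬ D j → ¬ Br nx j → [(v, i), (B j, j)].Sublist L') := by
    rcases hrep with ⟨h0, hrep⟩ | ⟨c, L₁, L₂, rfl, hc, hrep⟩
    · refine ⟨_, hrep, List.sublist_cons_self _ _, List.Perm.refl _, ?_, ?_⟩
      · intro j hj hDj
        rcases hI.prev with h | ⟨j', -, -, -, h⟩
        · exact absurd hDj (h.2 j hj)
        · rw [h0] at h; simp [node] at h
      · intro j hj hDj hbr
        have := (hI.cur j hj (Or.inr hbr)).2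
        exact (List.singleton_sublist.mpr this).cons_cons _
    · refine ⟨_, hrep, ?_, ?_, ?_, ?_⟩
      · exact (List.Sublist.refl L₁).append ((List.sublist_cons_self _ _).cons_cons _)
      · have : (L₁ ++ c :: (v, i) :: L₂).Perm ((L₁ ++ [c]) ++ (v, i) :: L₂) := by simp
        refine this.trans (List.perm_middle.trans ?_)
        simp
      all_goals
        rcases hI.prev with h | ⟨j', hj', hDj', hmax, h⟩
        · rw [h.1] at hc; simp [node] at hc
        obtain rfl : (B j', j') = c := by
          refine node_inj (hj'.trans hkQ) ((hLk c (by simp)).trans hkQ) (h.symm.trans hc)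
      · intro j hj hDj
        apply List.pair_sublist_insert hI.nodup
        rcases (hmax j hj hDj).lt_or_eq with hlt | heq
        · exact Or.inl (hI.ord j hj j' hj' (Or.inl hDj) (Or.inl hDj') hlt)
        · right; rw [hinj j hj j' hj' heq]
      · intro j hj hDj hbr
        apply List.insert_pair_sublist hI.nodup
        refine hI.ord j' hj' j hj (Or.inl hDj') (Or.inr hbr) ?_
        have h1 := hDlt j' hj' hDj'
        have h2 := hDgt j hj hDj (by rintro rfl; exact hbr c1)
        omega
  have hmem : ∀ u, u ∈ L' ↔ u = (v, i) ∨ u ∈ L := fun u => by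
    rw [hperm.mem_iff, List.mem_cons]
  refine ⟨L', hrep', ?_, hI.sub.trans hsub, ?_, ?_, ?_, ?_⟩
  · rw [hperm.nodup_iff, List.nodup_cons]; exact ⟨hnew, hI.nodup⟩
  · intro u
    rw [hmem, hI.mem]
    constructor
    · rintro (rfl | h | ⟨h1, h2, h3, h4⟩)
      · exact Or.inr ⟨rfl, hik, c1, (hDD i hik).mpr (Or.inr rfl)⟩
      · exact Or.inl h
      · exact Or.inr ⟨h1, h2, h3, (hDD _ h2).mpr (Or.inl h4)⟩
    · rintro (h | ⟨h1, h2, h3, h4⟩)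
      · exact Or.inr (Or.inl h)
      · rcases (hDD _ h2).mp h4 with h5 | h5
        · exact Or.inr (Or.inr ⟨h1, h2, h3, h5⟩)
        · exact Or.inl (Prod.ext h1 h5)
  · intro j hj hlive
    rw [g65, hmem]
    by_cases hji : j = i
    · subst hji; rw [hBi]; simp
    · rw [Function.update_of_ne hji]
      rw [hDD j hj] at hlive
      have := hI.cur j hj (by tauto)
      exact ⟨this.1, Or.inr this.2⟩
  · refine Or.inr ⟨i, hik, (hDD i hik).mpr (Or.inr rfl), ?_, by rw [g64, hBi]⟩
    intro j hj h
    rcases (hDD j hj).mp h with h | rfl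
    · exact (hDlt j hj h).le
    · exact le_rfl
  · intro j hj j' hj' h h' hlt'
    rw [hDD j hj] at h
    rw [hDD j' hj'] at h'
    by_cases h1 : j = i
    · subst h1
      have h2 : j' ≠ j := by rintro rfl; omega
      rw [hBi]
      by_cases h3 : D j'
      · have := hDlt j' hj' h3; omega
      · exact hgt j' hj' h3 (by tauto)
    · by_cases h2 : j' = i
      · subst h2
        rw [hBi]
        refine hlt j hj ?_
        by_contra h3
        have := hDgt j hj h3 h1
        omega
      · exact (hI.ord j hj j' hj' (by tauto) (by tauto) hlt').trans hsub

lemma visitProg_spec {D D' : ℕ → Prop} (s : Store) {L : List (ℕ × ℕ)} {i p θ a : ℕ}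
    (hI : VisitInv k Q nx v B key L₀ D s L) (hik : i < k) (hkQ : k < Q) (h63 : s 63 0 = i)
    (h62 : s 62 0 = θ) (h59 : s 5 (s 59 0) = a) (hkey : s 6 (a + i) = key i)
    (hnx : ∀ j, s 18 (s 45 0 + j) = nx j) (h45 : s 45 0 = v * Q) (h61 : s 61 0 = p)
    (hv : s 31 p = v) (hinj : ∀ j < k, ∀ j' < k, key j = key j' → j = j')
    (hB : Br nx i → B i = v) (hL₀ : ∀ u ∈ L₀, u.1 ≠ v) (hL₀' : ∀ u ∈ L₀, u.2 < k)
    (hD : ∀ j < k, D j ↔ key j < θ ∨ (key j = θ ∧ j < i))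
    (hD' : ∀ j < k, D' j ↔ key j < θ ∨ (key j = θ ∧ j < i + 1)) :
    Runs visitProg s 200 fun s' => Frame 64 70 s s' ∧
      ∃ L', VisitInv k Q nx v B key L₀ D' s' L' := by
  apply Runs.le
  · apply Runs.cond
    · intro c
      simp only [Expr.eval, h59, h63, hkey, h62, ne_eq, ne_eq_zero] at c
      apply Runs.skip
      refine ⟨Frame.refl _, L, hI.congr (fun j hj => ?_) fun _ _ _ => rfl⟩
      rw [hD j hj, hD' j hj]
      by_cases hji : j = i
      · subst hji; simp [c]
      · omega
    · intro c
      simp only [Expr.eval, h59, h63, hkey, h62, ne_eq_zero] at c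
      have hDi : ¬ D i := by rw [hD i hik]; omega
      have hDD : ∀ j < k, D' j ↔ D j ∨ j = i := by
        intro j hj
        rw [hD j hj, hD' j hj]
        constructor
        · rintro (h | ⟨h, h'⟩)
          · exact Or.inl (Or.inl h)
          · exact Or.inr (hinj j hj i hik (h.trans c.symm))
        · rintro ((h | h) | rfl)
          · exact Or.inl h
          · exact Or.inr ⟨h.1, by omega⟩
          · exact Or.inr ⟨c, by omega⟩
      have hDlt : ∀ j < k, D j → key j < key i := by
        intro j hj h
        rw [hD j hj] at h
        rcases h with h | ⟨h, h'⟩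
        · omega
        · have := hinj j hj i hik (h.trans c.symm); omega
      have hDgt : ∀ j < k, ¬ D j → j ≠ i → key i < key j := by
        intro j hj h hne
        rw [hD j hj] at h
        have : key j ≠ key i := fun h' => hne (hinj j hj i hik h')
        omega
      have hLk : ∀ u ∈ L, u.2 < k := by
        intro u hu
        rcases (hI.mem u).mp hu with h | h
        exacts [hL₀' u h, h.2.1]
      have e : (brE 63).eval s = 0 ↔ ¬ Br nx i := by rw [← h63]; exact brE_eval hnx
      apply Runs.seq
      apply Runs.cond
      · intro c1
        rw [ne_eq, e, not_not] at c1
        have hBi := hB c1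
        have hnew : (v, i) ∉ L := by
          rw [hI.mem]
          rintro (h | h)
          exacts [hL₀ _ h rfl, hDi h.2.2.2]
        apply (linkProg_spec s hI.rep hI.nodup (fun u hu => (hLk u hu).trans hkQ)
          (hik.trans hkQ) h45 h63 (h61 ▸ hv) hnew ?_).imp
        · rintro s₁ ⟨f1, e65, hrep⟩
          apply Runs.set
          set s₂ := upd s₁ 64 _ _ with hs₂
          have e63 : s₁ 63 0 = i := by rw [f1 63 (by simp), h63]
          have g64 : s₂ 64 0 = node Q (v, i) := by
            simp [hs₂, Expr.eval, e63, e65]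
          have g65 : s₂ 65 = Function.update (s 65) i (node Q (v, i)) := by
            simp [hs₂, e65]
          have f2 : Frame 64 70 s s₂ := (f1.mono (by simp) le_rfl).upd _ _ (by simp) (by simp)
          have frep : ∀ L', ListRep Q s₁ L' → ListRep Q s₂ L' := fun L' h =>
            ⟨by simpa [hs₂] using h.walk, by simpa [hs₂] using h.fst, by simpa [hs₂] using h.snd⟩
          clear_value s₂
          refine ⟨f2, ?_⟩
          exact hI.insert hik hkQ hinj hDD hDlt hDgt hLk c1 hBi hnew g64 g65
            (hrep.imp (fun h => ⟨h.1, frep _ h.2⟩) fun ⟨c, L₁, L₂, h1, h2, h3⟩ =>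
              ⟨c, L₁, L₂, h1, h2, frep _ h3⟩)
        · rcases hI.prev with h | ⟨j, hj, hDj, -, h⟩
          · exact Or.inl h.1
          · exact Or.inr ⟨_, (hI.cur j hj (Or.inl hDj)).2, h⟩
      · intro c1
        rw [e] at c1
        apply Runs.skip
        apply Runs.set
        refine ⟨(Frame.refl s).upd _ _ (by simp) (by simp), L, ?_⟩
        obtain ⟨h1, h2, h3, h4, h5, h6, h7⟩ := hI
        have hlive : ∀ j < k, D' j ∨ ¬ Br nx j → D j ∨ ¬ Br nx j := by
          intro j hj h
          rw [hDD j hj] at h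
          rcases h with (h | rfl) | h
          exacts [Or.inl h, Or.inr c1, Or.inr h]
        refine ⟨⟨by simpa using h1.walk, by simpa using h1.fst, by simpa using h1.snd⟩, h2, h3, ?_,
          ?_, ?_, ?_⟩
        · intro u
          rw [h4]
          refine or_congr_right (and_congr_right fun _ => and_congr_right fun hu =>
            and_congr_right fun hbr => ?_)
          rw [hDD _ hu]
          constructor
          · exact Or.inl
          · rintro (h | h)
            exacts [h, absurd (h ▸ hbr) c1]
        · intro j hj h
          rw [upd_of_ne _ _ _ (by simp)]
          exact h5 j hj (hlive j hj h)
        · refine Or.inr ⟨i, hik, (hDD i hik).mpr (Or.inr rfl), ?_, ?_⟩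
          · intro j hj h
            rcases (hDD j hj).mp h with h | rfl
            · exact (hDlt j hj h).le
            · exact le_rfl
          · simp [Expr.eval, h63, (h5 i hik (Or.inr c1)).1]
        · intro j hj j' hj' h h'
          exact h7 j hj j' hj' (hlive j hj h) (hlive j' hj' h')
  · simp [Expr.cost]

end

end RAM

/-! ### Building the global order of the blocks -/

namespace RAM

/-- Inserts the blocks that start at position `reg 61` and passes to a good state at the next
position. -/
def stepProg : Prog :=
  .seq positionProg
    (.seq (setReg 41 (.sub (.sub nE (.lit 1)) (reg 61)))
      (.seq (setReg 46 (.get 5 (reg 59)))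
        (.seq extendProg (setReg 59 (reg 57)))))

/-- Builds the linked list of all blocks, starting from a good state at the first position. -/
def walkProg : Prog := forTo 61 nE stepProg

section

variable {s : Store} {n k K N Q M : ℕ} {nx cap : ℕ → ℕ → ℕ} {d : ℕ → ℕ} {key : ℕ → ℕ → ℕ}
  {ord : ℕ → ℕ}

lemma positionProg_spec (he : Env s n k K N Q nx cap d key) (hM : 1 ≤ M) (hk : k ≤ M) (hK : K ≤ M)
    (hkQ : k < Q) (a p : ℕ) (ha : s 59 0 = a) (haN : a < N) (hp : s 61 0 = p)
    (hord : s 31 p = ord p) (hordn : ord p < n)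
    (hinj : ∀ j < k, ∀ j' < k, key a j = key a j' → j = j') (hKk : ∀ j < k, key a j < K)
    {L₀ : List (ℕ × ℕ)} (hrep : ListRep Q s L₀) (hL₀ : L₀.Nodup) (hne : ∀ u ∈ L₀, u.1 ≠ ord p)
    (hlt : ∀ u ∈ L₀, u.2 < k)
    (hcur : ∀ j < k, ¬ Br (nx p) j →
      s 65 j = node Q (blockBefore nx ord p j, j) ∧ (blockBefore nx ord p j, j) ∈ L₀)
    (hpair : ∀ i < k, ∀ j < k, ¬ Br (nx p) i → ¬ Br (nx p) j → key a i < key a j →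
      [(blockBefore nx ord p i, i), (blockBefore nx ord p j, j)].Sublist L₀) :
    Runs positionProg s (400 * M * M) fun s' => Frame 45 70 s s' ∧ s' 59 = s 59 ∧ s' 61 = s 61 ∧
      ∃ L, VisitInv k Q (nx p) (ord p) (blockBefore nx ord (p + 1)) (key a) L₀ (fun _ => True)
        s' L := by
  have hblock : ∀ j, ¬ Br (nx p) j → blockBefore nx ord (p + 1) j = blockBefore nx ord p j :=
    fun j h => by rw [blockBefore, if_neg h]
  apply Runs.le
  · apply Runs.seq
    apply Runs.set
    apply Runs.seq
    apply Runs.set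
    simp only [Expr.eval, hp, hord, he.row (ord p) (by omega)]
    apply Runs.forTo K M hM hK (fun θ s' => Frame 45 70 s s' ∧ s' 59 = s 59 ∧ s' 61 = s 61 ∧
      s' 45 0 = ord p * Q ∧ ∃ L, VisitInv k Q (nx p) (ord p) (blockBefore nx ord (p + 1)) (key a)
        L₀ (fun j => key a j < θ) s' L)
    · refine ⟨(((Frame.refl s).upd _ _ ?_ ?_).upd _ _ ?_ ?_).upd _ _ ?_ ?_, ?_, ?_, ?_, L₀, ?_⟩
      any_goals simp
      refine ⟨⟨by simpa using hrep.walk, by simpa using hrep.fst, by simpa using hrep.snd⟩, hL₀,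
        List.Sublist.refl _, by simp, ?_, by simp, ?_⟩
      · intro j hj h
        have h' : ¬ Br (nx p) j := by simpa using h
        rw [hblock j h']
        simpa using hcur j hj h'
      · intro i hi j hj h h' hlt
        have h1 : ¬ Br (nx p) i := by simpa using h
        have h2 : ¬ Br (nx p) j := by simpa using h'
        rw [hblock i h1, hblock j h2]
        exact hpair i hi j hj h1 h2 hlt
    · rintro i s' ⟨h1, -⟩ -
      simp [Expr.eval, h1 4, he.K_eq]
    · rintro θ s₁ hθ ⟨h1, h2, h3, h4, L, hI⟩ h5
      apply Runs.forTo k M hM hk (fun i s' => Frame 45 70 s s' ∧ s' 59 = s 59 ∧ s' 61 = s 61 ∧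
        s' 62 0 = θ ∧
        s' 45 0 = ord p * Q ∧ ∃ L, VisitInv k Q (nx p) (ord p) (blockBefore nx ord (p + 1)) (key a)
          L₀ (fun j => key a j < θ ∨ (key a j = θ ∧ j < i)) s' L)
      · refine ⟨h1.upd _ _ (by simp) (by simp), by simp [h2], by simp [h3], by simp [h5],
          by simp [h4], L, ?_⟩
        refine hI.congr (by simp) fun a h h' => upd_of_ne _ _ _ (by omega)
      · rintro i s' ⟨h1, -⟩ -
        simp [Expr.eval, h1 0, he.k_eq]
      · rintro i s₂ hi ⟨k1, k2, k3, k3', k4, L, kI⟩ k5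
        have he₂ := he.frame k1 (by simp)
        apply (visitProg_spec s₂ (i := i) (p := p) (θ := θ) (a := a * Q)
          (D' := fun j => key a j < θ ∨ (key a j = θ ∧ j < i + 1)) kI hi hkQ k5 k3' ?_ ?_ ?_ k4 ?_
          ?_ hinj ?_ hne hlt (fun _ _ => Iff.rfl) (fun _ _ => Iff.rfl)).imp
        · rintro s₃ ⟨f, L', hI'⟩
          refine ⟨by rw [f 63 (by simp), k5], (k1.trans (f.mono (by simp) le_rfl)).upd _ _ (by simp)
            (by simp), by simp [f 59, k2], by simp [f 61, k3], by simp [f 62, k3'],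
            by simp [f 45, k4], L', ?_⟩
          exact hI'.congr (fun _ _ => Iff.rfl) fun a h h' => upd_of_ne _ _ _ (by omega)
        · rw [k2, ha]; exact he₂.row a (by omega)
        · exact he₂.key_eq a haN i
        · intro j
          rw [k4, ← he.nx_eq p j, hord, he.row _ (by omega), k1 18 (by simp)]
        · rw [k3, hp]
        · rw [k1 31 (by simp), hord]
        · intro h; rw [blockBefore, if_pos h]
      · rintro s₂ ⟨k1, k2, k3, k3', k4, L, kI⟩
        refine ⟨k3', k1.upd _ _ (by simp) (by simp), by simp [k2], by simp [k3], by simp [k4], L,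
          ?_⟩
        refine kI.congr ?_ fun a h h' => upd_of_ne _ _ _ (by omega)
        intro j hj
        omega
    · rintro s' ⟨h1, h2, h3, h4, L, hI⟩
      refine ⟨h1, h2, h3, L, hI.congr ?_ fun _ _ _ => rfl⟩
      intro j hj
      simpa using hKk j hj
  · simp [Expr.cost]
    have h1 : M ≤ M * M := Nat.le_mul_of_pos_right _ hM
    linarith

/-- The state of the construction of the global order of the blocks before position `p`: the list
`L` consists of the blocks that start before `p`, each earlier position has an admissible state that
agrees with `L`, and the state `a` at position `p` agrees with `L` as far as it matters. -/
structure WalkInv (n k K N Q : ℕ) (nx cap : ℕ → ℕ → ℕ) (d : ℕ → ℕ) (key : ℕ → ℕ → ℕ)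
    (ord : ℕ → ℕ) (p : ℕ) (s : Store) (L : List (ℕ × ℕ)) : Prop where
  rep : ListRep Q s L
  nodup : L.Nodup
  mem : ∀ u, u ∈ L ↔ ∃ p' < p, u.1 = ord p' ∧ u.2 < k ∧ Br (nx p') u.2
  state : s 59 0 < N
  good : Good n k K N nx cap d key (n - p) (s 59 0)
  cur : 0 < p → ∀ j < k, s 65 j = node Q (blockBefore nx ord p j, j) ∧
    (blockBefore nx ord p j, j) ∈ L
  pair : 0 < p → ∀ i < k, ∀ j < k, ¬ Br (nx p) i → ¬ Br (nx p) j →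
    key (s 59 0) i < key (s 59 0) j →
    [(blockBefore nx ord p i, i), (blockBefore nx ord p j, j)].Sublist L
  done : ∀ p' < p, ∃ a < N, OkAt k K (nx p') (cap p') d (key a) ∧
    ∀ i < k, ∀ j < k, key a i < key a j →
      [(blockBefore nx ord (p' + 1) i, i), (blockBefore nx ord (p' + 1) j, j)].Sublist L

lemma stepProg_spec (he : Env s n k K N Q nx cap d key) (hM : 1 ≤ M) (hk : k ≤ M) (hN : N ≤ M)
    (hK : K ≤ M) (hkQ : k < Q) (p : ℕ) (hpn : p < n) (hp : s 61 0 = p)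
    (hord : ∀ p < n, s 31 p = ord p ∧ ord p < n)
    (hordi : ∀ p < n, ∀ p' < n, ord p = ord p' → p = p')
    (hinj : ∀ a < N, ∀ j < k, ∀ j' < k, key a j = key a j' → j = j')
    (hKk : ∀ a < N, ∀ j < k, key a j < K) (hbr : ∀ j < k, Br (nx 0) j)
    (hgood : ∀ r ≤ n, ∀ a < N, s 40 ((n - r) * Q + a) ≠ 0 ↔ Good n k K N nx cap d key r a)
    {L : List (ℕ × ℕ)} (hw : WalkInv n k K N Q nx cap d key ord p s L) :
    Runs stepProg s (1200 * M * M * M) fun s' => Frame 41 70 s s' ∧ s' 61 = s 61 ∧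
      ∃ L', WalkInv n k K N Q nx cap d key ord (p + 1) s' L' := by
  obtain ⟨a, ha⟩ : ∃ a, s 59 0 = a := ⟨_, rfl⟩
  have haN : a < N := ha ▸ hw.state
  have hp0 : ∀ j < k, ¬ Br (nx p) j → 0 < p := by
    intro j hj h
    rcases Nat.eq_zero_or_pos p with rfl | h0
    exacts [absurd (hbr j hj) h, h0]
  apply Runs.le
  · apply Runs.seq
    apply (positionProg_spec he hM hk hK hkQ a p ha haN hp (hord p hpn).1 (hord p hpn).2
      (hinj a haN) (hKk a haN) hw.rep hw.nodup ?_ ?_ ?_ ?_).imp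
    · rintro s₁ ⟨f1, f59, f61, L₁, hI⟩
      apply Runs.seq
      apply Runs.set
      apply Runs.seq
      apply Runs.set
      have he₁ := he.frame f1 (by simp)
      have e59 : s₁ 59 0 = a := by rw [f59, ha]
      have e61 : s₁ 61 0 = p := by rw [f61, hp]
      simp only [Expr.eval, he₁.n_eq, e61, upd_of_ne _ _ _ (by simp : 59 ≠ 41), e59,
        upd_of_ne _ _ _ (by simp : 5 ≠ 41), he₁.row a (by omega)]
      set s₂ := upd (upd s₁ _ _ _) _ _ _ with hs₂
      have f2 : Frame 41 70 s s₂ :=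
        ((f1.mono (by simp) le_rfl).upd _ _ (by simp) (by simp)).upd _ _ (by simp) (by simp)
      have g61 : s₂ 61 = s 61 := by simp [hs₂, f61]
      have g41 : s₂ 41 0 = n - 1 - p := by simp [hs₂]
      have g46 : s₂ 46 0 = a * Q := by simp [hs₂]
      have g40 : s₂ 40 = s 40 := by simp [hs₂, f1 40]
      have gI : VisitInv k Q (nx p) (ord p) (blockBefore nx ord (p + 1)) (key a) L (fun _ => True)
          s₂ L₁ := hI.congr (fun _ _ => Iff.rfl) fun b h h' => by
        rw [hs₂, upd_of_ne _ _ _ (by omega), upd_of_ne _ _ _ (by omega)]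
      clear_value s₂
      have he₂ := he.frame f2 (by simp)
      have e1 : n - (n - 1 - p) = p + 1 := by omega
      have hG := hw.good
      rw [ha, show n - p = (n - 1 - p) + 1 by omega, Good, show n - 1 - (n - 1 - p) = p by omega,
        e1] at hG
      apply Runs.seq
      apply (extendProg_spec he₂ hM hk hN a (n - 1 - p) g41 ?_ ?_).imp
      · rintro s₃ ⟨f3, h3, h4⟩
        rw [e1] at h3 h4
        obtain ⟨q1, q2, q3⟩ := h3 (h4.mpr hG.2)
        clear h3 h4
        have hG1 := hG.1
        clear hG
        rw [show n - 1 - p = n - (p + 1) by omega] at q2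
        apply Runs.set
        simp only [Expr.eval]
        set b := s₃ 57 0 with hb
        refine ⟨(f2.trans (f3.mono (by simp) (by simp))).upd _ _ (by simp) (by simp),
          by simp [f3 61, g61], L₁, ?_⟩
        have gI' : VisitInv k Q (nx p) (ord p) (blockBefore nx ord (p + 1)) (key a) L
            (fun _ => True) (upd s₃ 59 0 b) L₁ := gI.congr (fun _ _ => Iff.rfl) fun c h h' => by
          rw [upd_of_ne _ _ _ (by omega), f3 c (by omega)]
        obtain ⟨i1, i2, i3, i4, i5, i6, i7⟩ := gI'
        refine ⟨i1, i2, ?_, by simpa using q1, ?_, fun _ j hj => i5 j hj (Or.inl trivial), ?_, ?_⟩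
        · intro u
          rw [i4, hw.mem]
          constructor
          · rintro (⟨p', h1, h2⟩ | ⟨h1, h2, h3, -⟩)
            · exact ⟨p', by omega, h2⟩
            · exact ⟨p, by omega, h1, h2, h3⟩
          · rintro ⟨p', h1, h2, h3, h4⟩
            rcases Nat.lt_succ_iff_lt_or_eq.mp h1 with h1 | rfl
            · exact Or.inl ⟨p', h1, h2, h3, h4⟩
            · exact Or.inr ⟨h2, h3, h4, trivial⟩
        · simpa using q2
        · intro _ i hi j hj h h' hlt
          simp only [upd_same, if_true] at hlt
          refine i7 i hi j hj (Or.inl trivial) (Or.inl trivial) ?_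
          by_contra hcon
          rcases (not_lt.mp hcon).lt_or_eq with h5 | h5
          · have := q3 j hj i hi h' h h5
            omega
          · have := hinj a haN j hj i hi h5
            subst this
            omega
        · intro p' hp'
          rcases Nat.lt_succ_iff_lt_or_eq.mp hp' with h1 | rfl
          · obtain ⟨a', r1, r2, r3⟩ := hw.done p' h1
            exact ⟨a', r1, r2, fun i hi j hj h => (r3 i hi j hj h).trans i3⟩
          · exact ⟨a, haN, hG1, fun i hi j hj h =>
              i7 i hi j hj (Or.inl trivial) (Or.inl trivial) h⟩
      · intro j
        rw [g46, he₂.key_eq a haN]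
      · rw [g40]; exact hgood _ (by omega)
    · rintro u hu h
      obtain ⟨p', h1, h2, -⟩ := (hw.mem u).mp hu
      have := hordi p' (by omega) p hpn (h2.symm.trans h)
      omega
    · rintro u hu
      obtain ⟨p', -, -, h3, -⟩ := (hw.mem u).mp hu
      exact h3
    · exact fun j hj h => hw.cur (hp0 j hj h) j hj
    · intro i hi j hj h h' hlt
      exact hw.pair (hp0 i hi h) i hi j hj h h' (by rwa [ha])
  · simp [Expr.cost]
    have h1 : M ≤ M * M := Nat.le_mul_of_pos_right _ hM
    have h2 : M * M ≤ M * M * M := Nat.le_mul_of_pos_right _ hM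
    linarith

lemma walkProg_spec (he : Env s n k K N Q nx cap d key) (hM : 1 ≤ M) (hk : k ≤ M) (hN : N ≤ M)
    (hK : K ≤ M) (hkQ : k < Q) (hn : 1 ≤ n)
    (hord : ∀ p < n, s 31 p = ord p ∧ ord p < n)
    (hordi : ∀ p < n, ∀ p' < n, ord p = ord p' → p = p')
    (hinj : ∀ a < N, ∀ j < k, ∀ j' < k, key a j = key a j' → j = j')
    (hKk : ∀ a < N, ∀ j < k, key a j < K) (hbr : ∀ j < k, Br (nx 0) j)
    (hgood : ∀ r ≤ n, ∀ a < N, s 40 ((n - r) * Q + a) ≠ 0 ↔ Good n k K N nx cap d key r a)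
    (hst : s 59 0 < N) (hst' : Good n k K N nx cap d key n (s 59 0)) (h66 : s 66 0 = 0) :
    Runs walkProg s (1400 * M * M * M * n) fun s' => Frame 41 70 s s' ∧
      ∃ L, WalkInv n k K N Q nx cap d key ord n s' L := by
  apply Runs.le
  · apply Runs.forTo n n hn le_rfl (fun p s' => Frame 41 70 s s' ∧
      ∃ L, WalkInv n k K N Q nx cap d key ord p s' L)
    · refine ⟨(Frame.refl s).upd _ _ (by simp) (by simp), [], ⟨by simpa [Walk], by simp, by simp⟩,
        by simp, by simp, by simpa, by simpa, by simp, by simp, by simp⟩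
    · rintro i s' ⟨h1, -⟩ -
      simp [Expr.eval, h1 0, he.n_eq]
    · rintro p s' hp ⟨h1, L, hw⟩ h3
      apply (stepProg_spec (he.frame h1 (by simp)) hM hk hN hK hkQ p hp h3 ?_ hordi hinj hKk hbr
        ?_ hw).imp
      · rintro s₁ ⟨k1, k2, L', hw'⟩
        refine ⟨by rw [k2, h3], (h1.trans k1).upd _ _ (by simp) (by simp), L', ?_⟩
        obtain ⟨⟨w1, w2, w3⟩, w4, w5, w6, w7, w8, w9, w10⟩ := hw'
        exact ⟨⟨by simpa using w1, by simpa using w2, by simpa using w3⟩, w4, w5, by simpa using w6,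
          by simpa using w7, by simpa using w8, by simpa using w9, w10⟩
      · rw [h1 31 (by simp)]; exact hord
      · rw [h1 40 (by simp)]; exact hgood
    · exact fun s' h => h
  · simp [Expr.cost]
    have h1 : n ≤ M * M * M * n := Nat.le_mul_of_pos_left _ (by positivity)
    nlinarith

end

end RAM

/-! ### Writing the answer -/

namespace RAM

/-- Searches a good state at the first position. Register `60` is cleared if there is one, and then
register `59` contains it. -/
def findProg : Prog :=
  .seq (setReg 60 (.lit 1))
    (forTo 61 (reg 3) (.cond (.get 40 (reg 61)) (.seq (setReg 60 (.lit 0)) (setReg 59 (reg 61)))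
      .skip))

lemma findProg_spec (s : Store) {N M : ℕ} (hM : 1 ≤ M) (hN : N ≤ M) (h3 : s 3 0 = N) :
    Runs findProg s (100 * M) fun s' => Frame 59 62 s s' ∧
      (s' 60 0 = 0 → s' 59 0 < N ∧ s 40 (s' 59 0) ≠ 0) ∧
      (s' 60 0 = 0 ↔ ∃ a < N, s 40 a ≠ 0) := by
  apply Runs.le
  · apply Runs.seq
    apply Runs.set
    apply Runs.forTo N M hM hN (fun j s' => Frame 59 62 s s' ∧
      (s' 60 0 = 0 → s' 59 0 < N ∧ s 40 (s' 59 0) ≠ 0) ∧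
      (s' 60 0 = 0 ↔ ∃ a < j, s 40 a ≠ 0))
    · refine ⟨((Frame.refl s).upd _ _ ?_ ?_).upd _ _ ?_ ?_, ?_⟩ <;> simp [Expr.eval]
    · rintro j s' ⟨h1, -⟩ -
      simp [Expr.eval, h1 3, h3]
    · rintro j s' hj ⟨h1, h2, h4⟩ h5
      have e40 : s' 40 = s 40 := h1 40 (by simp)
      apply Runs.cond
      · intro c
        simp only [Expr.eval, h5, e40] at c
        apply Runs.seq
        apply Runs.set
        apply Runs.set
        refine ⟨by simp [h5], ((h1.upd _ _ (by simp) (by simp)).upd _ _ (by simp) (by simp)).upd _ _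
          (by simp) (by simp), ?_, ?_⟩
        · intro _
          simpa [Expr.eval, h5] using ⟨hj, c⟩
        · simp only [Expr.eval]
          simpa using ⟨j, by omega, c⟩
      · intro c
        simp only [Expr.eval, h5, e40] at c
        apply Runs.skip
        refine ⟨h5, h1.upd _ _ (by simp) (by simp), by simpa using h2, ?_⟩
        rw [upd_of_ne _ _ _ (by simp), h4]
        constructor
        · rintro ⟨a, ha, ha'⟩
          exact ⟨a, by omega, ha'⟩
        · rintro ⟨a, ha, ha'⟩
          rcases Nat.lt_succ_iff_lt_or_eq.mp ha with h | rfl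
          exacts [⟨a, h, ha'⟩, absurd c ha']
    · exact fun s' h => h
  · simp [Expr.cost]
    linarith

/-- The output array contains the list `l`. -/
def Out (s : Store) (l : List ℕ) : Prop :=
  s 1 0 = l.length ∧ ∀ j < l.length, s 1 (j + 1) = l.getD j 0

/-- `s` and `s'` agree on the arrays below `80` other than the output. -/
def OutFrame (s s' : Store) : Prop := ∀ a, a ≠ 1 → a < 80 → s' a = s a

lemma OutFrame.refl (s : Store) : OutFrame s s := fun _ _ _ => rfl

lemma OutFrame.trans {s₁ s₂ s₃ : Store} (h : OutFrame s₁ s₂) (h' : OutFrame s₂ s₃) :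
    OutFrame s₁ s₃ := fun a h1 h2 => (h' a h1 h2).trans (h a h1 h2)

lemma OutFrame.upd {s s₁ : Store} (h : OutFrame s s₁) {a : ℕ} (i x : ℕ) (ha : 80 ≤ a) :
    OutFrame s (upd s₁ a i x) := by
  intro b h1 h2
  rw [upd_of_ne _ _ _ (by omega), h b h1 h2]

/-- Appending the value of `x` to the output. -/
def emit (x : Expr) : Prog :=
  .seq (.set 1 (.add (reg 1) (.lit 1)) x) (setReg 1 (.add (reg 1) (.lit 1)))

lemma emit_spec (s : Store) (x : Expr) {l : List ℕ} (h : Out s l) :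
    Runs (emit x) s (x.cost + 20) fun s' => (∀ a, a ≠ 1 → s' a = s a) ∧
      Out s' (l ++ [x.eval s]) := by
  apply Runs.le
  · apply Runs.seq
    apply Runs.set
    apply Runs.set
    refine ⟨fun a ha => by rw [upd_of_ne _ _ _ ha, upd_of_ne _ _ _ ha], ?_, ?_⟩
    · simp [Expr.eval, h.1]
    · intro j hj
      simp only [List.length_append, List.length_singleton] at hj
      simp only [Expr.eval, upd_same, h.1]
      rw [if_neg (by omega)]
      rcases Nat.lt_succ_iff_lt_or_eq.mp hj with h1 | rfl
      · rw [if_neg (by omega), h.2 j h1, List.getD_append _ _ _ _ h1]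
      · simp [List.getD_eq_getElem?_getD]
  · simp [Expr.cost]
    omega

/-- A list of updates as a list of numbers. -/
def flat (A : List (ℕ × ℕ)) : List ℕ := A.flatMap fun u => [u.1, u.2]

lemma flat_append (A B : List (ℕ × ℕ)) : flat (A ++ B) = flat A ++ flat B := by simp [flat]

/-- Appending the values of `x` and `y` to the output. -/
def emitPair (x y : Expr) : Prog := .seq (emit x) (emit y)

lemma emitPair_spec (s : Store) (x y : Expr) (hy : ∀ s', (∀ a, a ≠ 1 → s' a = s a) →
      y.eval s' = y.eval s) {l : List ℕ} {A : List (ℕ × ℕ)} (h : Out s (l ++ flat A)) :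
    Runs (emitPair x y) s (x.cost + y.cost + 40) fun s' => (∀ a, a ≠ 1 → s' a = s a) ∧
      Out s' (l ++ flat (A ++ [(x.eval s, y.eval s)])) := by
  apply Runs.le
  · apply Runs.seq
    apply (emit_spec s x h).imp
    rintro s₁ ⟨h1, h2⟩
    apply (emit_spec s₁ y h2).imp
    rintro s₂ ⟨h3, h4⟩
    refine ⟨fun a ha => (h3 a ha).trans (h1 a ha), ?_⟩
    rw [hy s₁ h1] at h4
    simpa [flat] using h4
  · omega

/-- Appends all updates that satisfy the condition `b` to the output. The condition may refer to the
vertex (register `80`), the index of the pair (register `81`), and the row of the vertex (register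
`82`). -/
def outProg (b : Expr) : Prog :=
  forTo 80 nE (.seq (setReg 82 (.get 5 (reg 80)))
    (forTo 81 kE (.cond b (emitPair (reg 80) (reg 81)) .skip)))

lemma outProg_spec (s : Store) {n k Q M : ℕ} (b : Expr) (P : ℕ → ℕ → Prop) (hn : s 0 0 = n)
    (hk : s 0 2 = k) (hrow : ∀ v < n, s 5 v = v * Q) (hM : 1 ≤ M) (hkM : k ≤ M) (hn1 : 1 ≤ n)
    (hb : ∀ s' v i, OutFrame s s' → v < n → i < k → s' 82 0 = v * Q → s' 81 0 = i →
      (b.eval s' ≠ 0 ↔ P v i)) {l : List ℕ} (hl : Out s l) :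
    Runs (outProg b) s ((b.cost + 150) * M * n) fun s' => OutFrame s s' ∧
      ∃ A : List (ℕ × ℕ), A.Nodup ∧ (∀ u, u ∈ A ↔ u.1 < n ∧ u.2 < k ∧ P u.1 u.2) ∧
        Out s' (l ++ flat A) := by
  apply Runs.le
  · apply Runs.forTo n n hn1 le_rfl (fun v s' => OutFrame s s' ∧
      ∃ A : List (ℕ × ℕ), A.Nodup ∧ (∀ u, u ∈ A ↔ u.1 < v ∧ u.2 < k ∧ P u.1 u.2) ∧
        Out s' (l ++ flat A))
    · exact ⟨(OutFrame.refl s).upd _ _ (by simp), [], by simp, by simp,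
        by simpa [flat, Out] using hl⟩
    · rintro j s' ⟨h1, -⟩ -
      simp [Expr.eval, h1 0, hn]
    · rintro v s' hv ⟨h1, A, hA, hmem, hout⟩ h2
      apply Runs.seq
      apply Runs.set
      simp only [Expr.eval, h2, h1 5 (by simp) (by simp), hrow v hv]
      apply Runs.forTo k M hM hkM (fun i s' => OutFrame s s' ∧ s' 80 0 = v ∧ s' 82 0 = v * Q ∧
        ∃ A : List (ℕ × ℕ), A.Nodup ∧
          (∀ u, u ∈ A ↔ (u.1 < v ∨ u.1 = v ∧ u.2 < i) ∧ u.2 < k ∧ P u.1 u.2) ∧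
          Out s' (l ++ flat A))
      · refine ⟨(h1.upd _ _ (by simp)).upd _ _ (by simp), by simpa, by simp, A, hA, ?_, ?_⟩
        · simpa using hmem
        · simpa [Out] using hout
      · rintro j s' ⟨h1, -⟩ -
        simp [Expr.eval, h1 0, hk]
      · rintro i s₁ hi ⟨k1, k2, k3, A, kA, kmem, kout⟩ k4
        have e := hb s₁ v i k1 hv hi k3 k4
        apply Runs.cond
        · intro c
          rw [e] at c
          apply (emitPair_spec s₁ (reg 80) (reg 81) ?_ kout).imp
          · rintro s₂ ⟨f, hout⟩
            simp only [Expr.eval, k2, k4] at hout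
            have f' : OutFrame s s₂ := k1.trans fun a h _ => f a h
            refine ⟨by rw [f 81 (by simp), k4], f'.upd _ _ (by simp), by simp [f 80, k2],
              by simp [f 82, k3], A ++ [(v, i)], ?_, ?_, by simpa [Out] using hout⟩
            · rw [List.nodup_append]
              refine ⟨kA, by simp, ?_⟩
              rintro x hx y hy rfl
              rw [List.mem_singleton] at hy
              subst hy
              have := (kmem _).mp hx
              omega
            · rintro ⟨x, y⟩
              rw [List.mem_append, kmem, List.mem_singleton, Prod.mk_inj]
              constructor
              · rintro (⟨h, h'⟩ | ⟨rfl, rfl⟩)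
                · exact ⟨by omega, h'⟩
                · exact ⟨by omega, hi, c⟩
              · rintro ⟨h, h'⟩
                by_cases hxy : x = v ∧ y = i
                · exact Or.inr hxy
                · exact Or.inl ⟨by omega, h'⟩
          · intro s' h
            simp [Expr.eval, h 81]
        · intro c
          have c' : ¬ P v i := by rw [← e]; simpa using c
          apply Runs.skip
          refine ⟨k4, k1.upd _ _ (by simp), by simpa using k2, by simpa using k3, A, kA, ?_,
            by simpa [Out] using kout⟩
          rintro ⟨x, y⟩
          rw [kmem]
          constructor
          · rintro ⟨h, h'⟩
            exact ⟨by omega, h'⟩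
          · rintro ⟨h, h'⟩
            refine ⟨?_, h'⟩
            by_contra hcon
            obtain ⟨rfl, rfl⟩ : x = v ∧ y = i := by omega
            exact c' h'.2
      · rintro s₁ ⟨k1, k2, k3, A, kA, kmem, kout⟩
        refine ⟨k2, k1.upd _ _ (by simp), A, kA, ?_, by simpa [Out] using kout⟩
        rintro ⟨x, y⟩
        rw [kmem]
        constructor
        · rintro ⟨h, h'⟩
          exact ⟨by omega, h'⟩
        · rintro ⟨h, h'⟩
          exact ⟨by omega, h'⟩
    · exact fun s' h => h
  · simp [Expr.cost]
    have h1 : 1 * n ≤ M * n := Nat.mul_le_mul_right _ hM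
    nlinarith

/-- Appends the updates on the linked list to the output. -/
def outListProg : Prog :=
  .seq (setReg 80 (.get 66 (.lit 0)))
    (.loop (reg 80) (.seq (emitPair (.get 67 (reg 80)) (.get 68 (reg 80)))
      (setReg 80 (.get 66 (reg 80)))))

lemma outListProg_spec (s : Store) {Q : ℕ} {L : List (ℕ × ℕ)} (hL : ListRep Q s L) {l : List ℕ}
    {A : List (ℕ × ℕ)} (hl : Out s (l ++ flat A)) :
    Runs outListProg s (70 * L.length + 20) fun s' => OutFrame s s' ∧
      Out s' (l ++ flat (A ++ L)) := by
  have key : ∀ (L : List (ℕ × ℕ)) (A : List (ℕ × ℕ)) (s₁ : Store) (a : ℕ), OutFrame s s₁ →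
      s₁ 80 0 = s 66 a → Walk (s 66) a (L.map (node Q)) →
      (∀ u ∈ L, s 67 (node Q u) = u.1) → (∀ u ∈ L, s 68 (node Q u) = u.2) →
      Out s₁ (l ++ flat A) →
      Runs (.loop (reg 80) (.seq (emitPair (.get 67 (reg 80)) (.get 68 (reg 80)))
        (setReg 80 (.get 66 (reg 80))))) s₁ (70 * L.length + 10) fun s' => OutFrame s s' ∧
        Out s' (l ++ flat (A ++ L)) := by
    intro L
    induction L with
    | nil =>
      intro A s₁ a hf h80 hw _ _ hout
      refine ⟨s₁, _, .loopFalse ?_, ?_, hf, by simpa using hout⟩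
      · simpa [Expr.eval, h80, Walk] using hw
      · simp [Expr.cost]
    | cons u L ih =>
      intro A s₁ a hf h80 hw h67 h68 hout
      have hu : s 66 a = node Q u := hw.1
      have h := emitPair_spec s₁ (.get 67 (reg 80)) (.get 68 (reg 80))
        (by intro s' h; simp [Expr.eval, h 80, h 68]) hout
      simp only [Expr.eval, h80, hu, hf 67 (by simp) (by simp), hf 68 (by simp) (by simp),
        h67 u (by simp), h68 u (by simp)] at h
      obtain ⟨s₂, t₂, e2, c2, f2, o2⟩ := h
      have f2' : OutFrame s s₂ := hf.trans fun a h _ => f2 a h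
      obtain ⟨s₃, t₃, e3, c3, f3, o3⟩ := ih (A ++ [(u.1, u.2)]) (upd s₂ 80 0 (s 66 (node Q u)))
        (node Q u) (f2'.upd _ _ (by simp)) (by simp) hw.2
        (fun w hw => h67 w (by simp [hw])) (fun w hw => h68 w (by simp [hw]))
        (by simpa [Out] using o2)
      refine ⟨s₃, _, .loopTrue (t₂ := t₃) ?_ (.seq e2 (.set _ _ _ _)) ?_, ?_, f3, by simpa using o3⟩
      · simp [Expr.eval, h80, hu, node]
      · simpa [Expr.eval, f2 80, f2' 66, h80, hu, upd] using e3
      · simp [Expr.cost] at c2 ⊢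
        omega
  apply Runs.le
  · apply Runs.seq
    apply Runs.set
    exact key L A _ 0 ((OutFrame.refl s).upd _ _ (by simp)) (by simp [Expr.eval]) hL.walk hL.fst
      hL.snd (by simpa [Out] using hl)
  · simp [Expr.cost]
    omega

/-- The program that writes an update sequence: the updates without an old edge to deactivate, those
on the linked list, and those that only deactivate an edge. -/
def answerProg : Prog :=
  .seq (emit (.lit 1))
    (.seq (outProg (.sub (.lit 1) (.get 18 (.add (reg 82) (.add (reg 81) (reg 81))))))
      (.seq outListProg
        (outProg (.sub (.lit 1) (.add
          (.sub (.lit 1) (.get 18 (.add (reg 82) (.add (reg 81) (reg 81)))))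
          (.get 18 (.add (reg 82) (.add (.add (reg 81) (reg 81)) (.lit 1)))))))))

lemma answerProg_spec (s : Store) {n k Q M : ℕ} (hn : s 0 0 = n)
    (hk : s 0 2 = k) (hrow : ∀ v < n, s 5 v = v * Q) (hM : 1 ≤ M) (hkM : k ≤ M) (hn1 : 1 ≤ n)
    {L : List (ℕ × ℕ)} (hL : ListRep Q s L) (hLn : L.Nodup) (hLk : ∀ u ∈ L, u.1 < n ∧ u.2 < k)
    (hout : s 1 0 = 0) :
    Runs answerProg s (1000 * M * n) fun s' => ∃ A C : List (ℕ × ℕ), A.Nodup ∧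
      (∀ u, u ∈ A ↔ u.1 < n ∧ u.2 < k ∧ s 18 (u.1 * Q + (u.2 + u.2)) = 0) ∧ C.Nodup ∧
      (∀ u, u ∈ C ↔ u.1 < n ∧ u.2 < k ∧ s 18 (u.1 * Q + (u.2 + u.2)) ≠ 0 ∧
        s 18 (u.1 * Q + (u.2 + u.2 + 1)) = 0) ∧ Out s' (1 :: flat (A ++ L ++ C)) := by
  have hlen : L.length ≤ M * n := by
    have h : L.toFinset ⊆ Finset.range n ×ˢ Finset.range k := by
      intro u hu
      simpa using hLk u (by simpa using hu)
    have := Finset.card_le_card h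
    rw [List.toFinset_card_of_nodup hLn, Finset.card_product, Finset.card_range,
      Finset.card_range, mul_comm] at this
    exact this.trans (Nat.mul_le_mul_right _ hkM)
  apply Runs.le
  · apply Runs.seq
    apply (emit_spec s (.lit 1) (l := []) ⟨by simpa, by simp⟩).imp
    rintro s₁ ⟨f1, o1⟩
    have f1' : OutFrame s s₁ := fun a h _ => f1 a h
    apply Runs.seq
    apply (outProg_spec s₁ _ (fun v i => s 18 (v * Q + (i + i)) = 0) (by rw [f1 0 (by simp), hn])
      (by rw [f1 0 (by simp), hk]) (by rw [f1 5 (by simp)]; exact hrow) hM hkM hn1 ?_ o1).imp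
    · rintro s₂ ⟨f2, A, hA, hmemA, o2⟩
      replace f2 := f1'.trans f2
      apply Runs.seq
      have hL₂ : ListRep Q s₂ L := ⟨by rw [f2 66 (by simp) (by simp)]; exact hL.walk,
        by rw [f2 67 (by simp) (by simp)]; exact hL.fst,
        by rw [f2 68 (by simp) (by simp)]; exact hL.snd⟩
      apply (outListProg_spec s₂ hL₂ o2).imp
      rintro s₃ ⟨f3, o3⟩
      replace f3 := f2.trans f3
      apply (outProg_spec s₃ _ (fun v i => s 18 (v * Q + (i + i)) ≠ 0 ∧
        s 18 (v * Q + (i + i + 1)) = 0) (by rw [f3 0 (by simp) (by simp), hn])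
        (by rw [f3 0 (by simp) (by simp), hk]) (by rw [f3 5 (by simp) (by simp)]; exact hrow) hM hkM
        hn1 ?_ o3).imp
      · rintro s₄ ⟨-, C, hC, hmemC, o4⟩
        refine ⟨A, C, hA, hmemA, hC, hmemC, ?_⟩
        rw [flat_append]
        simpa only [Expr.eval, List.nil_append, List.append_assoc, List.cons_append] using o4
      · intro s' v i hf hv hi h82 h81
        simp only [Expr.eval, h82, h81, hf 18 (by simp) (by simp), f3 18 (by simp) (by simp)]
        omega
    · intro s' v i hf hv hi h82 h81
      simp only [Expr.eval, h82, h81, hf 18 (by simp) (by simp), f1 18 (by simp)]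
      omega
  · simp [Expr.cost]
    have h1 : 1 ≤ M * n := Nat.mul_pos hM hn1
    nlinarith

end RAM

/-! ### The tables describe the network -/

/-- Every injective ranking of the pairs is induced by the keys of some state. -/
lemma RAM.exists_stateKey {k : ℕ} (g : Fin k → ℕ) (hg : Function.Injective g) :
    ∃ a < k ^ k, ∀ i j : Fin k, stateKey k a i < stateKey k a j ↔ g i < g j := by
  -- The digit of `i` is the number of pairs of smaller rank.
  let r : Fin k → ℕ := fun i => (Finset.univ.filter fun j => g j < g i).card
  have hr : ∀ i, r i < k := by
    intro i
    have h := Finset.card_lt_univ_of_notMem (s := Finset.univ.filter fun j => g j < g i) (x := i)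
      (by simp)
    simpa using h
  have hmono : ∀ i j, g i < g j → r i < r j := by
    intro i j h
    apply Finset.card_lt_card
    rw [Finset.ssubset_iff_of_subset]
    · exact ⟨i, by simpa using h, by simp⟩
    · intro l hl
      simp only [Finset.mem_filter, Finset.mem_univ, true_and] at hl ⊢
      omega
  let a := finFunctionFinEquiv fun i => (⟨r i, hr i⟩ : Fin k)
  have ha : ∀ i : Fin k, (a : ℕ) / k ^ (i : ℕ) % k = r i := by
    intro i
    have h : finFunctionFinEquiv.symm a i = ⟨r i, hr i⟩ := by simp [a]
    simpa [finFunctionFinEquiv] using congrArg Fin.val h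
  have hlt : ∀ i j, g i < g j → stateKey k a i < stateKey k a j := by
    intro i j h
    have h1 := Nat.mul_le_mul_right k (hmono i j h)
    have h2 := i.isLt
    simp only [stateKey, ha]
    rw [Nat.succ_mul] at h1
    omega
  refine ⟨a, a.isLt, fun i j => ⟨fun h => ?_, hlt i j⟩⟩
  rcases lt_trichotomy (g i) (g j) with h1 | h1 | h1
  · exact h1
  · rw [hg h1] at h; exact absurd h (lt_irrefl _)
  · exact absurd h (hlt j i h1).not_gt

lemma RAM.stateKey_lt {k a i : ℕ} (hi : i < k) : stateKey k a i + 1 < k * k + 1 := by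
  have h1 := Nat.mod_lt (a / k ^ i) (by omega : k > 0)
  have h2 := Nat.mul_le_mul_right k h1
  rw [Nat.succ_mul] at h2
  unfold stateKey
  omega

lemma RAM.stateKey_injective {k a i j : ℕ} (hi : i < k) (hj : j < k)
    (h : stateKey k a i = stateKey k a j) : i = j :=
  ((row_inj hi hj).mp h).2

namespace UpdateFlowNetwork

open RAM

variable {n k : ℕ} {G : UpdateFlowNetwork (Fin n) k}

/-- The arrays `f`, `c` and `d`, with rows of length `Q`, contain the successors on the paths, the
capacities and the demands of `G`. -/
structure IsTable (G : UpdateFlowNetwork (Fin n) k) (Q : ℕ) (f c d : ℕ → ℕ) : Prop where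
  old : ∀ i : Fin k, PathCol f Q (i + i) (G.old i)
  new : ∀ i : Fin k, PathCol f Q (i + i + 1) (G.new i)
  cap : ∀ e ∈ G.E, c (e.1 * Q + e.2) = G.c e
  dem : ∀ i : Fin k, d i = G.d i

section

variable {Q : ℕ} {f c d : ℕ → ℕ} (hT : G.IsTable Q f c d)
include hT

namespace IsTable

lemma path (i : Fin k) (b : Prop) [Decidable b] :
    PathCol f Q (i + i + if b then 1 else 0) (G.path i b) := by
  unfold UpdateFlowNetwork.path
  split_ifs
  exacts [hT.new i, hT.old i]

lemma entry_eq_iff {i : Fin k} {b : Prop} [Decidable b] {v w : Fin n} :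
    f (v * Q + (i + i + if b then 1 else 0)) = w + 1 ↔ (v, w) ∈ pathEdges (G.path i b) := by
  refine ⟨fun h => ?_, (hT.path i b).1 v w⟩
  obtain ⟨w', h1, h2⟩ := (hT.path i b).2 v (by omega)
  obtain rfl : w = w' := Fin.ext (by omega)
  exact h2

lemma entry_ne_zero_iff {i : Fin k} {b : Prop} [Decidable b] {v : Fin n} :
    f (v * Q + (i + i + if b then 1 else 0)) ≠ 0 ↔ ∃ w, (v, w) ∈ pathEdges (G.path i b) := by
  constructor
  · intro h
    obtain ⟨w, -, h⟩ := (hT.path i b).2 v h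
    exact ⟨w, h⟩
  · rintro ⟨w, h⟩
    rw [hT.entry_eq_iff.mpr h]
    omega

lemma old_ne_zero_iff {i : Fin k} {v : Fin n} :
    f (v * Q + (i + i)) ≠ 0 ↔ ∃ w, (v, w) ∈ pathEdges (G.old i) := by
  simpa [UpdateFlowNetwork.path] using hT.entry_ne_zero_iff (i := i) (b := False) (v := v)

lemma new_ne_zero_iff {i : Fin k} {v : Fin n} :
    f (v * Q + (i + i + 1)) ≠ 0 ↔ ∃ w, (v, w) ∈ pathEdges (G.new i) := by
  simpa [UpdateFlowNetwork.path] using hT.entry_ne_zero_iff (i := i) (b := True) (v := v)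

lemma br_iff {i : Fin k} {v : Fin n} : Br (fun j => f (v * Q + j)) i ↔ G.Branches i v :=
  and_congr hT.old_ne_zero_iff hT.new_ne_zero_iff

omit hT in
lemma exists_col {j : ℕ} (hj : j < k + k) : ∃ (i : Fin k) (b : Bool),
    j = i + i + if b = true then 1 else 0 := by
  rcases Nat.even_or_odd j with ⟨i, hi⟩ | ⟨i, hi⟩
  · exact ⟨⟨i, by omega⟩, false, by simp [hi]⟩
  · exact ⟨⟨i, by omega⟩, true, by simp; omega⟩

lemma entry_le (u : Fin n) {j : ℕ} (hj : j < k + k) : f (u * Q + j) ≤ n := by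
  obtain ⟨i, b, rfl⟩ := exists_col hj
  by_cases h : f (u * Q + (i + i + if b = true then 1 else 0)) = 0
  · omega
  · obtain ⟨w, h1, -⟩ := (hT.path i (b = true)).2 u h
    have := w.isLt
    omega

lemma entry_pathEdges {u w : Fin n} {j : ℕ} (hj : j < k + k) (h : f (u * Q + j) = w + 1) :
    ∃ (i : Fin k) (b : Bool), (u, w) ∈ pathEdges (G.path i (b = true)) := by
  obtain ⟨i, b, rfl⟩ := exists_col hj
  exact ⟨i, b, hT.entry_eq_iff.mp h⟩

/-- The test at a position of the order decides whether the capacities at its vertex are respected.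
-/
lemma okAt_iff {K : ℕ} {v : Fin n} {key : ℕ → ℕ} :
    OkAt k K (fun j => f (v * Q + j)) (fun j => c (v * Q + j)) d key ↔
      G.OkKey K v fun i => key i := by
  have hsum : ∀ θ (w : Fin n), (∑ i ∈ Finset.range k,
      if hop (fun j => f (v * Q + j)) key θ i = w + 1 then d i else 0) =
      ∑ i with (v, w) ∈ pathEdges (G.path i (key i < θ)), G.d i := by
    intro θ w
    rw [Finset.sum_range, Finset.sum_filter]
    refine Finset.sum_congr rfl fun i _ => ?_
    rw [hT.dem i]
    exact if_congr hT.entry_eq_iff rfl rfl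
  constructor
  · intro h θ hθ w hw
    by_cases hex : ∃ i : Fin k, (v, w) ∈ pathEdges (G.path i (key i < θ))
    · obtain ⟨i, hi⟩ := hex
      have e : hop (fun j => f (v * Q + j)) key θ i = w + 1 := hT.entry_eq_iff.mpr hi
      have := h θ hθ i i.isLt (by rw [e]; omega)
      rw [e, hsum] at this
      simpa [hT.cap _ hw] using this
    · rw [Finset.filter_false_of_mem]
      · simp
      · exact fun i _ hi => hex ⟨i, hi⟩
  · intro h θ hθ i hi hne
    obtain ⟨w, e, hw⟩ := (hT.path ⟨i, hi⟩ (key i < θ)).2 v hne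
    have e' : hop (fun j => f (v * Q + j)) key θ i = w + 1 := e
    have hE : (v, w) ∈ G.E := (G.path_flow ⟨i, hi⟩ (key i < θ)).edges _ hw
    rw [e', hsum]
    simpa [hT.cap _ hE] using h θ hθ w hE

/-- The source is the only vertex without incoming edges. -/
lemma entryCount_eq_zero_iff (w : Fin n) :
    entryCount n (k + k) (fun u j => f (u * Q + j)) (fun _ _ => True) w = 0 ↔ w = G.s := by
  rw [entryCount_eq_zero]
  constructor
  · intro h
    by_contra hw
    obtain ⟨i, b, hb⟩ : ∃ (i : Fin k) (b : Bool), w ∈ G.path i (b = true) := by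
      obtain ⟨i, hi | hi⟩ := G.vertex_cover w
      exacts [⟨i, false, by simpa [UpdateFlowNetwork.path]⟩,
        ⟨i, true, by simpa [UpdateFlowNetwork.path]⟩]
    obtain ⟨u, hu⟩ := (G.path_flow i _).exists_pred hb hw
    refine h u u.isLt (i + i + if b = true then 1 else 0) ?_ (hT.entry_eq_iff.mpr hu) trivial
    have := i.isLt
    split_ifs <;> omega
  · rintro rfl u hu j hj h -
    obtain ⟨i, b, hi⟩ := hT.entry_pathEdges (u := ⟨u, hu⟩) hj h
    exact (G.path_flow i _).not_edge_source _ hi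

end IsTable

end

/-- In an acyclic network the number of ancestors increases along every edge. -/
lemma exists_rank (hG : G.Acyclic) : ∃ rank : ℕ → ℕ, ∀ u w : Fin n, (u, w) ∈ G.E →
    rank u < rank w := by
  classical
  refine ⟨fun x => if h : x < n then (Finset.univ.filter fun v =>
    Relation.TransGen (fun u w => (u, w) ∈ G.E) v ⟨x, h⟩).card else 0, fun u w huw => ?_⟩
  simp only [Fin.is_lt, dif_pos, Fin.eta]
  apply Finset.card_lt_card
  rw [Finset.ssubset_iff_of_subset]
  · exact ⟨u, by simpa using Relation.TransGen.single huw, by simpa using hG u⟩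
  · intro v hv
    simp only [Finset.mem_filter, Finset.mem_univ, true_and] at hv ⊢
    exact hv.tail huw

lemma exists_map_val {n : ℕ} {L : List ℕ} (h : ∀ x ∈ L, x < n) :
    ∃ L' : List (Fin n), L'.map (fun v : Fin n => (v : ℕ)) = L :=
  ⟨L.pmap Fin.mk h, by simp [List.map_pmap]⟩

lemma idxOf_map_of_injective {α β : Type*} [DecidableEq α] [DecidableEq β] {g : α → β}
    (hg : Function.Injective g) (L : List α) (x : α) : (L.map g).idxOf (g x) = L.idxOf x := by
  induction L with
  | nil => rfl
  | cons a L ih =>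
    by_cases h : a = x
    · subst h; simp
    · rw [List.map_cons, List.idxOf_cons_ne _ (fun h' => h (hg h')), List.idxOf_cons_ne _ h, ih]

lemma IsTable.exists_isTopo {Q : ℕ} {f c d : ℕ → ℕ} (hT : G.IsTable Q f c d) {L : List ℕ}
    (hn : L.Nodup) (hlen : L.length = n) (hlt : ∀ x ∈ L, x < n)
    (hidx : ∀ u < n, ∀ j < k + k, ∀ w, f (u * Q + j) = w + 1 → L.idxOf u < L.idxOf w) :
    ∃ L' : List (Fin n), L'.map (fun v : Fin n => (v : ℕ)) = L ∧ G.IsTopo L' := by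
  obtain ⟨L', rfl⟩ := exists_map_val hlt
  have hn' : L'.Nodup := hn.of_map _
  refine ⟨L', rfl, hn', fun v => ?_, fun i b _ u w h => ?_⟩
  · have h : L'.toFinset = Finset.univ := by
      rw [← Finset.card_eq_iff_eq_univ, List.toFinset_card_of_nodup hn', Fintype.card_fin]
      simpa using hlen
    rw [← List.mem_toFinset, h]
    exact Finset.mem_univ v
  · have := hidx u u.isLt (i + i + if b then 1 else 0) (by have := i.isLt; split_ifs <;> omega) w
      (hT.entry_eq_iff.mpr h)
    rwa [idxOf_map_of_injective Fin.val_injective, idxOf_map_of_injective Fin.val_injective] at this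

end UpdateFlowNetwork

/-! ### Correctness of the search -/

namespace UpdateFlowNetwork

open RAM

variable {n k : ℕ} {G : UpdateFlowNetwork (Fin n) k}

lemma IsTopo.length_eq {L : List (Fin n)} (hL : G.IsTopo L) : L.length = n := by
  have h : L.toFinset = Finset.univ := by
    ext v
    simpa using hL.complete v
  have := List.toFinset_card_of_nodup hL.nodup
  rw [h, Finset.card_univ, Fintype.card_fin] at this
  exact this.symm

lemma IsTopo.exists_idxOf {L : List (Fin n)} (hL : G.IsTopo L) {p : ℕ} (hp : p < n) :
    ∃ v, L.idxOf v = p := by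
  have : p < L.length := by rwa [hL.length_eq]
  exact ⟨L[p], hL.nodup.idxOf_getElem p this⟩

lemma IsTopo.idxOf_lt {L : List (Fin n)} (hL : G.IsTopo L) (v : Fin n) : L.idxOf v < n := by
  have := List.idxOf_lt_length_of_mem (hL.complete v)
  rwa [hL.length_eq] at this

lemma IsTopo.block_of_not_branches {L : List (Fin n)} (hL : G.IsTopo L) {i : Fin k} {v : Fin n}
    {p : ℕ} (hp : L.idxOf v = p + 1) (h : ¬ G.Branches i v) :
    G.block L i (p + 1) = G.block L i p := by
  have := hL.getD_idxOf v
  rw [hp] at this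
  rw [block, this, if_neg h]

/-- The tables `nx` and `cap` contain the rows of the vertices in the order `L`, which is also
listed in `ord`. -/
structure IsOrderedTable (G : UpdateFlowNetwork (Fin n) k) (L : List (Fin n)) (Q : ℕ)
    (f c d : ℕ → ℕ) (nx cap : ℕ → ℕ → ℕ) (ord : ℕ → ℕ) : Prop where
  table : G.IsTable Q f c d
  topo : G.IsTopo L
  ord_eq : ∀ v : Fin n, ord (L.idxOf v) = v
  nx_eq : ∀ v : Fin n, nx (L.idxOf v) = fun j => f (v * Q + j)
  cap_eq : ∀ v : Fin n, cap (L.idxOf v) = fun j => c (v * Q + j)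

namespace IsOrderedTable

variable {L : List (Fin n)} {Q : ℕ} {f c d : ℕ → ℕ} {nx cap : ℕ → ℕ → ℕ} {ord : ℕ → ℕ}
  (h : G.IsOrderedTable L Q f c d nx cap ord)
include h

lemma br_iff {i : Fin k} (v : Fin n) : Br (nx (L.idxOf v)) i ↔ G.Branches i v := by
  rw [h.nx_eq, h.table.br_iff]

lemma okAt_iff {K : ℕ} {key : ℕ → ℕ} (v : Fin n) :
    OkAt k K (nx (L.idxOf v)) (cap (L.idxOf v)) d key ↔ G.OkKey K v fun i => key i := by
  rw [h.nx_eq, h.cap_eq, h.table.okAt_iff]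

lemma br_zero (hst : G.s ≠ G.t) : ∀ j < k, Br (nx 0) j := by
  intro j hj
  rw [← h.topo.idxOf_source]
  exact (h.br_iff (i := ⟨j, hj⟩) G.s).mpr (branches_source hst _)

lemma blockBefore_eq (hst : G.s ≠ G.t) (i : Fin k) :
    ∀ {p}, p < n → blockBefore nx ord (p + 1) i = G.block L i p := by
  intro p
  induction p with
  | zero =>
    intro _
    rw [blockBefore, if_pos (h.br_zero hst i i.isLt), block, ← h.ord_eq, h.topo.idxOf_source]
  | succ p ih =>
    intro hp
    obtain ⟨v, hv⟩ := h.topo.exists_idxOf hp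
    have h1 := h.br_iff (i := i) v
    have h2 := h.ord_eq v
    rw [hv] at h1 h2
    rw [blockBefore, h1]
    by_cases hb : G.Branches i v
    · have h3 := h.topo.block_idxOf hb
      rw [hv] at h3
      rw [if_pos hb, h3, h2]
    · rw [if_neg hb, h.topo.block_of_not_branches hv hb, ih (by omega)]

/-- A feasible update sequence yields a compatible choice of states. -/
lemma exists_good {K : ℕ} {key : ℕ → ℕ → ℕ}
    (hkey : ∀ a < k ^ k, ∀ i < k, key a i = stateKey k a i) {σ : List (Fin n × Fin k)}
    (hσ : G.Feasible σ) : ∃ a < k ^ k, Good n k K (k ^ k) nx cap d key n a := by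
  have hn : 0 < n := Fin.pos G.s
  let g : ℕ → Fin k → ℕ := fun p i => σ.idxOf (G.block L i p, i)
  have hg : ∀ p, Function.Injective (g p) := by
    intro p i j hij
    have := (List.idxOf_inj (hσ.complete (G.block L i p, i))).mp hij
    exact (Prod.mk.inj this).2
  choose a ha hag using fun p => exists_stateKey (g p) (hg p)
  have hag' : ∀ p (i j : Fin k), key (a p) i < key (a p) j ↔ g p i < g p j := by
    intro p i j
    rw [hkey _ (ha p) i i.isLt, hkey _ (ha p) j j.isLt, hag]
  have hok : ∀ p < n, OkAt k K (nx p) (cap p) d (key (a p)) := by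
    intro p hp
    obtain ⟨v, rfl⟩ := h.topo.exists_idxOf hp
    rw [h.okAt_iff]
    intro θ _ w hw
    -- A threshold for the keys of the state is one for the times of the switches as well.
    obtain ⟨θ', hθ', he⟩ := exists_threshold (B := σ.length) (g (L.idxOf v))
      (fun i => key (a (L.idxOf v)) i < θ) (by
        intro i j hij hj
        rcases hij.lt_or_eq with hij | hij
        · exact ((hag' _ i j).mpr hij).trans hj
        · rwa [hg _ hij]) (fun i => List.idxOf_lt_length_of_mem (hσ.complete _))
    have := hσ.okKey h.topo (σ.length + 1) v θ' (by omega) w hw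
    refine le_trans (le_of_eq ?_) this
    refine Finset.sum_congr ?_ fun _ _ => rfl
    ext i
    simp only [Finset.mem_filter, Finset.mem_univ, true_and]
    rw [path_congr _ (he i)]
  have key' : ∀ r, r < n → Good n k K (k ^ k) nx cap d key (r + 1) (a (n - 1 - r)) := by
    intro r
    induction r with
    -- Behind the last position every state counts as good, and there is nothing to agree on.
    | zero => exact fun _ => ⟨hok _ (by omega), a (n - 1 - 0), ha _, trivial, fun _ _ _ _ _ _ => id⟩
    | succ r ih =>
      intro hr
      refine ⟨hok _ (by omega), a (n - 1 - r), ha _, ih (by omega), ?_⟩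
      obtain ⟨p, hp⟩ : ∃ p, n - 1 - r = p + 1 := ⟨n - 1 - r - 1, by omega⟩
      rw [show n - (r + 1) = p + 1 by omega, hp, show n - 1 - (r + 1) = p by omega]
      obtain ⟨v, hv⟩ := h.topo.exists_idxOf (show p + 1 < n by omega)
      intro i hi j hj hbi hbj hlt
      rw [← hv] at hbi hbj
      have h1 := h.topo.block_of_not_branches hv ((h.br_iff (i := ⟨i, hi⟩) v).not.mp hbi)
      have h2 := h.topo.block_of_not_branches hv ((h.br_iff (i := ⟨j, hj⟩) v).not.mp hbj)
      rw [hag' p ⟨i, hi⟩ ⟨j, hj⟩] at hlt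
      rw [hag' (p + 1) ⟨i, hi⟩ ⟨j, hj⟩]
      simp only [g, h1, h2]
      exact hlt
  have := key' (n - 1) (by omega)
  rw [show n - 1 + 1 = n by omega] at this
  exact ⟨_, ha _, this⟩

/-- The update sequence assembled from the list of the blocks is feasible. -/
lemma feasible_of_walkInv (hst : G.s ≠ G.t) {key : ℕ → ℕ → ℕ}
    (hkey : ∀ a < k ^ k, ∀ i < k, key a i = stateKey k a i) {s : Store}
    {A B C : List (Fin n × Fin k)}
    (hw : WalkInv n k (k * k + 1) (k ^ k) Q nx cap d key ord n s
      (B.map fun u => ((u.1 : ℕ), (u.2 : ℕ))))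
    (hA : A.Nodup) (hC : C.Nodup)
    (hA' : ∀ v i, (v, i) ∈ A ↔ ∀ w, (v, w) ∉ pathEdges (G.old i))
    (hC' : ∀ v i, (v, i) ∈ C ↔ (∃ w, (v, w) ∈ pathEdges (G.old i)) ∧
      ∀ w, (v, w) ∉ pathEdges (G.new i)) :
    G.Feasible (A ++ B ++ C) := by
  have hcast : Function.Injective fun u : Fin n × Fin k => ((u.1 : ℕ), (u.2 : ℕ)) := by
    rintro ⟨v, i⟩ ⟨w, j⟩ huv
    simpa [Fin.ext_iff] using huv
  choose a ha hok hord using hw.done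
  have hk : ∀ v (i : Fin k), key (a (L.idxOf v) (h.topo.idxOf_lt v)) i =
      stateKey k (a (L.idxOf v) (h.topo.idxOf_lt v)) i := fun v i => hkey _ (ha _ _) i i.isLt
  refine feasible_of_okKey h.topo (K := k * k + 1)
    (fun v i => key (a (L.idxOf v) (h.topo.idxOf_lt v)) i) hA (hw.nodup.of_map _) hC hA' ?_ hC' ?_
    ?_ ?_ ?_
  · intro v i
    have h1 : (v, i) ∈ B ↔ ((v : ℕ), (i : ℕ)) ∈ B.map fun u => ((u.1 : ℕ), (u.2 : ℕ)) :=
      (List.mem_map_of_injective hcast (a := (v, i))).symm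
    rw [h1, hw.mem]
    constructor
    · rintro ⟨p, hp, e, -, hb⟩
      obtain ⟨w, rfl⟩ := h.topo.exists_idxOf hp
      obtain rfl : v = w := Fin.ext (by rw [← h.ord_eq w]; exact e)
      exact (h.br_iff _).mp hb
    · exact fun hb => ⟨_, h.topo.idxOf_lt v, (h.ord_eq v).symm, i.isLt, (h.br_iff _).mpr hb⟩
  · intro v i
    simp only [hk]
    exact stateKey_lt i.isLt
  · intro v
    exact (h.okAt_iff v).mp (hok _ (h.topo.idxOf_lt v))
  · intro v i j hij
    simp only [hk] at hij
    exact Fin.ext (stateKey_injective i.isLt j.isLt hij)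
  · intro _ v i j hij
    have h1 := hord _ (h.topo.idxOf_lt v) i i.isLt j j.isLt hij
    rw [h.blockBefore_eq hst i (h.topo.idxOf_lt v),
      h.blockBefore_eq hst j (h.topo.idxOf_lt v)] at h1
    obtain ⟨l, hl, he⟩ := List.sublist_map_iff.mp h1
    have : l = [(G.block L i (L.idxOf v), i), (G.block L j (L.idxOf v), j)] :=
      (List.map_injective_iff.mpr hcast (by simpa using he)).symm
    rwa [← this]

end IsOrderedTable

/-- If the source is the terminal, there are no edges, and any order of the updates is feasible. -/
lemma feasible_of_source_eq_terminal (hst : G.s = G.t) {L : List (Fin n)} (hL : G.IsTopo L)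
    {A C : List (Fin n × Fin k)} (hA : A.Nodup) (hC : C.Nodup)
    (hA' : ∀ v i, (v, i) ∈ A ↔ ∀ w, (v, w) ∉ pathEdges (G.old i))
    (hC' : ∀ v i, (v, i) ∈ C ↔ (∃ w, (v, w) ∈ pathEdges (G.old i)) ∧
      ∀ w, (v, w) ∉ pathEdges (G.new i)) :
    G.Feasible (A ++ [] ++ C) := by
  have hold : ∀ i v w, (v, w) ∉ pathEdges (G.old i) := fun i v w hw =>
    source_ne_terminal (i := i) (b := False) (by simpa [path] using hw) hst
  refine feasible_of_okKey hL (K := k + 1) (fun _ i => i) hA (by simp) hC hA' ?_ hC' (by simp) ?_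
    (fun _ => Fin.val_injective) (fun h => absurd hst h)
  · intro v i
    simpa using fun hb : G.Branches i v => hold i v _ hb.1.choose_spec
  · intro v θ _ w hw
    obtain ⟨i, h | h⟩ := G.edge_cover _ hw
    · exact absurd h (hold i v w)
    · exact absurd hst (source_ne_terminal (i := i) (b := True) (by simpa [path] using h))

end UpdateFlowNetwork

/-! ### The program -/

namespace RAM

/-- Computes the tables: row starts, the keys of the states, capacities, demands, successors. -/
def setupProg : Prog :=
  .seq powProg (.seq sizesProg (.seq rowProg (.seq keyProg (.seq capProg pairsProg))))

/-- The whole algorithm. If register `60` is not cleared by `findProg`, there is no good state at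
the first position. If the source is the terminal, no pair ever branches and the linked list stays
empty. -/
def mainProg : Prog :=
  .seq setupProg (.seq sortProg (.seq goodProg (.seq findProg
    (.cond (reg 60) (emit (.lit 0))
      (.seq (.cond (neE (.get 0 (.lit 3)) (.get 0 (.lit 4))) walkProg .skip) answerProg)))))

end RAM

namespace UpdateFlowNetwork

open RAM

variable {n k : ℕ} {G : UpdateFlowNetwork (Fin n) k}

lemma encode_eq (es : List (Fin n × Fin n)) : G.encode es =
    [n, es.length, k, (G.s : ℕ), (G.t : ℕ)] ++
    (es.flatMap (fun e => [(e.1 : ℕ), (e.2 : ℕ), G.c e]) ++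
    (List.finRange k).flatMap fun i =>
      [G.d i] ++ ((G.old i).length :: (G.old i).map fun v : Fin n => (v : ℕ)) ++
        ((G.new i).length :: (G.new i).map fun v : Fin n => (v : ℕ))) := by
  have h : ∀ l : List (Fin n), l.flatMap (fun v : Fin n => [(v : ℕ)]) =
      l.map fun v : Fin n => (v : ℕ) := by
    intro l
    induction l with
    | nil => rfl
    | cons v l ih => simp [ih]
  simp [encode, h, Function.comp_def]

lemma setupProg_spec (es : List (Fin n × Fin n)) (hes : es.toFinset = G.E) {N Q M : ℕ}
    (hN : N = k ^ k) (hQ : Q = N + n + 2 * k + 1) (hM : 1 ≤ M) (hk1 : 1 ≤ k) (hkM : k ≤ M)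
    (hNM : N ≤ M) (hn : 1 ≤ n) :
    Runs setupProg (initial (G.encode es)) (1300 * (M * M) * (n + es.length)) fun s =>
      Frame 2 25 (initial (G.encode es)) s ∧ s 3 0 = N ∧ s 4 0 = k * k + 1 ∧
      (∀ x ≤ n + N, s 5 x = x * Q) ∧ (∀ a < N, ∀ i < k, s 6 (a * Q + i) = stateKey k a i) ∧
      G.IsTable Q (s 18) (s 16) (s 17) := by
  set x := G.encode es with hx
  have hrd : ∀ y, y = x → Rd (initial x 0) 0 y := by
    rintro y rfl
    exact rd_initial _
  replace hrd := hrd _ (encode_eq es).symm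
  rw [rd_append] at hrd
  obtain ⟨⟨r0, r1, r2, -⟩, hrd⟩ := hrd
  simp only [List.length_cons, List.length_nil, zero_add, Nat.reduceAdd] at r0 r1 r2 hrd
  apply Runs.le
  · apply Runs.seq
    apply (powProg_spec _ k M hM hkM r2).imp
    rintro s₁ ⟨f1, e3⟩
    apply Runs.seq
    apply (sizesProg_spec s₁ n k N M hM hkM (by rw [f1 0 (by simp), r2])
      (by rw [f1 0 (by simp), r0]) (by rw [e3, hN])).imp
    rintro s₂ ⟨f2, e3', e4, e2⟩
    replace e3' : s₂ 3 0 = N := by rw [e3', e3, hN]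
    replace f2 := (f1.mono (by simp) le_rfl : Frame 2 10 _ _).trans f2
    apply Runs.seq
    apply (rowProg_spec s₂ n N Q (3 * M * n) (by rw [f2 0 (by simp), r0]) e3' (by rw [e2, hQ])
      (by
        have h1 : 1 * n ≤ M * n := Nat.mul_le_mul_right _ hM
        have h2 : N * 1 ≤ M * n := Nat.mul_le_mul hNM hn
        have h3 : 1 ≤ M * n := Nat.mul_pos hM hn
        linarith)).imp
    rintro s₃ ⟨f3, row3⟩
    have g3 := f2.trans (f3.mono (by simp) le_rfl)
    apply Runs.seq
    apply (keyProg_spec s₃ k N Q M n hM hk1 hkM (by rw [g3 0 (by simp), r2])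
      (by rw [f3 3 (by simp), e3']) hNM row3 (by omega)).imp
    rintro s₄ ⟨f4, key4⟩
    have g4 : Frame 2 13 (initial x) s₄ :=
      (g3.mono le_rfl (by simp)).trans (f4.mono (by simp) le_rfl)
    have row4 : ∀ x ≤ n + N, s₄ 5 x = x * Q := by rw [f4 5 (by simp)]; exact row3
    apply Runs.seq
    apply (capProg_spec s₄ (X := n + es.length) es G.c _ row4 (by omega)
      (by rw [g4 0 (by simp), r1]) (by omega) (by omega) (by rw [g4 0 (by simp)]; exact hrd)).imp
    rintro s₅ ⟨f5, rd5, cap5⟩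
    have g5 : Frame 2 17 (initial x) s₅ :=
      (g4.mono le_rfl (by simp)).trans (f5.mono (by simp) le_rfl)
    apply (pairsProg_spec s₅ (X := n) (Y := M) G.d G.old G.new (fun i => (G.old_flow i).nodup)
      (fun i => (G.new_flow i).nodup) (by rw [g5 0 (by simp), r2])
      (by rw [f5 5 (by simp)]; exact row4) (by omega) hn le_rfl hM hkM
      (by intro j; rw [g5 18 (by simp)]; simp [initial])
      (by rw [f5 0 (by simp)]; exact rd5)).imp
    rintro s₆ ⟨f6, e16, h6⟩
    have g6 : Frame 2 25 (initial x) s₆ :=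
      (g5.mono le_rfl (by simp)).trans (f6.mono (by simp) le_rfl)
    refine ⟨g6, ?_, ?_, ?_, ?_, fun i => (h6 i).2.1, fun i => (h6 i).2.2, ?_, fun i => (h6 i).1⟩
    · rw [f6 3 (by simp), f5 3 (by simp), f4 3 (by simp), f3 3 (by simp), e3']
    · rw [f6 4 (by simp), f5 4 (by simp), f4 4 (by simp), f3 4 (by simp), e4]
    · rw [f6 5 (by simp), f5 5 (by simp)]
      exact row4
    · rw [f6 6 (by simp), f5 6 (by simp)]
      exact key4
    · intro e he
      rw [e16]
      exact cap5 e (by rw [← List.mem_toFinset, hes]; exact he)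
  · have h1 : M ≤ M * M := Nat.le_mul_of_pos_right _ hM
    have h2 : (M * M) * 1 ≤ (M * M) * (n + es.length) := Nat.mul_le_mul_left _ (by omega)
    have h3 : M * n ≤ (M * M) * (n + es.length) := Nat.mul_le_mul h1 (by omega)
    have h4 : 1 * (n + es.length) ≤ (M * M) * (n + es.length) :=
      Nat.mul_le_mul_right _ (by omega)
    nlinarith

end UpdateFlowNetwork

namespace UpdateFlowNetwork

open RAM

variable {n k : ℕ} {G : UpdateFlowNetwork (Fin n) k}

lemma exists_map_cast {L : List (ℕ × ℕ)} (h : ∀ u ∈ L, u.1 < n ∧ u.2 < k) :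
    ∃ L' : List (Fin n × Fin k), L'.map (fun u => ((u.1 : ℕ), (u.2 : ℕ))) = L :=
  ⟨L.pmap (fun u hu => (⟨u.1, hu.1⟩, ⟨u.2, hu.2⟩)) h, by simp [List.map_pmap]⟩

lemma mem_map_cast {L : List (Fin n × Fin k)} {v : Fin n} {i : Fin k} :
    ((v : ℕ), (i : ℕ)) ∈ L.map (fun u => ((u.1 : ℕ), (u.2 : ℕ))) ↔ (v, i) ∈ L := by
  refine List.mem_map_of_injective (f := fun u : Fin n × Fin k => ((u.1 : ℕ), (u.2 : ℕ)))
    ?_ (a := (v, i))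
  rintro ⟨v, i⟩ ⟨w, j⟩ huv
  simpa [Fin.ext_iff] using huv

lemma encodeAnswer_some (σ : List (Fin n × Fin k)) : encodeAnswer (some σ) =
    1 :: flat (σ.map fun u => ((u.1 : ℕ), (u.2 : ℕ))) := by
  simp [encodeAnswer, flat, List.flatMap_map]

lemma one_le (G : UpdateFlowNetwork (Fin n) k) : 1 ≤ n ∧ 1 ≤ k := by
  obtain ⟨i, -⟩ := G.vertex_cover G.s
  exact ⟨Fin.pos G.s, Fin.pos i⟩

/-- The program computes a correct answer. -/
lemma mainProg_spec (hG : G.Acyclic) (es : List (Fin n × Fin n)) (hes : es.toFinset = G.E) {M : ℕ}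
    (hM : 1 ≤ M) (hkM : 2 * k ≤ M) (hKM : k * k + 1 ≤ M) (hNM : k ^ k ≤ M) :
    Runs mainProg (initial (G.encode es)) (10000 * (M * M * M * M) * (n + es.length)) fun s =>
      ∃ r, Out s (encodeAnswer r) ∧
        ((∃ σ, r = some σ ∧ G.Feasible σ) ∨ (r = none ∧ ¬ ∃ σ, G.Feasible σ)) := by
  obtain ⟨hn, hk⟩ := one_le G
  obtain ⟨N, hN⟩ : ∃ N, N = k ^ k := ⟨_, rfl⟩
  obtain ⟨Q, hQ⟩ : ∃ Q, Q = N + n + 2 * k + 1 := ⟨_, rfl⟩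
  set x := G.encode es with hx
  have i0 : initial x 0 0 = n := by simp [hx, initial, encode]
  have i2 : initial x 0 2 = k := by simp [hx, initial, encode]
  have i3 : initial x 0 3 = (G.s : ℕ) := by simp [hx, initial, encode]
  have i4 : initial x 0 4 = (G.t : ℕ) := by simp [hx, initial, encode]
  have iz : ∀ a, a ≠ 0 → ∀ j, initial x a j = 0 := fun a ha j => by simp [initial, ha]
  apply Runs.le
  · apply Runs.seq
    apply (setupProg_spec (G := G) es hes hN hQ hM hk (by omega) (by omega) hn).imp
    rintro s₁ ⟨f1, e3, e4, row, key, hT⟩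
    rw [← hx] at f1
    obtain ⟨rank, hrank⟩ := exists_rank hG
    have hin : ∀ w < n,
        entryCount n (k + k) (fun u j => s₁ 18 (u * Q + j)) (fun _ _ => True) w = 0 ↔ w = G.s :=
      fun w hw => (hT.entryCount_eq_zero_iff ⟨w, hw⟩).trans Fin.ext_iff
    have hrk : ∀ u < n, ∀ j < k + k, ∀ w, s₁ 18 (u * Q + j) = w + 1 → rank u < rank w := by
      intro u hu j hj w hw
      have hle := hT.entry_le ⟨u, hu⟩ hj
      have hwn : w < n := by
        simp only at hle
        omega
      obtain ⟨i, b, hb⟩ := hT.entry_pathEdges (u := ⟨u, hu⟩) (w := ⟨w, hwn⟩) hj hw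
      exact hrank ⟨u, hu⟩ ⟨w, hwn⟩ ((G.path_flow i _).edges _ hb)
    apply Runs.seq
    apply (sortProg_spec s₁ (X := n) (Y := M) (src := G.s) (N := N)
      (fun u j => s₁ 18 (u * Q + j)) (by rw [f1 0 (by simp), i2]) (by rw [f1 0 (by simp), i0])
      row hn le_rfl hM (by omega) (by intro j; rw [f1 30 (by simp), iz _ (by simp)])
      (fun _ _ => rfl) (by rw [f1 0 (by simp), i3]) G.s.isLt
      (fun u hu j hj => hT.entry_le ⟨u, hu⟩ hj) hin rank hrk).imp
    rintro s₂ ⟨f2, L₀, hL₀, hlen, hlt, h31, hidx⟩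
    obtain ⟨L, rfl, hL⟩ := hT.exists_isTopo hL₀ hlen hlt hidx
    have hLlen := hL.length_eq
    have f12 : ∀ a, a < 2 ∨ 37 ≤ a → s₂ a = initial x a := fun a ha => by
      rw [f2 a (by omega), f1 a (by omega)]
    have row2 : ∀ x ≤ n + N, s₂ 5 x = x * Q := by rw [f2 5 (by simp)]; exact row
    have hT2 : G.IsTable Q (s₂ 18) (s₂ 16) (s₂ 17) := by
      rw [f2 18 (by simp), f2 16 (by simp), f2 17 (by simp)]; exact hT
    have hord : ∀ v : Fin n, s₂ 31 (L.idxOf v) = v := by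
      intro v
      have h := hL.idxOf_lt v
      rw [h31 _ (by simpa [hLlen] using h)]
      simp
    set nx : ℕ → ℕ → ℕ := fun p j => s₂ 18 (s₂ 5 (s₂ 31 p) + j) with hnx
    set cap : ℕ → ℕ → ℕ := fun p j => s₂ 16 (s₂ 5 (s₂ 31 p) + j) with hcap
    set ky : ℕ → ℕ → ℕ := fun a j => s₂ 6 (a * Q + j) with hky
    have hkey : ∀ a < k ^ k, ∀ i < k, ky a i = stateKey k a i := by
      intro a ha i hi
      simp only [hky, f2 6 (by simp)]
      exact key a (by rwa [hN]) i hi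
    have hO : G.IsOrderedTable L Q (s₂ 18) (s₂ 16) (s₂ 17) nx cap (s₂ 31) := by
      refine ⟨hT2, hL, hord, fun v => ?_, fun v => ?_⟩ <;> funext j
      · simp only [hnx, hord, row2 v (by omega)]
      · simp only [hcap, hord, row2 v (by omega)]
    have he : Env s₂ n k (k * k + 1) N Q nx cap (s₂ 17) ky := by
      refine ⟨by rw [f12 0 (by simp), i0], by rw [f12 0 (by simp), i2], by rw [f2 3 (by simp), e3],
        by rw [f2 4 (by simp), e4], row2, by omega, fun _ _ _ => rfl, rfl, fun _ _ => rfl,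
        fun _ _ => rfl⟩
    clear_value nx cap ky
    apply Runs.seq
    apply (goodProg_spec he hM (by omega) (by omega) hKM hn).imp
    rintro s₃ ⟨f3, hgood⟩
    have he3 := he.frame f3 (by simp)
    apply Runs.seq
    apply (findProg_spec s₃ hM (by omega) he3.N_eq).imp
    rintro s₄ ⟨f4, hfind, hiff⟩
    have he4 := he3.frame f4 (by simp)
    have f34 : Frame 40 62 s₂ s₄ :=
      (f3.mono le_rfl (by simp)).trans (f4.mono (by simp) le_rfl)
    have e40 : s₄ 40 = s₃ 40 := f4 40 (by simp)
    have hgood0 : ∀ a < N, s₃ 40 a ≠ 0 ↔ Good n k (k * k + 1) N nx cap (s₂ 17) ky n a := by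
      intro a ha
      simpa using hgood n le_rfl a ha
    have out0 : s₄ 1 0 = 0 := by rw [f34 1 (by simp), f12 1 (by simp), iz _ (by simp)]
    apply Runs.cond
    · intro c
      simp only [Expr.eval] at c
      apply (emit_spec s₄ (.lit 0) (l := []) ⟨by simpa, by simp⟩).imp
      rintro s₅ ⟨-, hout⟩
      refine ⟨none, hout, Or.inr ⟨rfl, ?_⟩⟩
      rintro ⟨σ, hσ⟩
      obtain ⟨a, ha, hga⟩ := hO.exists_good (K := k * k + 1) hkey hσ
      rw [← hN] at ha hga
      exact c (hiff.mpr ⟨a, ha, (hgood0 a ha).mpr hga⟩)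
    · intro c
      simp only [Expr.eval] at c
      obtain ⟨ha, hga⟩ := hfind c
      rw [hgood0 _ ha] at hga
      apply Runs.seq
      -- Whether or not the source is the terminal, the linked list holds the blocks in an order
      -- that makes the answer feasible.
      let P : List (ℕ × ℕ) → Prop := fun B' => B'.Nodup ∧ (∀ u ∈ B', u.1 < n ∧ u.2 < k) ∧
        ∀ A B C : List (Fin n × Fin k), B.map (fun u => ((u.1 : ℕ), (u.2 : ℕ))) = B' → A.Nodup →
          C.Nodup → (∀ v i, (v, i) ∈ A ↔ ∀ w, (v, w) ∉ pathEdges (G.old i)) →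
          (∀ v i, (v, i) ∈ C ↔ (∃ w, (v, w) ∈ pathEdges (G.old i)) ∧
            ∀ w, (v, w) ∉ pathEdges (G.new i)) → G.Feasible (A ++ B ++ C)
      have hwalk : Runs (.cond (neE (.get 0 (.lit 3)) (.get 0 (.lit 4))) walkProg .skip) s₄
          (12 + (1400 * M * M * M * n + 1)) fun s' => Frame 41 70 s₄ s' ∧
            ∃ B', ListRep Q s' B' ∧ P B' := by
        have e03 : s₄ 0 3 = G.s := by rw [f34 0 (by simp), f12 0 (by simp), i3]
        have e04 : s₄ 0 4 = G.t := by rw [f34 0 (by simp), f12 0 (by simp), i4]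
        have hst : (neE (.get 0 (.lit 3)) (.get 0 (.lit 4))).eval s₄ = 0 ↔ G.s = G.t := by
          simp only [Expr.eval, e03, e04, ne_eq_zero, Fin.ext_iff]
        have z66 : s₄ 66 0 = 0 := by rw [f34 66 (by simp), f12 66 (by simp), iz _ (by simp)]
        refine (Runs.cond (T₁ := 1400 * M * M * M * n) (T₂ := 1) ?_ ?_).le (by simp [Expr.cost])
        · intro c
          rw [ne_eq, hst] at c
          have e31 : s₄ 31 = s₂ 31 := f34 31 (by simp)
          apply (walkProg_spec (ord := s₂ 31) he4 hM (by omega) (by omega) hKM (by omega) hn ?_ ?_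
            ?_ ?_ (hO.br_zero c) ?_ ha hga z66).imp
          · rintro s₅ ⟨f5, B', hw⟩
            refine ⟨f5, B', hw.rep, hw.nodup, ?_, ?_⟩
            · intro u hu
              obtain ⟨p, hp, h1, h2, -⟩ := (hw.mem u).mp hu
              obtain ⟨v, rfl⟩ := hL.exists_idxOf hp
              exact ⟨by rw [h1, hord]; exact v.isLt, h2⟩
            · rintro A B C rfl hA hC hA' hC'
              rw [hN] at hw
              exact hO.feasible_of_walkInv c hkey hw hA hC hA' hC'
          · intro p hp
            obtain ⟨v, rfl⟩ := hL.exists_idxOf hp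
            exact ⟨by rw [e31], by rw [hord]; exact v.isLt⟩
          · intro p hp p' hp' h
            obtain ⟨v, rfl⟩ := hL.exists_idxOf hp
            obtain ⟨v', rfl⟩ := hL.exists_idxOf hp'
            rw [hord, hord] at h
            rw [Fin.ext h]
          · intro a ha j hj j' hj' h
            rw [hkey a (by omega) j hj, hkey a (by omega) j' hj'] at h
            exact stateKey_injective hj hj' h
          · intro a ha j hj
            rw [hkey a (by omega) j hj]
            have := stateKey_lt (a := a) hj
            omega
          · rw [e40]; exact hgood
        · intro c
          rw [hst] at c
          apply Runs.skip
          refine ⟨Frame.refl _, [], ⟨z66, by simp, by simp⟩, by simp, by simp, ?_⟩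
          intro A B C hB hA hC hA' hC'
          obtain rfl : B = [] := by simpa using hB
          exact feasible_of_source_eq_terminal c hL hA hC hA' hC'
      apply hwalk.imp
      rintro s₅ ⟨f5, B', hrep, hB, hBlt, hfeas⟩
      have he5 := he4.frame f5 (by simp)
      have e18 : s₅ 18 = s₂ 18 := by rw [f5 18 (by simp), f34 18 (by simp)]
      apply (answerProg_spec s₅ (M := M) he5.n_eq he5.k_eq (fun v hv => he5.row v (by omega)) hM
        (by omega) hn hrep hB hBlt (by rw [f5 1 (by simp), out0])).imp
      rintro s₆ ⟨A', C', hA, hmA, hC, hmC, hout⟩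
      obtain ⟨A, rfl⟩ := exists_map_cast (fun u hu => ⟨((hmA u).mp hu).1, ((hmA u).mp hu).2.1⟩)
      obtain ⟨B, rfl⟩ := exists_map_cast hBlt
      obtain ⟨C, rfl⟩ := exists_map_cast (fun u hu => ⟨((hmC u).mp hu).1, ((hmC u).mp hu).2.1⟩)
      refine ⟨some (A ++ B ++ C), by simpa [encodeAnswer_some] using hout, Or.inl ⟨_, rfl, ?_⟩⟩
      refine hfeas A B C rfl (hA.of_map _) (hC.of_map _) ?_ ?_
      · intro v i
        rw [← mem_map_cast, hmA, ← not_exists, ← hT2.old_ne_zero_iff, e18]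
        simp
      · intro v i
        rw [← mem_map_cast, hmC, ← not_exists, ← hT2.old_ne_zero_iff, ← hT2.new_ne_zero_iff, e18]
        simp
  · have h0 : 1 ≤ n + es.length := by omega
    have h1 : M * M ≤ M * M * M * M := by
      rw [mul_assoc (M * M)]; exact Nat.le_mul_of_pos_right _ (Nat.mul_pos hM hM)
    have h2 : M ≤ M * M := Nat.le_mul_of_pos_right _ hM
    have h3 : M * M * M ≤ M * M * M * M := Nat.le_mul_of_pos_right _ hM
    have h4 : (M * M) * (n + es.length) ≤ (M * M * M * M) * (n + es.length) :=
      Nat.mul_le_mul_right _ h1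
    have h5 : n * M ≤ (M * M * M * M) * (n + es.length) := by
      rw [mul_comm n]; exact Nat.mul_le_mul (h2.trans h1) (by omega)
    have h6 : (M * M * M * M) * n ≤ (M * M * M * M) * (n + es.length) :=
      Nat.mul_le_mul_left _ (by omega)
    have h7 : (M * M * M) * n ≤ (M * M * M * M) * (n + es.length) :=
      Nat.mul_le_mul h3 (by omega)
    have h8 : M * 1 ≤ (M * M * M * M) * (n + es.length) := Nat.mul_le_mul (h2.trans h1) h0
    simp [Expr.cost]
    nlinarith

end UpdateFlowNetwork

/-- `k ^ k = 2 ^ (k log₂ k)`. -/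
lemma two_rpow_mul_logb {k : ℕ} (hk : 1 ≤ k) :
    (2 : ℝ) ^ ((k : ℝ) * Real.logb 2 k) = (k : ℝ) ^ k := by
  rw [mul_comm, Real.rpow_mul (by norm_num), Real.rpow_logb (by norm_num) (by norm_num)
    (by exact_mod_cast hk), Real.rpow_natCast]

theorem mainTheorem3 :
    ∃ (p : RAM.Prog) (C : ℕ), ∀ (n k : ℕ) (G : UpdateFlowNetwork (Fin n) k), G.Acyclic →
      ∀ es : List (Fin n × Fin n), es.Nodup → es.toFinset = G.E →
        ∃ (r : Option (List (Fin n × Fin k))) (t : ℕ),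
          RAM.Computes p (G.encode es) (UpdateFlowNetwork.encodeAnswer r) t ∧
          (t : ℝ) ≤ C * (2 : ℝ) ^ ((C : ℝ) * ((k : ℝ) * Real.logb 2 k)) * G.size ∧
          ((∃ σ, r = some σ ∧ G.Feasible σ) ∨ (r = none ∧ ¬ ∃ σ, G.Feasible σ)) := by
  refine ⟨RAM.mainProg, 160000, fun n k G hG es hnd hes => ?_⟩
  obtain ⟨-, hk⟩ := G.one_le
  have hN : 1 ≤ k ^ k := Nat.one_le_pow _ _ hk
  have hkN : k ≤ k ^ k := Nat.le_self_pow (by omega) k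
  have hNN : k ^ k ≤ k ^ k * k ^ k := Nat.le_mul_of_pos_right _ hN
  have hkk : k * k ≤ k ^ k * k ^ k := Nat.mul_le_mul hkN hkN
  -- The constant `2 * (k ^ k) ^ 2` bounds the numbers of states, of thresholds, and of columns.
  obtain ⟨s, t, hexec, ht, r, hout, hr⟩ := UpdateFlowNetwork.mainProg_spec hG es hes
    (M := 2 * (k ^ k * k ^ k)) (by omega) (by omega) (by omega) (by omega)
  refine ⟨r, t, ⟨s, hexec, hout⟩, ?_, hr⟩
  have hsize : G.size = n + es.length := by
    rw [FlowNetwork.size, ← hes, List.toFinset_card_of_nodup hnd, Fintype.card_fin]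
  have hpow : (2 : ℝ) ^ (((160000 : ℕ) : ℝ) * ((k : ℝ) * Real.logb 2 k)) =
      ((k : ℝ) ^ k) ^ 160000 := by
    rw [mul_comm, Real.rpow_mul (by norm_num), two_rpow_mul_logb hk, Real.rpow_natCast]
  rw [hpow, hsize]
  have h1 : (1 : ℝ) ≤ (k : ℝ) ^ k := by exact_mod_cast hN
  have h8 : ((k : ℝ) ^ k) ^ 8 ≤ ((k : ℝ) ^ k) ^ 160000 := pow_le_pow_right₀ h1 (by norm_num)
  calc (t : ℝ) ≤ 160000 * ((k : ℝ) ^ k) ^ 8 * ((n + es.length : ℕ) : ℝ) := by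
        have : t ≤ 160000 * (k ^ k) ^ 8 * (n + es.length) := ht.trans (le_of_eq (by ring))
        exact_mod_cast this
    _ ≤ ((160000 : ℕ) : ℝ) * ((k : ℝ) ^ k) ^ 160000 * ((n + es.length : ℕ) : ℝ) := by
        push_cast
        gcongr
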